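/- Let $d\ge 0$, $A=\mathbb C[x_1,\dots,x_d]$, and let $\Omega=\omega\,dx_1\wedge\dots\wedge dx_d$ be a volume form with $\omega$ a unit of $A$ (that is, a nonzero constant). For $i\ge -1$ let $T^i_{\rm poly}$ be the space of polynomial $(i+1)$-vector fields, and let ${\rm div}:T^i_{\rm poly}\to T^{i-1}_{\rm poly}$ be the de Rham differential transported along the isomorphism $\gamma\mapsto\iota_\gamma\Omega$ from polyvector fields to differential forms. Put $[T^i_{\rm poly}]_{\rm div}=\{\gamma\in T^i_{\rm poly}: {\rm div}\,\gamma=0\}$. On $T^\bullet_{\rm poly}\otimes\mathbb C[u]$, with $\deg u=2$, let $d_{\rm div}(\gamma\otimes u^k)={\rm div}(\gamma)\otimes u^{k+1}$. Let $\mathcal D^i_{\rm poly}\subset{\rm Hom}_{\mathbb C}(A^{\otimes(i+1)},A)$ be the space of polydifferential operators, and let $[\mathcal D^{n-1}_{\rm poly}]_{\rm cycl}$ be the subspace of those $\psi$ (extended to smooth functions) such that $$\int_{\mathbb R^d}\psi(f_1,\dots,f_n)\,f_{n+1}\,\Omega=(-1)^n\int_{\mathbb R^d}\psi(f_2,\dots,f_{n+1})\,f_1\,\Omega$$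 for all compactly supported smooth functions $f_1,\dots,f_{n+1}:\mathbb R^d\to\mathbb C$. Then $([\mathcal D^\bullet_{\rm poly}]_{\rm cycl},d_{\rm Hoch})$, with the Hochschild differential, and $(T^\bullet_{\rm poly}\otimes\mathbb C[u],d_{\rm div})$ are complexes, and for all $i\ge -1$ $$H^i([\mathcal D^\bullet_{\rm poly}]_{\rm cycl})\;\simeq\;H^i(T^\bullet_{\rm poly}\otimes\mathbb C[u])\;\simeq\;\begin{cases}[T^i_{\rm poly}]_{\rm div}, & i\le d-1,\\ \mathbb C, & i=d+2k-1,\ k\ge 0,\\ 0, & i=d+2k,\ k\ge 0,\end{cases}$$ as complex vector spaces. For $i\le d-1$ the isomorphism from $[T^i_{\rm poly}]_{\rm div}$ to $H^i([\mathcal D^\bullet_{\rm poly}]_{\rm cycl})$ sends $\gamma$ to the class of the Hochschild–Kostant–Rosenberg cochain $\varphi_{\rm HKR}(\gamma)$, where $\varphi_{\rm HKR}(\xi_1\wedge\dots\wedge\xi_n)(f_1,\dots,f_n)=\frac1{n!}\sum_{\sigma\in S_n}{\rm sgn}(\sigma)\,\xi_{\sigma(1)}(f_1)\cdots\xi_{\sigma(n)}(f_n)$,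 and the isomorphism from $[T^i_{\rm poly}]_{\rm div}$ to $H^i(T^\bullet_{\rm poly}\otimes\mathbb C[u])$ sends $\gamma$ to the class of $\gamma\otimes 1$. -/

import Mathlib

open MeasureTheory
open scoped ContDiff TensorProduct

namespace CyclicHKR

noncomputable section

/-! ### Cohomology of a subcomplex -/

section Cohomology

variable {M : ℕ → Type} [∀ n, AddCommGroup (M n)] [∀ n, Module ℂ (M n)]

/-- The family of subspaces `S` is stable under `D`, and `D` squares to zero on it. -/
def IsSubcomplex (D : ∀ n, M n →ₗ[ℂ] M (n + 1)) (S : ∀ n, Submodule ℂ (M n)) : Prop :=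
  ∀ n, ∀ x ∈ S n, D n x ∈ S (n + 1) ∧ D (n + 1) (D n x) = 0

/-- Cocycles `{x ∈ S n | D x = 0}`. -/
def cocycles (D : ∀ n, M n →ₗ[ℂ] M (n + 1)) (S : ∀ n, Submodule ℂ (M n)) (n : ℕ) :
    Submodule ℂ (M n) :=
  S n ⊓ LinearMap.ker (D n)

/-- Coboundaries `D (S (n - 1))`; there is nothing below position `0`. -/
def coboundaries (D : ∀ n, M n →ₗ[ℂ] M (n + 1)) (S : ∀ n, Submodule ℂ (M n)) :
    ∀ n, Submodule ℂ (M n)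
  | 0 => ⊥
  | n + 1 => (S n).map (D n)

/-- Cohomology at position `n`: cocycles modulo coboundaries. -/
abbrev Cohomology (D : ∀ n, M n →ₗ[ℂ] M (n + 1)) (S : ∀ n, Submodule ℂ (M n)) (n : ℕ) : Type :=
  cocycles D S n ⧸ (coboundaries D S n).submoduleOf (cocycles D S n)

end Cohomology

/-- The polynomial algebra `A = ℂ[x_1, …, x_d]`. -/
abbrev Poly (d : ℕ) : Type := MvPolynomial (Fin d) ℂ

/-! ### Polyvector fields, differential forms, divergence

A volume form is `Ω = w dx_1 ∧ … ∧ dx_d` with `w` a unit of `A`, i.e. a generator of the `A`-module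
of polynomial top degree forms. -/

/-- Polynomial polyvector fields of all degrees: `γ` stands for `∑_I γ_I ∂_I`, where
`∂_I = ∂_{i_1} ∧ … ∧ ∂_{i_k}` for `I = {i_1 < … < i_k}`. -/
abbrev Polyvec (d : ℕ) : Type := Finset (Fin d) → Poly d

/-- Polynomial differential forms of all degrees: `η` stands for `∑_J η_J dx_J`, where
`dx_J = dx_{j_1} ∧ … ∧ dx_{j_m}` for `J = {j_1 < … < j_m}`. -/
abbrev DiffForm (d : ℕ) : Type := Finset (Fin d) → Poly d

/-- The space of `n`-vector fields, i.e. `T_poly^{n-1}`. -/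
def polyvecDeg (d n : ℕ) : Submodule ℂ (Polyvec d) where
  carrier := {γ | ∀ I, I.card ≠ n → γ I = 0}
  add_mem' := fun {a b} ha hb I hI => by simp [ha I hI, hb I hI]
  zero_mem' := fun _ _ => rfl
  smul_mem' := fun c a ha I hI => by simp [ha I hI]

/-- The sign of the concatenation of the increasing sequences `I` and `J`: for disjoint `I`, `J`
one has `dx_I ∧ dx_J = shuffleSign I J • dx_{I ∪ J}`. -/
def shuffleSign {d : ℕ} (I J : Finset (Fin d)) : ℂ :=
  (-1) ^ ((I ×ˢ J).filter fun p => p.2 < p.1).card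

lemma shuffleSign_mul_self {d : ℕ} (I J : Finset (Fin d)) :
    shuffleSign I J * shuffleSign I J = 1 := by
  unfold shuffleSign
  rw [← pow_add, ← two_mul, pow_mul]
  simp

/-- The isomorphism `γ ↦ ι_γ Ω = Ω(γ, ·)` from polyvector fields to differential forms; it sends
`k`-vector fields to `(d - k)`-forms. -/
def contractVol {d : ℕ} (w : (Poly d)ˣ) : Polyvec d ≃ₗ[ℂ] DiffForm d where
  toFun γ J := shuffleSign Jᶜ J • ((w : Poly d) * γ Jᶜ)
  invFun η I := shuffleSign I Iᶜ • (((w⁻¹ : (Poly d)ˣ) : Poly d) * η Iᶜ)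
  map_add' a b := by funext J; simp [mul_add]
  map_smul' c a := by funext J; simp [smul_comm c]
  left_inv γ := by
    funext I
    simp [smul_smul, shuffleSign_mul_self]
  right_inv η := by
    funext I
    simp [smul_smul, shuffleSign_mul_self]

/-- The de Rham differential, `d (η_J dx_J) = ∑_j (∂_j η_J) dx_j ∧ dx_J`. -/
def deRham (d : ℕ) : DiffForm d →ₗ[ℂ] DiffForm d where
  toFun η J := ∑ j ∈ J, ((-1 : ℂ) ^ (J.filter (· < j)).card) • MvPolynomial.pderiv j (η (J.erase j))
  map_add' a b := by funext J; simp [Finset.sum_add_distrib]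
  map_smul' c a := by funext J; simp [Finset.smul_sum, smul_comm c]

/-- The divergence with respect to `Ω`: the de Rham differential transported by `γ ↦ ι_γ Ω`. -/
def divergence {d : ℕ} (w : (Poly d)ˣ) : Polyvec d →ₗ[ℂ] Polyvec d :=
  (contractVol w).symm.toLinearMap ∘ₗ deRham d ∘ₗ (contractVol w).toLinearMap

/-- Divergence-free `n`-vector fields, i.e. `[T_poly^{n-1}]_div`. -/
def polyvecDiv {d : ℕ} (w : (Poly d)ˣ) (n : ℕ) : Submodule ℂ (Polyvec d) :=
  polyvecDeg d n ⊓ LinearMap.ker (divergence w)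

/-! ### The complex `T_poly ⊗ ℂ[u]` -/

/-- `T_poly ⊗ ℂ[u]`. -/
abbrev PolyvecU (d : ℕ) : Type := Polyvec d ⊗[ℂ] Polynomial ℂ

/-- The part of `T_poly ⊗ ℂ[u]` of degree `n - 1`: it is spanned by the `γ ⊗ u^k` with `γ` an
`m`-vector field (of degree `m - 1`) and `m + 2k = n`, since `u` has degree `2`. -/
def polyvecUDeg (d n : ℕ) : Submodule ℂ (PolyvecU d) :=
  Submodule.span ℂ
    {t | ∃ m k : ℕ, m + 2 * k = n ∧ ∃ γ ∈ polyvecDeg d m, t = γ ⊗ₜ[ℂ] (Polynomial.X ^ k)}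

/-- The differential `d_div (γ ⊗ u^k) = div γ ⊗ u^{k+1}`. -/
def dDiv {d : ℕ} (w : (Poly d)ˣ) : PolyvecU d →ₗ[ℂ] PolyvecU d :=
  TensorProduct.map (divergence w) (LinearMap.mulLeft ℂ (Polynomial.X : Polynomial ℂ))

/-! ### Polydifferential operators -/

/-- The iterated derivative `∂^α = ∂_1^{α_1} ⋯ ∂_d^{α_d}` for a family of operators `∂_j`. -/
def multiDeriv {d : ℕ} {B : Type} (D : Fin d → B → B) (α : Fin d → ℕ) (f : B) : B :=
  (List.finRange d).foldr (fun j g => (D j)^[α j] g) f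

/-- Partial derivatives of polynomials. -/
def polyPartial {d : ℕ} (j : Fin d) (f : Poly d) : Poly d := MvPolynomial.pderiv j f

/-- Partial derivatives of functions `ℝ^d → ℂ`. -/
def funPartial {d : ℕ} (j : Fin d) (f : (Fin d → ℝ) → ℂ) : (Fin d → ℝ) → ℂ :=
  fun x => fderiv ℝ f x (Pi.single j 1)

/-- The value of a complex polynomial at a point of `ℝ^d`. -/
def evalReal {d : ℕ} (p : Poly d) (x : Fin d → ℝ) : ℂ := MvPolynomial.eval (fun j => (x j : ℂ)) p

/-- Finite families of coefficients `a_α ∈ A`, where `α = (α_1, …, α_n)` is an `n`-tuple of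
multi-indices. They stand for the polydifferential operators
`f_1 ⊗ ⋯ ⊗ f_n ↦ ∑_α a_α ∂^{α_1} f_1 ⋯ ∂^{α_n} f_n`. -/
abbrev PolyDiffSymbol (d n : ℕ) : Type := (Fin n → Fin d → ℕ) →₀ Poly d

/-- Functions of `n` arguments in `A`; the space `Hom_ℂ(A^{⊗ n}, A)` of Hochschild cochains consists
of the multilinear ones. -/
abbrev Cochain (d n : ℕ) : Type := (Fin n → Poly d) → Poly d

/-- The polydifferential operator on polynomials with given coefficients. The range of this map is
`D_poly^{n-1}`, the polydifferential part of `Hom_ℂ(A^{⊗ n}, A)` (such operators are automatically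
multilinear). -/
def polyOp (d n : ℕ) : PolyDiffSymbol d n →ₗ[ℂ] Cochain d n where
  toFun P f := P.sum fun α a => a * ∏ i, multiDeriv polyPartial (α i) (f i)
  map_add' P Q := by
    funext f
    exact Finsupp.sum_add_index' (by simp) (by intros; ring)
  map_smul' c P := by
    funext f
    simp only [RingHom.id_apply, Pi.smul_apply]
    rw [Finsupp.sum_smul_index' (by simp), Finsupp.smul_sum]
    simp

/-- The same polydifferential operator acting on functions `ℝ^d → ℂ`. -/
def smoothOp {d n : ℕ} (P : PolyDiffSymbol d n) (f : Fin n → (Fin d → ℝ) → ℂ) :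
    (Fin d → ℝ) → ℂ :=
  fun x => P.sum fun α a => evalReal a x * ∏ i, multiDeriv funPartial (α i) (f i) x

/-- The Hochschild differential
`(dφ)(a_0, …, a_n) = a_0 φ(a_1, …, a_n) + ∑_{i < n} (-1)^{i+1} φ(…, a_i a_{i+1}, …)
  + (-1)^{n+1} φ(a_0, …, a_{n-1}) a_n`. -/
def hochschildD (d n : ℕ) : Cochain d n →ₗ[ℂ] Cochain d (n + 1) where
  toFun φ a := a 0 * φ (fun i => a i.succ)
    + ∑ j : Fin n, (-1) ^ ((j : ℕ) + 1) * φ (Fin.contractNth j.castSucc (· * ·) a)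
    + (-1) ^ (n + 1) * (φ (fun i => a i.castSucc) * a (Fin.last n))
  map_add' φ ψ := by
    funext a
    simp only [Pi.add_apply, mul_add, add_mul, Finset.sum_add_distrib]
    ring
  map_smul' c φ := by
    funext a
    simp only [Pi.smul_apply, RingHom.id_apply, smul_add, Finset.smul_sum, mul_smul_comm,
      smul_mul_assoc]

/-! ### Cyclically invariant polydifferential operators -/

/-- Smooth compactly supported functions on `ℝ^d`. -/
def IsTestFun {d : ℕ} (f : (Fin d → ℝ) → ℂ) : Prop := ContDiff ℝ ∞ f ∧ HasCompactSupport f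

/-- `ψ' = C(ψ)` for the cyclic shift `C`:
`∫ ψ(f_1, …, f_n) f_{n+1} Ω = (-1)^n ∫ ψ'(f_2, …, f_{n+1}) f_1 Ω` for all compactly supported
smooth functions `f_1, …, f_{n+1}`. -/
def IsCyclicShift {d n : ℕ} (w : (Poly d)ˣ) (ψ ψ' : PolyDiffSymbol d n) : Prop :=
  ∀ f : Fin (n + 1) → (Fin d → ℝ) → ℂ, (∀ i, IsTestFun (f i)) →
    ∫ x, smoothOp ψ (fun i => f i.castSucc) x * f (Fin.last n) x * evalReal (w : Poly d) x =
      (-1) ^ n * ∫ x, smoothOp ψ' (fun i => f i.succ) x * f 0 x * evalReal (w : Poly d) x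

lemma contDiff_evalReal {d : ℕ} (p : Poly d) : ContDiff ℝ ∞ (evalReal p) := by
  unfold evalReal
  induction p using MvPolynomial.induction_on with
  | C a => simpa using contDiff_const
  | add p q hp hq => simpa using hp.add hq
  | mul_X p i hp =>
    simp only [map_mul, MvPolynomial.eval_X]
    exact hp.mul (Complex.ofRealCLM.contDiff.comp (contDiff_apply ℝ ℝ i))

lemma contDiff_funPartial {d : ℕ} (j : Fin d) {f : (Fin d → ℝ) → ℂ} (hf : ContDiff ℝ ∞ f) :
    ContDiff ℝ ∞ (funPartial j f) :=
  (hf.fderiv_right (m := ∞) (by simp)).clm_apply contDiff_const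

lemma contDiff_multiDeriv {d : ℕ} (α : Fin d → ℕ) {f : (Fin d → ℝ) → ℂ} (hf : ContDiff ℝ ∞ f) :
    ContDiff ℝ ∞ (multiDeriv funPartial α f) := by
  unfold multiDeriv
  induction List.finRange d with
  | nil => simpa using hf
  | cons j l ih =>
    simp only [List.foldr_cons]
    induction α j with
    | zero => simpa using ih
    | succ k ihk =>
      rw [Function.iterate_succ_apply']
      exact contDiff_funPartial j ihk

lemma continuous_smoothOp {d n : ℕ} (P : PolyDiffSymbol d n) {f : Fin n → (Fin d → ℝ) → ℂ}
    (hf : ∀ i, ContDiff ℝ ∞ (f i)) : Continuous (smoothOp P f) := by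
  unfold smoothOp Finsupp.sum
  refine continuous_finsetSum _ fun α _ => (contDiff_evalReal _).continuous.mul ?_
  exact continuous_finsetProd _ fun i _ => (contDiff_multiDeriv _ (hf i)).continuous

lemma integrable_smoothOp {d n : ℕ} (w : (Poly d)ˣ) (P : PolyDiffSymbol d n)
    {f : Fin n → (Fin d → ℝ) → ℂ} (hf : ∀ i, IsTestFun (f i)) {g : (Fin d → ℝ) → ℂ}
    (hg : IsTestFun g) :
    Integrable fun x => smoothOp P f x * g x * evalReal (w : Poly d) x := by
  refine Continuous.integrable_of_hasCompactSupport ?_ ?_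
  · exact ((continuous_smoothOp P fun i => (hf i).1).mul hg.1.continuous).mul
      (contDiff_evalReal _).continuous
  · exact (hg.2.mul_left (f := smoothOp P f)).mul_right

lemma smoothOp_add {d n : ℕ} (P Q : PolyDiffSymbol d n) (f : Fin n → (Fin d → ℝ) → ℂ)
    (x : Fin d → ℝ) : smoothOp (P + Q) f x = smoothOp P f x + smoothOp Q f x :=
  Finsupp.sum_add_index' (by simp [evalReal]) (by intros; simp [evalReal, add_mul])

lemma smoothOp_smul {d n : ℕ} (c : ℂ) (P : PolyDiffSymbol d n) (f : Fin n → (Fin d → ℝ) → ℂ)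
    (x : Fin d → ℝ) : smoothOp (c • P) f x = c * smoothOp P f x := by
  unfold smoothOp
  rw [Finsupp.sum_smul_index' (by simp [evalReal]), Finsupp.mul_sum]
  simp [evalReal, MvPolynomial.smul_eval, mul_assoc]

/-- Coefficient families of the operators with `C(ψ) = ψ`. -/
def cyclicSymbols {d : ℕ} (w : (Poly d)ˣ) (n : ℕ) : Submodule ℂ (PolyDiffSymbol d n) where
  carrier := {ψ | IsCyclicShift w ψ ψ}
  zero_mem' := by
    intro f _
    simp [smoothOp]
  add_mem' := by
    intro P Q hP hQ f hf
    simp only [smoothOp_add, add_mul]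
    rw [integral_add (integrable_smoothOp w P (fun i => hf i.castSucc) (hf _))
        (integrable_smoothOp w Q (fun i => hf i.castSucc) (hf _)),
      integral_add (integrable_smoothOp w P (fun i => hf i.succ) (hf _))
        (integrable_smoothOp w Q (fun i => hf i.succ) (hf _)), hP f hf, hQ f hf, mul_add]
  smul_mem' := by
    intro c P hP f hf
    simp only [smoothOp_smul, mul_assoc, integral_const_mul]
    have h := hP f hf
    simp only [mul_assoc] at h
    rw [h]
    ring

/-- The cyclically invariant polydifferential cochains `[D_poly^{n-1}]_cycl`: the polydifferential
operators `ψ` with `C(ψ) = ψ`. -/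
def cyclicCochains {d : ℕ} (w : (Poly d)ˣ) (n : ℕ) : Submodule ℂ (Cochain d n) :=
  (cyclicSymbols w n).map (polyOp d n)

/-! ### The Hochschild–Kostant–Rosenberg map -/

/-- `φ_HKR(γ)(f_1, …, f_n) = (1/n!) ∑_{|I| = n} γ_I det(∂_{i_a} f_b)`, i.e. `ξ_1 ∧ … ∧ ξ_n` is sent
to `(1/n!) ∑_σ sgn(σ) ξ_{σ(1)}(f_1) ⋯ ξ_{σ(n)}(f_n)`. -/
def hkr {d : ℕ} (n : ℕ) (γ : Polyvec d) : Cochain d n := fun f =>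
  ((n.factorial : ℂ)⁻¹) • ∑ I : {I : Finset (Fin d) // I.card = n},
    γ I.1 * (Matrix.of fun a b : Fin n =>
      MvPolynomial.pderiv (I.1.orderEmbOfFin I.2 a) (f b)).det

/-! ### The two cohomologies -/

/-- `H^{n-1}([D_poly]_cycl, d_Hoch)`. -/
abbrev HCyc {d : ℕ} (w : (Poly d)ˣ) (n : ℕ) : Type :=
  Cohomology (hochschildD d) (cyclicCochains w) n

/-- `H^{n-1}(T_poly ⊗ ℂ[u], d_div)`. -/
abbrev HDiv {d : ℕ} (w : (Poly d)ˣ) (n : ℕ) : Type :=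
  Cohomology (M := fun _ => PolyvecU d) (fun _ => dDiv w) (polyvecUDeg d) n

end

end CyclicHKR

/-! Positions are counted by the number `n` of arguments, so position `n` is degree `n - 1`. Write b
for the Hochschild differential (`hochP`), b' for b without its first term (`barP`), t for the
signed cyclic shift (`cycP`), transported to operators through the pairing ∫ φ(f_1, …, f_n) f_{n+1},
and N for the sum of the powers of t (`cycSumP`). The proof runs Connes' calculus of cyclic
cohomology on top of the Hochschild–Kostant–Rosenberg theorem. It uses b'(1 - t) = (1 - t)b and N b'
= b N, the acyclicity of b' (inserting 1 is a contraction up to sign), and the equality of the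
kernel of N with the image of 1 - t, which holds over ℂ.

HKR. Multiplication by a new first argument (`mulFirst`) identifies b with -b' on the operators that
are A-linear in their first slot, i.e. on the common kernel of the commutators with the x_j
(`commX`). These commutators are locally nilpotent and form Weyl pairs with precomposition by ∂_j,
so their Koszul complex is exact in positive form degree (`exists_wedge_eq`). In the double complex
with differentials Koszul and b', the b' direction contracts onto alternating maps with values in A.
Zigzagging through it shows that each Hochschild class in positive position contains exactly one
`hkP γ` (`exists_hkP_add`, `hkP_eq_hochP`).

Divergence. Integration by parts gives (1 - t) hkP γ = b' hkP (div γ), where div is `contr n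
partialL` (`hkP_sub_cycP`). Let x = hkP γ + b y be a cyclic cocycle. Then div γ = 0 and b'(1 - t)y =
0. When y has at least one argument, (1 - t)y = b'ρ for some ρ, and Nρ is a cyclic cocycle two
positions lower; if Nρ is a cyclic coboundary, so is b y (`hochP_mem_cycCoboundaries`).

Up to position d + 1, induction represents Nρ by a divergence-free field of degree below d. Such a
field is a divergence by the Poincaré lemma (`exists_contr_partialL_eq`), so it can be absorbed into
y, and only γ survives (`exists_sub_hkP_mem_cycCoboundaries`). At position d this leaves the
constants, at position d + 1 nothing. Above position d there are no polyvector fields, and the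
passage from x to Nρ inverts, up to a scalar, the periodicity operator from position n to n + 2, d ≤
n. This settles all higher degrees.

For T_poly ⊗ ℂ[u] the argument is coefficientwise in u: by the Poincaré lemma the coefficient of u^k
with k > 0 is exact unless it has top degree d. -/

namespace CyclicHKR

noncomputable section

/-! ### Alternating forms with coefficients and their Koszul differentials -/

section Koszul

variable {d : ℕ} {M M' : Type} [AddCommGroup M] [Module ℂ M] [AddCommGroup M'] [Module ℂ M']

/-- Alternating `p`-forms on `ℂ^d` with values in `M`. -/
abbrev Alt (d p : ℕ) (M : Type) [AddCommGroup M] [Module ℂ M] : Type :=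
  (Fin d → ℂ) [⋀^Fin p]→ₗ[ℂ] M

lemma Alt.sum_apply {p : ℕ} {ι : Type} (s : Finset ι) (f : ι → Alt d p M)
    (v : Fin p → Fin d → ℂ) : (∑ i ∈ s, f i) v = ∑ i ∈ s, f i v := by
  classical
  induction s using Finset.induction_on with
  | empty => simp
  | insert i s hi ih => simp [Finset.sum_insert hi, ih]

/-- The `j`-th standard basis vector of `ℂ^d`. -/
def bvec (j : Fin d) : Fin d → ℂ := Pi.single j 1

/-- The operator `∑_j v_j a_j` as a linear function of `v`. -/
def linComb (a : Fin d → M →ₗ[ℂ] M') : (Fin d → ℂ) →ₗ[ℂ] M →ₗ[ℂ] M' where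
  toFun v := ∑ j, v j • a j
  map_add' v w := by simp [add_smul, Finset.sum_add_distrib]
  map_smul' c v := by simp [Finset.smul_sum, smul_smul]

lemma linComb_apply (a : Fin d → M →ₗ[ℂ] M') (v : Fin d → ℂ) (x : M) :
    linComb a v x = ∑ j, v j • a j x := by
  simp [linComb]

lemma linComb_bvec (a : Fin d → M →ₗ[ℂ] M') (j : Fin d) : linComb a (bvec j) = a j := by
  ext x
  simp [linComb_apply, bvec, Pi.single_apply, ite_smul]

/-- Postcomposition of alternating maps with a linear map. -/
def compAlt (p : ℕ) (f : M →ₗ[ℂ] M') : Alt d p M →ₗ[ℂ] Alt d p M' where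
  toFun τ := f.compAlternatingMap τ
  map_add' _ _ := by ext; simp
  map_smul' _ _ := by ext; simp

@[simp] lemma compAlt_apply {p : ℕ} (f : M →ₗ[ℂ] M') (τ : Alt d p M) (v : Fin p → Fin d → ℂ) :
    compAlt p f τ v = f (τ v) := rfl

/-- The Koszul differential `τ ↦ ∑_j e_j^* ∧ a_j τ`. -/
def wedge (p : ℕ) (a : Fin d → M →ₗ[ℂ] M') : Alt d p M →ₗ[ℂ] Alt d (p + 1) M' where
  toFun τ := AlternatingMap.alternatizeUncurryFin
    { toFun := fun v => compAlt p (linComb a v) τ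
      map_add' := fun v w => by ext; simp
      map_smul' := fun c v => by ext; simp }
  map_add' τ τ' := by
    ext v
    simp [AlternatingMap.alternatizeUncurryFin_apply, Finset.sum_add_distrib]
  map_smul' c τ := by
    ext v
    simp [AlternatingMap.alternatizeUncurryFin_apply, Finset.smul_sum, smul_comm c]

lemma wedge_apply {p : ℕ} (a : Fin d → M →ₗ[ℂ] M') (τ : Alt d p M)
    (v : Fin (p + 1) → Fin d → ℂ) :
    wedge p a τ v = ∑ i : Fin (p + 1), (-1 : ℂ) ^ (i : ℕ) •
      linComb a (v i) (τ (i.removeNth v)) := by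
  simp only [wedge, LinearMap.coe_mk, AddHom.coe_mk, AlternatingMap.alternatizeUncurryFin_apply,
    compAlt_apply]
  refine Finset.sum_congr rfl fun i _ => ?_
  rcases Nat.even_or_odd (i : ℕ) with h | h <;> simp [h.neg_one_pow]

/-- Because the a_j commute, the bilinear form (v, w) ↦ a_v a_w τ is symmetric, and alternating a
symmetric form twice gives zero. -/
lemma wedge_wedge {p : ℕ} (a : Fin d → M →ₗ[ℂ] M) (ha : ∀ i j x, a i (a j x) = a j (a i x))
    (τ : Alt d p M) : wedge (p + 1) a (wedge p a τ) = 0 := by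
  have hc : ∀ v w x, linComb a v (linComb a w x) = linComb a w (linComb a v x) := by
    intro v w x
    simp only [linComb_apply, map_sum, map_smul, Finset.smul_sum]
    rw [Finset.sum_comm]
    exact Finset.sum_congr rfl fun i _ => Finset.sum_congr rfl fun j _ => by
      rw [ha, smul_comm]
  let F : (Fin d → ℂ) →ₗ[ℂ] (Fin d → ℂ) →ₗ[ℂ] Alt d p M :=
    LinearMap.mk₂ ℂ (fun v w => compAlt p (linComb a v) (compAlt p (linComb a w) τ))
      (fun _ _ _ => by ext; simp) (fun _ _ _ => by ext; simp)
      (fun _ _ _ => by ext; simp) (fun _ _ _ => by ext; simp)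
  have h := AlternatingMap.alternatizeUncurryFin_alternatizeUncurryFinLM_comp_of_symmetric
    (f := F) (fun v w => by ext u; simp [F, hc v w])
  rw [← h]
  ext v
  simp [wedge, F, AlternatingMap.alternatizeUncurryFin_apply, map_sum]

lemma compAlt_wedge {p : ℕ} (a : Fin d → M →ₗ[ℂ] M) (a' : Fin d → M' →ₗ[ℂ] M')
    (f : M →ₗ[ℂ] M') (h : ∀ j x, f (a j x) = a' j (f x)) (τ : Alt d p M) :
    compAlt (p + 1) f (wedge p a τ) = wedge p a' (compAlt p f τ) := by
  ext v
  simp [wedge_apply, map_sum, linComb_apply, h]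

lemma wedge_neg {p : ℕ} (a : Fin d → M →ₗ[ℂ] M') (τ : Alt d p M) :
    wedge p a (-τ) = -wedge p a τ := map_neg _ _

lemma wedge_sub {p : ℕ} (a : Fin d → M →ₗ[ℂ] M') (τ τ' : Alt d p M) :
    wedge p a (τ - τ') = wedge p a τ - wedge p a τ' := map_sub _ _ _

lemma compAlt_neg {p : ℕ} (f : M →ₗ[ℂ] M') (τ : Alt d p M) :
    compAlt p f (-τ) = -compAlt p f τ := map_neg _ _

lemma compAlt_sub {p : ℕ} (f : M →ₗ[ℂ] M') (τ τ' : Alt d p M) :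
    compAlt p f (τ - τ') = compAlt p f τ - compAlt p f τ' := map_sub _ _ _

lemma Alt.neg_zero {p : ℕ} : -(0 : Alt d p M) = 0 := _root_.neg_zero

lemma Alt.neg_zero_sub {p : ℕ} (τ : Alt d p M) : -0 - τ = -τ := by abel

lemma Alt.eq_neg_inv_smul {p : ℕ} {τ τ' : Alt d p M} {c : ℂ} (hc : c ≠ 0) (h : -τ = c • τ') :
    τ' = -c⁻¹ • τ := by
  rw [neg_smul, ← smul_neg, h, smul_smul, inv_mul_cancel₀ hc, one_smul]

lemma Alt.neg_add_sub_sub {p : ℕ} (τ τ' : Alt d p M) : -(τ + τ' - τ - τ') = 0 := by abel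

/-- The constant `0`-form. -/
def constAlt (x : M) : Alt d 0 M := AlternatingMap.constOfIsEmpty ℂ (Fin d → ℂ) (Fin 0) x

lemma constAlt_apply (x : M) (v : Fin 0 → Fin d → ℂ) : constAlt x v = x := rfl

/-- The contraction `τ ↦ ∑_j b_j τ(e_j, ·)`. -/
def contr (p : ℕ) (b : Fin d → M →ₗ[ℂ] M') : Alt d (p + 1) M →ₗ[ℂ] Alt d p M' where
  toFun τ := ∑ j, compAlt p (b j) (τ.curryLeft (bvec j))
  map_add' τ τ' := by ext v; simp [Finset.sum_add_distrib, Alt.sum_apply]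
  map_smul' c τ := by ext v; simp [Finset.smul_sum, Alt.sum_apply]

lemma contr_apply {p : ℕ} (b : Fin d → M →ₗ[ℂ] M') (τ : Alt d (p + 1) M)
    (v : Fin p → Fin d → ℂ) :
    contr p b τ v = ∑ j, b j (τ (Matrix.vecCons (bvec j) v)) := by
  simp [contr, Alt.sum_apply]

lemma Alt.map_vecCons_swap {p : ℕ} (τ : Alt d (p + 2) M) (x y : Fin d → ℂ)
    (v : Fin p → Fin d → ℂ) :
    τ (Matrix.vecCons x (Matrix.vecCons y v)) = -τ (Matrix.vecCons y (Matrix.vecCons x v)) := by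
  rw [← τ.map_swap (i := 0) (j := 1) _ (by simp)]
  congr 1
  funext k
  refine Fin.cases ?_ (fun k => ?_) k
  · simp
  · refine Fin.cases ?_ (fun k => ?_) k
    · simp
    · simp only [Matrix.cons_val_succ, Function.comp_apply]
      rw [show (1 : Fin (p + 2)) = Fin.succ 0 from rfl, Equiv.swap_apply_of_ne_of_ne (Fin.succ_ne_zero _)
        (fun h => Fin.succ_ne_zero k (Fin.succ_injective _ h))]
      simp

/-- b_i b_j is symmetric in i, j while τ(e_i, e_j, ·) is antisymmetric, so the double sum equals its
own negative. -/
lemma contr_contr {p : ℕ} (b : Fin d → M →ₗ[ℂ] M) (hb : ∀ i j x, b i (b j x) = b j (b i x))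
    (τ : Alt d (p + 2) M) : contr p b (contr (p + 1) b τ) = 0 := by
  have key : ∀ v, contr p b (contr (p + 1) b τ) v = -contr p b (contr (p + 1) b τ) v := by
    intro v
    simp only [contr_apply, map_sum]
    conv_lhs => rw [Finset.sum_comm]
    rw [← Finset.sum_neg_distrib]
    refine Finset.sum_congr rfl fun i _ => ?_
    rw [← Finset.sum_neg_distrib]
    refine Finset.sum_congr rfl fun j _ => ?_
    rw [Alt.map_vecCons_swap, map_neg, map_neg, hb]
  ext v
  have h := key v
  rw [eq_neg_iff_add_eq_zero, ← two_smul ℂ] at h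
  exact (smul_eq_zero.1 h).resolve_left two_ne_zero

/-! ### The homotopy formula for the Koszul differential and the contraction -/

variable {a b : Fin d → M →ₗ[ℂ] M} {c : ℂ}

lemma removeNth_succ_vecCons {α : Type} {p : ℕ} (x : α) (v : Fin (p + 1) → α) (i : Fin (p + 1)) :
    i.succ.removeNth (Matrix.vecCons x v : Fin (p + 2) → α) =
      Matrix.vecCons x (i.removeNth v) := by
  funext k
  refine Fin.cases ?_ (fun k => ?_) k
  · simp [Fin.removeNth]
  · simp [Fin.removeNth]

/-- The homotopy formula for the Koszul differential and the contraction, for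
operators with `[a_i, b_j] = c δ_ij`. -/
lemma contr_wedge_add {p : ℕ}
    (hab : ∀ i j x, a i (b j x) = b j (a i x) + if i = j then c • x else 0)
    (τ : Alt d (p + 1) M) (v : Fin (p + 1) → Fin d → ℂ) :
    contr (p + 1) b (wedge (p + 1) a τ) v + wedge p a (contr p b τ) v =
      ∑ j, b j (a j (τ v)) + (c * (p + 1)) • τ v := by
  have hcomm : ∀ (w : Fin d → ℂ) j x,
      linComb a w (b j x) = b j (linComb a w x) + (c * w j) • x := by
    intro w j x
    simp only [linComb_apply, hab, smul_add, Finset.sum_add_distrib, map_sum, map_smul]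
    simp [smul_smul, mul_comm c]
  -- Expansion along the new first slot: it yields a_j τ(v), and every other slot picks up one more
  -- sign.
  have h1 : ∀ j, wedge (p + 1) a τ (Matrix.vecCons (bvec j) v) = a j (τ v) -
      ∑ i : Fin (p + 1), (-1 : ℂ) ^ (i : ℕ) •
        linComb a (v i) (τ (Matrix.vecCons (bvec j) (i.removeNth v))) := by
    intro j
    rw [wedge_apply, Fin.sum_univ_succ]
    simp only [Fin.val_zero, pow_zero, one_smul, Matrix.cons_val_zero, linComb_bvec,
      Matrix.cons_val_succ, removeNth_succ_vecCons, Fin.val_succ, pow_succ, mul_neg, mul_one,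
      neg_smul, Finset.sum_neg_distrib, sub_eq_add_neg]
    rfl
  have h2 : ∀ i : Fin (p + 1), τ v = (-1 : ℂ) ^ (i : ℕ) •
      ∑ j, v i j • τ (Matrix.vecCons (bvec j) (i.removeNth v)) := by
    intro i
    have : τ (Matrix.vecCons (v i) (i.removeNth v)) =
        ∑ j, v i j • τ (Matrix.vecCons (bvec j) (i.removeNth v)) := by
      have hv : v i = ∑ j, v i j • bvec j := by
        ext k; simp [bvec, Pi.single_apply, Finset.sum_apply]
      have := congrArg (fun w => τ.curryLeft w (i.removeNth v)) hv
      simpa [map_sum, Alt.sum_apply] using this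
    rw [← this]
    have h3 := τ.map_insertNth i (v i) (i.removeNth v)
    rw [Fin.insertNth_self_removeNth] at h3
    rw [h3]
    rcases Nat.even_or_odd (i : ℕ) with h | h <;> simp [h.neg_one_pow]
  rw [contr_apply, wedge_apply]
  simp only [h1, contr_apply, map_sub, map_sum, map_smul, hcomm, Finset.sum_sub_distrib,
    Finset.sum_add_distrib, smul_add, Finset.smul_sum]
  rw [Finset.sum_comm (s := Finset.univ (α := Fin d))]
  -- The commutator terms: each of the p + 1 slots reassembles c τ(v), whence the constant c (p +
  -- 1).
  have h4 : ∑ i : Fin (p + 1), ∑ j, (-1 : ℂ) ^ (i : ℕ) • (c * v i j) •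
      τ (Matrix.vecCons (bvec j) (i.removeNth v)) = (c * (p + 1)) • τ v := by
    have : ∀ i : Fin (p + 1), ∑ j, (-1 : ℂ) ^ (i : ℕ) • (c * v i j) •
        τ (Matrix.vecCons (bvec j) (i.removeNth v)) = c • τ v := by
      intro i
      rw [h2 i, Finset.smul_sum, Finset.smul_sum]
      exact Finset.sum_congr rfl fun j _ => by simp only [smul_smul]; ring_nf
    rw [Finset.sum_congr rfl fun i _ => this i]
    simp only [Finset.sum_const, Finset.card_univ, Fintype.card_fin, ← Nat.cast_smul_eq_nsmul ℂ,
      smul_smul]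
    push_cast
    ring_nf
  rw [h4]
  abel

lemma contr_wedge_zero (τ : Alt d 0 M) (v : Fin 0 → Fin d → ℂ) :
    contr 0 b (wedge 0 a τ) v = ∑ j, b j (a j (τ v)) := by
  rw [contr_apply]
  refine Finset.sum_congr rfl fun j _ => ?_
  rw [wedge_apply, Fin.sum_univ_succ]
  simp only [Fin.val_zero, pow_zero, one_smul, Matrix.cons_val_zero, linComb_bvec,
    Finset.univ_eq_empty, Finset.sum_empty, add_zero]
  congr 3

/-- Elements killed by all products of `m` of the operators `D_j`. -/
def nilFil (D : Fin d → M →ₗ[ℂ] M) : ℕ → Submodule ℂ M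
  | 0 => ⊥
  | m + 1 => ⨅ j, (nilFil D m).comap (D j)

lemma mem_nilFil_succ {D : Fin d → M →ₗ[ℂ] M} {m : ℕ} {x : M} :
    x ∈ nilFil D (m + 1) ↔ ∀ j, D j x ∈ nilFil D m := by
  simp [nilFil, Submodule.mem_iInf]

lemma nilFil_le_succ (D : Fin d → M →ₗ[ℂ] M) (m : ℕ) : nilFil D m ≤ nilFil D (m + 1) := by
  induction m with
  | zero => simp [nilFil]
  | succ m ih => exact fun x hx => mem_nilFil_succ.2 fun j => ih (mem_nilFil_succ.1 hx j)

lemma nilFil_mono (D : Fin d → M →ₗ[ℂ] M) : Monotone (nilFil D) :=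
  monotone_nat_of_le_succ (nilFil_le_succ D)

/-! ### The Euler operator on the order filtration and the two Poincaré lemmas -/

variable {D e : Fin d → M →ₗ[ℂ] M}

lemma nilFil_comm_map (f : M →ₗ[ℂ] M) (hf : ∀ j x, D j (f x) = f (D j x)) {m : ℕ} {x : M}
    (hx : x ∈ nilFil D m) : f x ∈ nilFil D m := by
  induction m generalizing x with
  | zero => simp_all [nilFil]
  | succ m ih =>
    exact mem_nilFil_succ.2 fun j => by rw [hf]; exact ih (mem_nilFil_succ.1 hx j)

lemma nilFil_weyl_map (hDe : ∀ i j x, D i (e j x) = e j (D i x) + if i = j then x else 0)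
    (j : Fin d) {m : ℕ} {x : M} (hx : x ∈ nilFil D m) : e j x ∈ nilFil D (m + 1) := by
  induction m generalizing x with
  | zero => simp_all [nilFil]
  | succ m ih =>
    refine mem_nilFil_succ.2 fun i => ?_
    rw [hDe]
    refine add_mem (ih (mem_nilFil_succ.1 hx i)) ?_
    split_ifs
    · exact hx
    · exact zero_mem _

/-- The Euler operator `∑_j e_j D_j`. -/
def euler (D e : Fin d → M →ₗ[ℂ] M) : M →ₗ[ℂ] M := ∑ j, e j ∘ₗ D j

lemma euler_apply (x : M) : euler D e x = ∑ j, e j (D j x) := by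
  simp [euler]

/-- The Euler operator is multiplication by m on the m-th graded piece of the filtration. The
relation [D_i, E] = D_i reduces this to the previous m. -/
lemma euler_sub_mem_nilFil (hDe : ∀ i j x, D i (e j x) = e j (D i x) + if i = j then x else 0)
    (hD : ∀ i j x, D i (D j x) = D j (D i x)) {m : ℕ} {x : M} (hx : x ∈ nilFil D (m + 1)) :
    euler D e x - (m : ℂ) • x ∈ nilFil D m := by
  have hE : ∀ i x, D i (euler D e x) = euler D e (D i x) + D i x := by
    intro i x
    simp [euler_apply, hDe, Finset.sum_add_distrib, hD i]
  induction m generalizing x with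
  | zero =>
    have : ∀ j, D j x = 0 := by simpa [mem_nilFil_succ, nilFil] using hx
    simp [euler_apply, this, nilFil]
  | succ m ih =>
    refine mem_nilFil_succ.2 fun i => ?_
    have := ih (mem_nilFil_succ.1 hx i)
    rw [map_sub, map_smul, hE]
    convert this using 1
    push_cast
    module

/-- A form is determined by finitely many values on basis vectors, so local nilpotency provides one
exponent valid for all its values. -/
lemma exists_nilFil_alt (hloc : ∀ x, ∃ m, x ∈ nilFil D m) {p : ℕ} (τ : Alt d p M) :
    ∃ m, ∀ v, τ v ∈ nilFil D m := by
  choose N hN using hloc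
  let m := Finset.univ.sup fun i : Fin p → Fin d => N (τ fun k => bvec (i k))
  refine ⟨m, fun v => ?_⟩
  have hv : v = fun k => ∑ j, v k j • bvec j := by
    funext k l; simp [bvec, Pi.single_apply, Finset.sum_apply]
  have : τ v = ∑ i : Fin p → Fin d, (∏ k, v k (i k)) • τ fun k => bvec (i k) := by
    conv_lhs => rw [hv]
    have := τ.toMultilinearMap.map_sum (fun k j => v k j • (bvec j : Fin d → ℂ))
    simp only [AlternatingMap.coe_multilinearMap] at this
    rw [this]
    exact Finset.sum_congr rfl fun i _ =>
      τ.toMultilinearMap.map_smul_univ (fun k => v k (i k)) (fun k => bvec (i k))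
  rw [this]
  refine sum_mem fun i _ => Submodule.smul_mem _ _ ?_
  exact nilFil_mono D (Finset.le_sup (f := fun i : Fin p → Fin d => N (τ fun k => bvec (i k)))
    (Finset.mem_univ i)) (hN _)

/-- Poincaré lemma for the Koszul differential of locally nilpotent derivations. -/
theorem exists_wedge_eq (hDe : ∀ i j x, D i (e j x) = e j (D i x) + if i = j then x else 0)
    (hD : ∀ i j x, D i (D j x) = D j (D i x)) (hloc : ∀ x, ∃ m, x ∈ nilFil D m) {p : ℕ}
    (τ : Alt d (p + 1) M) (hτ : wedge (p + 1) D τ = 0) : ∃ η : Alt d p M, wedge p D η = τ := by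
  obtain ⟨m, hm⟩ := exists_nilFil_alt hloc τ
  induction m generalizing τ with
  | zero =>
    refine ⟨0, ?_⟩
    ext v
    simpa [nilFil, eq_comm] using hm v
  | succ m ih =>
    -- For closed τ only one half of the homotopy formula remains, and it acts as Euler operator
    -- plus p + 1.
    have key : ∀ v, wedge p D (contr p e τ) v = euler D e (τ v) + ((p : ℂ) + 1) • τ v := by
      intro v
      have := contr_wedge_add (a := D) (b := e) (c := 1) (by simpa using hDe) τ v
      simpa [hτ, euler_apply] using this
    -- On the top graded piece the eigenvalue is m + p + 1; subtracting it lowers the nilpotency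
    -- order, so the induction hypothesis applies to the remainder.
    obtain ⟨η, hη⟩ := ih (wedge p D (contr p e τ) - ((m : ℂ) + p + 1) • τ)
      (by rw [map_sub, map_smul, hτ, wedge_wedge _ hD]; simp) (fun v => by
        have := euler_sub_mem_nilFil hDe hD (hm v)
        simp only [AlternatingMap.sub_apply, AlternatingMap.smul_apply, key]
        convert this using 1
        module)
    refine ⟨((m : ℂ) + p + 1)⁻¹ • (contr p e τ - η), ?_⟩
    have h0 : (m : ℂ) + p + 1 ≠ 0 := by exact_mod_cast Nat.succ_ne_zero (m + p)
    rw [map_smul, map_sub, hη, sub_sub_cancel, smul_smul, inv_mul_cancel₀ h0, one_smul]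

/-- Poincaré lemma for the divergence type contraction. -/
theorem exists_contr_eq (hDe : ∀ i j x, D i (e j x) = e j (D i x) + if i = j then x else 0)
    (hD : ∀ i j x, D i (D j x) = D j (D i x)) (hloc : ∀ x, ∃ m, x ∈ nilFil D m) {p : ℕ}
    (hp : p < d) (τ : Alt d p M) (hτ : ∀ q (h : p = q + 1), contr q D (h ▸ τ) = 0) :
    ∃ η : Alt d (p + 1) M, contr p D η = τ := by
  obtain ⟨m, hm⟩ := exists_nilFil_alt hloc τ
  induction m generalizing τ with
  | zero =>
    refine ⟨0, ?_⟩
    ext v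
    simpa [nilFil, eq_comm] using hm v
  | succ m ih =>
    -- With the roles exchanged the commutator constant is -1, and ∑ D_j e_j is the Euler operator
    -- plus d; together they give the shift d - p.
    have key : ∀ v, contr p D (wedge p e τ) v = euler D e (τ v) + ((d : ℂ) - p) • τ v := by
      intro v
      have hde : ∀ x, ∑ j, D j (e j x) = euler D e x + (d : ℂ) • x := by
        intro x
        simp [hDe, Finset.sum_add_distrib, euler_apply, Nat.cast_smul_eq_nsmul]
      cases p with
      | zero => rw [contr_wedge_zero, hde]; simp
      | succ p =>
        have := contr_wedge_add (a := e) (b := D) (c := -1) (by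
          intro i j x
          rw [hDe]
          by_cases h : i = j
          · subst h; simp
          · simp [h, Ne.symm h]) τ v
        rw [hτ p rfl, map_zero, AlternatingMap.zero_apply, add_zero, hde] at this
        rw [this]
        push_cast
        module
    obtain ⟨η, hη⟩ := ih (contr p D (wedge p e τ) - ((m : ℂ) + (d - p)) • τ)
      (by
        rintro q rfl
        have := hτ q rfl
        simp only at this ⊢
        rw [map_sub, map_smul, this, contr_contr _ hD]; simp) (fun v => by
        have := euler_sub_mem_nilFil hDe hD (hm v)
        simp only [AlternatingMap.sub_apply, AlternatingMap.smul_apply, key]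
        convert this using 1
        module)
    refine ⟨((m : ℂ) + (d - p))⁻¹ • (wedge p e τ - η), ?_⟩
    -- Here p < d is essential: in top degree the eigenvalue vanishes for m = 0, which is why
    -- constants survive there.
    have h0 : (m : ℂ) + (d - p) ≠ 0 := by
      rw [← Nat.cast_sub hp.le]
      have : 0 < d - p := by omega
      exact_mod_cast (by omega : m + (d - p) ≠ 0)
    rw [map_smul, map_sub, hη, sub_sub_cancel, smul_smul, inv_mul_cancel₀ h0, one_smul]

end Koszul

end

end CyclicHKR

namespace CyclicHKR

noncomputable section

/-! ### Cyclic identities for functionals of several arguments -/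

section Functionals

variable {R : Type} [CommSemigroup R] {n : ℕ}

/-- Functionals of `n + 1` arguments. -/
abbrev Functional (R : Type) (n : ℕ) : Type := (Fin (n + 1) → R) → ℂ

lemma contractNth_castSucc_last {α : Type} (op : α → α → α) {n : ℕ} (j : Fin n)
    (a : Fin (n + 2) → α) :
    Fin.contractNth j.castSucc.castSucc op a (Fin.last n) = a (Fin.last (n + 1)) := by
  rw [Fin.contractNth_apply_of_gt _ _ _ _ (by simp)]
  simp

lemma contractNth_rotate (j : Fin n) (a : Fin (n + 2) → R) :
    Fin.contractNth j.castSucc.castSucc (· * ·) (fun i => a (i + 1)) =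
      fun i : Fin (n + 1) => Fin.contractNth j.succ.castSucc (· * ·) a (i + 1) := by
  funext i
  refine Fin.lastCases ?_ (fun k => ?_) i
  · rw [contractNth_castSucc_last, Fin.last_add_one, Fin.last_add_one,
      Fin.contractNth_apply_of_lt _ _ _ _ (by simp)]
    simp
  · rw [Fin.coeSucc_eq_succ]
    rcases lt_trichotomy (k : ℕ) (j : ℕ) with h | h | h
    · rw [Fin.contractNth_apply_of_lt _ _ _ _ (by simpa using h),
        Fin.contractNth_apply_of_lt _ _ _ _ (by simpa using h)]
      rw [Fin.coeSucc_eq_succ]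
      rfl
    · rw [Fin.contractNth_apply_of_eq _ _ _ _ (by simpa using h),
        Fin.contractNth_apply_of_eq _ _ _ _ (by simpa using h)]
      rw [Fin.coeSucc_eq_succ, Fin.succ_castSucc, Fin.coeSucc_eq_succ]
    · rw [Fin.contractNth_apply_of_gt _ _ _ _ (by simpa using h),
        Fin.contractNth_apply_of_gt _ _ _ _ (by simpa using h)]
      rw [Fin.succ_castSucc, Fin.coeSucc_eq_succ]

lemma contractNth_rotate_rotate (a : Fin (n + 2) → R) :
    Fin.contractNth (Fin.last n).castSucc (· * ·) (fun i => a (i + 1 + 1)) =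
      fun i : Fin (n + 1) => Fin.contractNth (0 : Fin (n + 1)).castSucc (· * ·) a (i + 1) := by
  funext i
  refine Fin.lastCases ?_ (fun k => ?_) i
  · rw [Fin.contractNth_apply_of_eq _ _ _ _ (by simp), Fin.last_add_one,
      Fin.contractNth_apply_of_eq _ _ _ _ (by simp)]
    rw [Fin.coeSucc_eq_succ, Fin.succ_last, Fin.last_add_one, zero_add]
    rfl
  · rw [Fin.coeSucc_eq_succ, Fin.contractNth_apply_of_lt _ _ _ _ (by simp),
      Fin.contractNth_apply_of_gt _ _ _ _ (by simp), Fin.coeSucc_eq_succ, Fin.succ_castSucc,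
      Fin.coeSucc_eq_succ]

/-- Multiplication of two adjacent arguments. -/
def face (j : Fin (n + 1)) : Functional R n →ₗ[ℂ] Functional R (n + 1) where
  toFun Ψ a := Ψ (Fin.contractNth j.castSucc (· * ·) a)
  map_add' _ _ := rfl
  map_smul' _ _ := rfl

/-- Multiplication of the last argument by the first one. -/
def wrapFace : Functional R n →ₗ[ℂ] Functional R (n + 1) where
  toFun Ψ a := Ψ (Fin.contractNth (Fin.last n).castSucc (· * ·) fun i => a (i + 1))
  map_add' _ _ := rfl
  map_smul' _ _ := rfl

/-- The signed cyclic rotation of the arguments. -/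
def cyc (n : ℕ) : Functional R n →ₗ[ℂ] Functional R n where
  toFun Ψ a := (-1) ^ n * Ψ fun i => a (i + 1)
  map_add' _ _ := by funext a; simp [mul_add]
  map_smul' c _ := by funext a; simp [mul_left_comm]

/-- The n + 2 products of cyclically adjacent arguments are permuted by the rotation. This lemma and
the next two record the permutation with its signs. -/
lemma cyc_wrapFace (Ψ : Functional R n) :
    cyc (n + 1) (wrapFace Ψ) = -face 0 (cyc n Ψ) := by
  funext a
  simp only [cyc, wrapFace, face, LinearMap.coe_mk, AddHom.coe_mk, Pi.neg_apply,
    contractNth_rotate_rotate a]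
  ring

lemma cyc_face_castSucc (j : Fin n) (Ψ : Functional R n) :
    cyc (n + 1) (face j.castSucc Ψ) = -face j.succ (cyc n Ψ) := by
  funext a
  simp only [cyc, face, LinearMap.coe_mk, AddHom.coe_mk, Pi.neg_apply, contractNth_rotate j a]
  ring

lemma cyc_face_last (Ψ : Functional R n) :
    cyc (n + 1) (face (Fin.last n) Ψ) = (-1 : ℂ) ^ (n + 1) • wrapFace Ψ := by
  funext a
  simp [cyc, wrapFace, face]

/-- The alternating sum of the multiplications of adjacent arguments. -/
def barF (n : ℕ) : Functional R n →ₗ[ℂ] Functional R (n + 1) :=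
  ∑ j : Fin (n + 1), (-1 : ℂ) ^ ((j : ℕ) + 1) • face j

/-- The Hochschild differential on functionals. -/
def hochF (n : ℕ) : Functional R n →ₗ[ℂ] Functional R (n + 1) := barF n + wrapFace

lemma cyc_face_sign (j : Fin n) (Ψ : Functional R n) :
    cyc (n + 1) ((-1 : ℂ) ^ ((j : ℕ) + 1) • face j.castSucc Ψ) =
      (-1 : ℂ) ^ ((j : ℕ) + 1 + 1) • face j.succ (cyc n Ψ) := by
  rw [map_smul, cyc_face_castSucc]
  module

/-- This is b'(1 - t) = (1 - t)b. Conjugation by t shifts the faces by one, so the two sides differ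
only in the boundary faces, and these cancel through `cyc_wrapFace` and `cyc_face_last`. -/
lemma barF_sub_cyc (Ψ : Functional R n) :
    barF n (Ψ - cyc n Ψ) = hochF n Ψ - cyc (n + 1) (hochF n Ψ) := by
  have h1 : cyc (n + 1) (barF n Ψ) = (∑ j : Fin n, (-1 : ℂ) ^ ((j : ℕ) + 1 + 1) •
      face j.succ (cyc n Ψ)) + wrapFace Ψ := by
    simp only [barF, Fin.sum_univ_castSucc, LinearMap.add_apply, LinearMap.sum_apply,
      LinearMap.smul_apply, map_add, map_sum, Fin.val_castSucc, cyc_face_sign, Fin.val_last]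
    rw [map_smul, cyc_face_last, smul_smul, ← pow_add, ← two_mul]
    simp
  have h2 : barF n (cyc n Ψ) = -face 0 (cyc n Ψ) + ∑ j : Fin n, (-1 : ℂ) ^ ((j : ℕ) + 1 + 1) •
      face j.succ (cyc n Ψ) := by
    simp [barF, Fin.sum_univ_succ]
  rw [map_sub, hochF, LinearMap.add_apply, map_add, h1, h2, cyc_wrapFace]
  abel

/-- The sum over the cyclic group. -/
def cycSum (n : ℕ) : Functional R n →ₗ[ℂ] Functional R n := ∑ i ∈ Finset.range (n + 1), cyc n ^ i

lemma cyc_pow_apply (Ψ : Functional R n) (k : ℕ) (a : Fin (n + 1) → R) :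
    (cyc n ^ k) Ψ a = (-1) ^ (n * k) * Ψ fun i => a (i + k • (1 : Fin (n + 1))) := by
  induction k generalizing a with
  | zero => simp
  | succ k ih =>
    have h : ∀ Ψ : Functional R n, cyc n Ψ a = (-1) ^ n * Ψ fun i => a (i + 1) := fun _ => rfl
    rw [pow_succ', Module.End.mul_apply, h, ih, ← mul_assoc, ← pow_add, mul_add, mul_one,
      add_comm n]
    simp only [succ_nsmul, add_assoc]

lemma cyc_pow_card : (cyc n : Functional R n →ₗ[ℂ] Functional R n) ^ (n + 1) = 1 := by
  ext Ψ a
  rw [cyc_pow_apply]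
  have : (n + 1) • (1 : Fin (n + 1)) = 0 := by
    simpa using card_nsmul_eq_zero' (G := Fin (n + 1)) (x := 1)
  simp [this, (Nat.even_mul_succ_self n).neg_one_pow]

/-- On an invariant functional the iterated rotations of the wrap-around product run once through
all faces with exactly the Hochschild signs. -/
lemma cycSum_wrapFace (Ψ : Functional R n) (hΨ : cyc n Ψ = Ψ) :
    cycSum (n + 1) (wrapFace Ψ) = hochF n Ψ := by
  have hpow : ∀ k (hk : k < n + 1), (cyc (n + 1) ^ (k + 1)) (wrapFace Ψ) =
      (-1 : ℂ) ^ (k + 1) • face ⟨k, hk⟩ Ψ := by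
    intro k
    induction k with
    | zero => intro hk; simp [cyc_wrapFace, hΨ]
    | succ k ih =>
      intro hk
      have := cyc_face_sign (⟨k, by omega⟩ : Fin n) Ψ
      rw [pow_succ', Module.End.mul_apply, ih (by omega)]
      rw [hΨ] at this
      exact this
  rw [cycSum, Finset.sum_range_succ', LinearMap.add_apply, LinearMap.sum_apply, hochF, barF,
    LinearMap.add_apply, LinearMap.sum_apply, Finset.sum_range]
  congr 1
  exact Finset.sum_congr rfl fun k _ => hpow k k.2

end Functionals

end

end CyclicHKR

namespace CyclicHKR

noncomputable section

/-! ### Polydifferential operators on algebras with commuting derivations -/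

section Symbols

/-- A commutative algebra over `ℂ[x_1, …, x_d]` with commuting derivations extending the partial
derivatives. -/
class DiffAlg (d : ℕ) (B : Type) [CommRing B] [Algebra ℂ B] where
  der : Fin d → Derivation ℂ B B
  der_comm : ∀ i j f, der i (der j f) = der j (der i f)
  coeff : Poly d →ₐ[ℂ] B
  der_coeff : ∀ j p, der j (coeff p) = coeff (MvPolynomial.pderiv j p)

lemma pderiv_comm {d : ℕ} (i j : Fin d) (p : Poly d) :
    MvPolynomial.pderiv i (MvPolynomial.pderiv j p) =
      MvPolynomial.pderiv j (MvPolynomial.pderiv i p) := by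
  have h : ⁅MvPolynomial.pderiv (R := ℂ) (σ := Fin d) i, MvPolynomial.pderiv (R := ℂ) (σ := Fin d) j⁆ = 0 := by
    apply MvPolynomial.derivation_ext
    intro k
    rw [Derivation.commutator_apply]
    simp only [MvPolynomial.pderiv_X, Derivation.coe_zero, Pi.zero_apply, Pi.single_apply]
    split_ifs <;> simp
  have := congrArg (fun D => D p) h
  rw [Derivation.commutator_apply] at this
  exact sub_eq_zero.1 this

instance instDiffAlgPoly (d : ℕ) : DiffAlg d (Poly d) where
  der j := MvPolynomial.pderiv j
  der_comm := pderiv_comm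
  coeff := AlgHom.id ℂ _
  der_coeff _ _ := rfl

/-- Products of the arguments over the fibres of `g`. -/
def fibreProd {n m : ℕ} {B : Type} [CommMonoid B] (g : Fin m → Option (Fin n)) (f : Fin m → B)
    (o : Option (Fin n)) : B :=
  ∏ l ∈ Finset.univ.filter fun l => g l = o, f l

lemma fibreProd_update {n m : ℕ} {B : Type} [CommMonoid B] (g : Fin m → Option (Fin n))
    (f : Fin m → B) {l : Fin m} {o o' : Option (Fin n)} (hl : g l = o) (ho : o ≠ o') (b : B) :
    fibreProd g (Function.update f l b) o' = fibreProd g f o' := by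
  refine Finset.prod_update_of_notMem ?_ _ _
  simp [hl, ho]

variable {d n m : ℕ} {B : Type} [CommRing B] [Algebra ℂ B] [DiffAlg d B]

/-- The derivations of a `DiffAlg`. -/
abbrev der (j : Fin d) : Derivation ℂ B B := DiffAlg.der j

/-- The structure map of a `DiffAlg`. -/
abbrev coeffHom : Poly d →ₐ[ℂ] B := DiffAlg.coeff

lemma der_prod {l : Type} [DecidableEq l] (D : Derivation ℂ B B) (s : Finset l) (f : l → B) :
    D (∏ i ∈ s, f i) = ∑ i ∈ s, ∏ k ∈ s, Function.update f i (D (f i)) k := by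
  induction s using Finset.induction_on with
  | empty => simp
  | insert a s ha ih =>
    rw [Finset.prod_insert ha, Derivation.leibniz, ih, Finset.sum_insert ha,
      Finset.prod_insert ha, Function.update_self, Finset.prod_update_of_notMem ha]
    simp only [smul_eq_mul, Finset.mul_sum]
    rw [add_comm, mul_comm (∏ i ∈ s, f i)]
    congr 1
    refine Finset.sum_congr rfl fun i hi => ?_
    rw [Finset.prod_insert ha, Function.update_of_ne (by rintro rfl; exact ha hi)]

lemma multiDeriv_add_single {B : Type} (D : Fin d → B → B)
    (hD : ∀ i j f, D i (D j f) = D j (D i f)) (α : Fin d → ℕ) (j : Fin d) (f : B) :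
    multiDeriv D (α + Pi.single j 1) f = multiDeriv D α (D j f) := by
  have hit : ∀ i k g, (D i)^[k] (D j g) = D j ((D i)^[k] g) := by
    intro i k g
    induction k generalizing g with
    | zero => rfl
    | succ k ih => rw [Function.iterate_succ_apply, Function.iterate_succ_apply, hD, ih]
  have hcomm : ∀ l : List (Fin d), l.foldr (fun i g => (D i)^[α i] g) (D j f) =
      D j (l.foldr (fun i g => (D i)^[α i] g) f) := by
    intro l
    induction l with
    | nil => rfl
    | cons i l ih => rw [List.foldr_cons, List.foldr_cons, ih, hit]
  have hnot : ∀ l : List (Fin d), j ∉ l →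
      l.foldr (fun i g => (D i)^[(α + Pi.single j 1 : Fin d → ℕ) i] g) f =
        l.foldr (fun i g => (D i)^[α i] g) f := by
    intro l hl
    refine List.foldr_ext _ _ _ fun i hi g => ?_
    have : i ≠ j := fun h => hl (h ▸ hi)
    simp [this]
  have hmem : ∀ l : List (Fin d), l.Nodup → j ∈ l →
      l.foldr (fun i g => (D i)^[(α + Pi.single j 1 : Fin d → ℕ) i] g) f =
        l.foldr (fun i g => (D i)^[α i] g) (D j f) := by
    intro l hl hj
    induction l with
    | nil => simp at hj
    | cons i l ih =>
      rw [List.nodup_cons] at hl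
      rw [List.foldr_cons, List.foldr_cons]
      rcases List.mem_cons.1 hj with rfl | hj
      · rw [hnot l hl.1, hcomm]
        simp [Function.iterate_succ_apply]
      · have : i ≠ j := fun h => hl.1 (h ▸ hj)
        rw [ih hl.2 hj]
        simp [this]
  exact hmem _ (List.nodup_finRange d) (List.mem_finRange j)

lemma multiDeriv_zero {B : Type} (D : Fin d → B → B) (f : B) : multiDeriv D 0 f = f := by
  unfold multiDeriv
  induction List.finRange d with
  | nil => rfl
  | cons i l ih => simp [ih]

/-- The polydifferential operator with given coefficients. -/
def genOp (B : Type) [CommRing B] [Algebra ℂ B] [DiffAlg d B] :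
    PolyDiffSymbol d n →ₗ[ℂ] (Fin n → B) → B where
  toFun P f := P.sum fun α a => coeffHom a * ∏ i, multiDeriv (fun j => der j) (α i) (f i)
  map_add' P Q := by
    funext f
    exact Finsupp.sum_add_index' (by simp) (by intros; simp [add_mul])
  map_smul' c P := by
    funext f
    simp only [RingHom.id_apply, Pi.smul_apply]
    rw [Finsupp.sum_smul_index' (by simp), Finsupp.smul_sum]
    simp

lemma polyOp_eq_genOp (P : PolyDiffSymbol d n) : polyOp d n P = genOp (Poly d) P := rfl

/-- The multi-index tuple with a single entry `1`. -/
def unitIndex (i : Fin n) (j : Fin d) : Fin n → Fin d → ℕ := Pi.single i (Pi.single j 1)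

/-- Precomposition of the `i`-th argument with `∂_j`, on symbols. -/
def shift (i : Fin n) (j : Fin d) : PolyDiffSymbol d n →ₗ[ℂ] PolyDiffSymbol d n :=
  Finsupp.lmapDomain (Poly d) ℂ fun α => α + unitIndex i j

lemma shift_single (i : Fin n) (j : Fin d) (α : Fin n → Fin d → ℕ) (a : Poly d) :
    shift i j (Finsupp.single α a) = Finsupp.single (α + unitIndex i j) a := by
  simp [shift, Finsupp.lmapDomain_apply, Finsupp.mapDomain_single]

/-- All symbols arise from multiplication operators by sums and by precomposing slots with ∂_j. This
makes it possible to prove closure properties of polydifferential operators without handling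
multi-indices. -/
theorem symbol_induction {motive : PolyDiffSymbol d n → Prop}
    (base : ∀ a, motive (Finsupp.single 0 a)) (add : ∀ P Q, motive P → motive Q → motive (P + Q))
    (shift : ∀ i j P, motive P → motive (shift i j P)) (P : PolyDiffSymbol d n) : motive P := by
  induction P using Finsupp.induction_linear with
  | zero => simpa using base 0
  | add P Q hP hQ => exact add P Q hP hQ
  | single α a =>
    induction hk : ∑ i, ∑ j, α i j generalizing α with
    | zero =>
      have : α = 0 := by
        funext i j
        simp only [Finset.sum_eq_zero_iff, Finset.mem_univ, true_implies] at hk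
        exact hk i j
      rw [this]
      exact base a
    | succ k ih =>
      obtain ⟨i, j, hij⟩ : ∃ i j, α i j ≠ 0 := by
        by_contra! h
        simp [h] at hk
      have hα : α = (α - unitIndex i j) + unitIndex i j := by
        funext i' j'
        simp only [unitIndex, Pi.add_apply, Pi.sub_apply, Pi.single_apply]
        by_cases hi : i' = i
        · by_cases hj : j' = j
          · subst hi hj; simp; omega
          · simp [hi, hj]
        · simp [hi]
      have hsum : ∑ i', ∑ j', unitIndex i j i' j' = 1 := by
        have h1 : ∀ i', ∑ j', unitIndex i j i' j' = if i' = i then 1 else 0 := by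
          intro i'
          by_cases hi : i' = i
          · subst hi; simp [unitIndex, Pi.single_apply]
          · simp [unitIndex, hi]
        simp [h1]
      rw [hα, ← shift_single]
      refine shift _ _ _ (ih _ ?_)
      rw [hα] at hk
      simp only [Pi.add_apply, Finset.sum_add_distrib, hsum] at hk
      omega

lemma genOp_single_zero (a : Poly d) (f : Fin n → B) :
    genOp B (Finsupp.single 0 a) f = coeffHom a * ∏ i, f i := by
  simp [genOp, multiDeriv_zero]

lemma genOp_shift (i : Fin n) (j : Fin d) (P : PolyDiffSymbol d n) (f : Fin n → B) :
    genOp B (shift i j P) f = genOp B P (Function.update f i (der j (f i))) := by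
  induction P using Finsupp.induction_linear with
  | zero => simp
  | add P Q hP hQ => simp [hP, hQ]
  | single α a =>
    rw [shift_single]
    simp only [genOp, LinearMap.coe_mk, AddHom.coe_mk]
    rw [Finsupp.sum_single_index (by simp), Finsupp.sum_single_index (by simp)]
    congr 1
    refine Finset.prod_congr rfl fun k _ => ?_
    by_cases hk : k = i
    · subst hk
      rw [Function.update_self, Pi.add_apply, unitIndex, Pi.single_eq_same,
        multiDeriv_add_single _ DiffAlg.der_comm]
    · rw [Function.update_of_ne hk, Pi.add_apply, unitIndex, Pi.single_eq_of_ne hk, add_zero]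

lemma exists_multilinear_genOp (P : PolyDiffSymbol d n) :
    ∃ φ : MultilinearMap ℂ (fun _ : Fin n => B) B, ∀ f, φ f = genOp B P f := by
  induction P using symbol_induction with
  | base a =>
    refine ⟨coeffHom (B := B) a • MultilinearMap.mkPiAlgebra ℂ (Fin n) B, fun f => ?_⟩
    simp [genOp_single_zero]
  | add P Q hP hQ =>
    obtain ⟨φ, hφ⟩ := hP
    obtain ⟨ψ, hψ⟩ := hQ
    exact ⟨φ + ψ, fun f => by simp [hφ, hψ]⟩
  | shift i j P hP =>
    obtain ⟨φ, hφ⟩ := hP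
    refine ⟨φ.compLinearMap fun k => if k = i then (der j : Derivation ℂ B B).toLinearMap
      else LinearMap.id, fun f => ?_⟩
    rw [MultilinearMap.compLinearMap_apply, hφ, genOp_shift]
    refine congrArg _ (funext fun k => ?_)
    by_cases hk : k = i
    · subst hk; simp
    · simp [hk]

/-- Polydifferential operators are closed under multiplying together and inserting arguments. -/
theorem exists_genOp_fibreProd (g : Fin m → Option (Fin n)) (P : PolyDiffSymbol d n) :
    ∃ Q : PolyDiffSymbol d m, ∀ (B : Type) [CommRing B] [Algebra ℂ B] [DiffAlg d B]
      (f : Fin m → B), genOp B Q f =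
        fibreProd g f none * genOp B P fun i => fibreProd g f (some i) := by
  induction P using symbol_induction with
  | base a =>
    refine ⟨Finsupp.single 0 a, fun B _ _ _ f => ?_⟩
    rw [genOp_single_zero, genOp_single_zero, mul_left_comm]
    congr 1
    have := Finset.prod_fiberwise (Finset.univ : Finset (Fin m)) g f
    rw [← this, Fintype.prod_option]
    rfl
  | add P Q hP hQ =>
    obtain ⟨P', hP'⟩ := hP
    obtain ⟨Q', hQ'⟩ := hQ
    exact ⟨P' + Q', fun B _ _ _ f => by simp [hP', hQ', mul_add]⟩
  -- By Leibniz, differentiating the product that fills slot i gives a sum over the arguments l of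
  -- that fibre.
  | shift i k P hP =>
    obtain ⟨Q, hQ⟩ := hP
    refine ⟨∑ l ∈ Finset.univ.filter (fun l => g l = some i), shift l k Q, fun B _ _ _ f => ?_⟩
    obtain ⟨φ, hφ⟩ := exists_multilinear_genOp (B := B) P
    rw [map_sum, Finset.sum_apply, genOp_shift]
    conv_rhs => rw [fibreProd.eq_def g f (some i), der_prod, ← hφ, MultilinearMap.map_update_sum,
      Finset.mul_sum]
    refine Finset.sum_congr rfl fun l hl => ?_
    rw [Finset.mem_filter] at hl
    rw [genOp_shift, hQ, hφ, fibreProd_update g f hl.2 (by simp)]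
    refine congrArg _ (congrArg _ (funext fun i' => ?_))
    by_cases hi : i' = i
    · subst hi; rw [Function.update_self]; rfl
    · rw [Function.update_of_ne hi, fibreProd_update g f hl.2 (by simpa using Ne.symm hi)]

end Symbols

end

end CyclicHKR

namespace CyclicHKR

noncomputable section

/-! ### The bar differential -/

section Bar

variable {n : ℕ} {B : Type} [CommRing B] [Algebra ℂ B]

/-- The Hochschild differential without its first term. -/
def barOp (n : ℕ) : ((Fin n → B) → B) →ₗ[ℂ] (Fin (n + 1) → B) → B where
  toFun φ a := ∑ j : Fin n, (-1) ^ ((j : ℕ) + 1) * φ (Fin.contractNth j.castSucc (· * ·) a)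
    + (-1) ^ (n + 1) * (φ (fun i => a i.castSucc) * a (Fin.last n))
  map_add' φ ψ := by
    funext a
    simp only [Pi.add_apply, mul_add, add_mul, Finset.sum_add_distrib]
    ring
  map_smul' c φ := by
    funext a
    simp only [Pi.smul_apply, RingHom.id_apply, smul_add, Finset.smul_sum, mul_smul_comm,
      smul_mul_assoc]

lemma barOp_apply (φ : (Fin n → B) → B) (a : Fin (n + 1) → B) :
    barOp n φ a = ∑ j : Fin n, (-1) ^ ((j : ℕ) + 1) * φ (Fin.contractNth j.castSucc (· * ·) a)
      + (-1) ^ (n + 1) * (φ (fun i => a i.castSucc) * a (Fin.last n)) := rfl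

lemma barOp_zero_apply (φ : (Fin 0 → B) → B) (a : Fin 1 → B) :
    barOp 0 φ a = -(φ ![] * a 0) := by
  rw [barOp_apply]
  simp only [Finset.univ_eq_empty, Finset.sum_empty, zero_add, pow_one, neg_mul, one_mul]
  rw [show (fun i : Fin 0 => a i.castSucc) = ![] from Subsingleton.elim _ _]
  rfl

lemma contractNth_zero_cons (x : B) (a : Fin (n + 1) → B) :
    Fin.contractNth (0 : Fin (n + 2)) (· * ·) (Fin.cons x a : Fin (n + 2) → B) =
      Function.update a 0 (x * a 0) := by
  funext i
  refine Fin.cases ?_ (fun i => ?_) i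
  · rw [Fin.contractNth_apply_of_eq _ _ _ _ (by simp)]
    simp
  · rw [Fin.contractNth_apply_of_gt _ _ _ _ (by simp)]
    simp

lemma contractNth_succ_cons (j : Fin (n + 1)) (x : B) (a : Fin (n + 1) → B) :
    Fin.contractNth j.succ (· * ·) (Fin.cons x a : Fin (n + 2) → B) =
      Fin.cons x (Fin.contractNth j (· * ·) a) := by
  funext i
  refine Fin.cases ?_ (fun i => ?_) i
  · rw [Fin.contractNth_apply_of_lt _ _ _ _ (by simp)]
    simp
  · rw [Fin.cons_succ]
    rcases lt_trichotomy (i : ℕ) (j : ℕ) with h | h | h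
    · rw [Fin.contractNth_apply_of_lt _ _ _ _ (by simpa using h),
        Fin.contractNth_apply_of_lt _ _ _ _ h, ← Fin.succ_castSucc, Fin.cons_succ]
    · rw [Fin.contractNth_apply_of_eq _ _ _ _ (by simpa using h),
        Fin.contractNth_apply_of_eq _ _ _ _ h, ← Fin.succ_castSucc, Fin.cons_succ, Fin.cons_succ]
    · rw [Fin.contractNth_apply_of_gt _ _ _ _ (by simpa using h),
        Fin.contractNth_apply_of_gt _ _ _ _ h, Fin.cons_succ]

/-- Freezing the first argument expresses b' through b' in one variable less; the inductions on b'
below rest on this recursion. -/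
lemma barOp_cons (φ : (Fin (n + 1) → B) → B) (x : B) (a : Fin (n + 1) → B) :
    barOp (n + 1) φ (Fin.cons x a) =
      -φ (Function.update a 0 (x * a 0)) - barOp n (fun f => φ (Fin.cons x f)) a := by
  have h : (fun i : Fin (n + 1) => (Fin.cons x a : Fin (n + 2) → B) i.castSucc) =
      Fin.cons x fun i : Fin n => a i.castSucc := by
    funext i
    refine Fin.cases ?_ (fun i => ?_) i
    · simp
    · rw [← Fin.succ_castSucc, Fin.cons_succ, Fin.cons_succ]
  rw [barOp_apply, barOp_apply, Fin.sum_univ_succ, h, ← Fin.succ_last, Fin.cons_succ]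
  simp only [Fin.castSucc_zero, contractNth_zero_cons, ← Fin.succ_castSucc, contractNth_succ_cons,
    Fin.val_zero, Fin.val_succ, zero_add, pow_one, pow_succ _ (n + 1)]
  simp only [pow_succ _ (_ + 1), mul_neg, mul_one, neg_mul, Finset.sum_neg_distrib, one_mul]
  ring

lemma cons_update_zero (y z : B) (a : Fin n → B) :
    Function.update (Fin.cons y a : Fin (n + 1) → B) 0 z = Fin.cons z a := by
  simp

lemma barOp_mul_first (φ : (Fin (n + 1) → B) → B) (x : B) (a : Fin (n + 2) → B) :
    barOp (n + 1) (fun f => φ (Function.update f 0 (x * f 0))) a =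
      barOp (n + 1) φ (Function.update a 0 (x * a 0)) := by
  obtain ⟨y, a, rfl⟩ : ∃ y a', a = Fin.cons y a' := ⟨a 0, Fin.tail a, (Fin.cons_self_tail a).symm⟩
  rw [Fin.cons_zero, cons_update_zero, barOp_cons, barOp_cons]
  simp [mul_assoc]

lemma barOp_barOp (φ : (Fin n → B) → B) : barOp (n + 1) (barOp n φ) = 0 := by
  induction n with
  | zero =>
    funext a
    obtain ⟨y, a, rfl⟩ : ∃ y a', a = Fin.cons y a' :=
      ⟨a 0, Fin.tail a, (Fin.cons_self_tail a).symm⟩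
    rw [barOp_cons, barOp_zero_apply, barOp_zero_apply, barOp_zero_apply]
    simp
    ring
  | succ n ih =>
    funext a
    obtain ⟨x, a, rfl⟩ : ∃ y a', a = Fin.cons y a' :=
      ⟨a 0, Fin.tail a, (Fin.cons_self_tail a).symm⟩
    rw [barOp_cons]
    have : (fun f => barOp (n + 1) φ (Fin.cons x f)) =
        -(fun f => φ (Function.update f 0 (x * f 0))) - barOp n (fun f => φ (Fin.cons x f)) := by
      funext f
      rw [barOp_cons]
      rfl
    rw [this, map_sub, map_neg, ih, Pi.sub_apply, Pi.neg_apply, barOp_mul_first]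
    simp

/-- Acyclicity of b': insertion of 1 in the first slot is a contracting homotopy up to sign. -/
lemma barOp_insert_one (φ : (Fin (n + 1) → B) → B) (a : Fin (n + 1) → B) :
    barOp (n + 1) φ (Fin.cons 1 a) = -φ a - barOp n (fun f => φ (Fin.cons 1 f)) a := by
  rw [barOp_cons]
  simp

lemma barOp_mul_left (φ : (Fin n → B) → B) (x : B) (a : Fin (n + 1) → B) :
    barOp n (fun f => x * φ f) a = x * barOp n φ a := by
  simp only [barOp_apply, mul_add, Finset.mul_sum]
  congr 1
  · exact Finset.sum_congr rfl fun _ _ => by ring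
  · ring

/-- The bracket is the Hochschild differential of φ, so multiplication by a new first argument
intertwines b with -b'. -/
lemma barOp_mul_tail (φ : (Fin n → B) → B) (a : Fin (n + 2) → B) :
    barOp (n + 1) (fun f => f 0 * φ (Fin.tail f)) a =
      -(a 0 * (a 1 * φ (fun i => a i.succ.succ) + barOp n φ (Fin.tail a))) := by
  obtain ⟨x, a, rfl⟩ : ∃ y a', a = Fin.cons y a' := ⟨a 0, Fin.tail a, (Fin.cons_self_tail a).symm⟩
  have h : (fun f : Fin n → B => (Fin.cons x f : Fin (n + 1) → B) 0 * φ (Fin.tail (Fin.cons x f : Fin (n + 1) → B)))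
      = fun f => x * φ f := by
    funext f; simp
  have h3 : Fin.tail (Function.update a 0 (x * a 0)) = Fin.tail a := by
    funext i; simp [Fin.tail]
  rw [barOp_cons, h, barOp_mul_left, h3, show (1 : Fin (n + 2)) = Fin.succ 0 from rfl]
  simp only [Function.update_self, Fin.cons_succ, Fin.cons_zero, Fin.tail_cons]
  rw [show (fun i : Fin n => a i.succ) = Fin.tail a from rfl]
  ring

end Bar

/-! ### Polydifferential operators on polynomials -/

section PolyDiff

variable {d n m : ℕ}

lemma hochschildD_eq (φ : Cochain d n) (a : Fin (n + 1) → Poly d) :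
    hochschildD d n φ a = a 0 * φ (Fin.tail a) + barOp n φ a := by
  rw [barOp_apply, ← add_assoc]
  rfl

lemma contractNth_eq_fibreProd {B : Type} [CommMonoid B] (j : Fin n) (a : Fin (n + 1) → B) :
    Fin.contractNth j.castSucc (· * ·) a =
      fun i => fibreProd (fun l => some (j.predAbove l)) a (some i) := by
  funext i
  have hp : ∀ l : Fin (n + 1), j.predAbove l = i ↔
      (if (j : ℕ) < l then (l : ℕ) = i + 1 else (l : ℕ) = i) := by
    intro l
    simp only [Fin.predAbove, Fin.lt_def, Fin.ext_iff, Fin.val_castSucc]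
    split_ifs
    · simp; omega
    · simp
  simp only [fibreProd, Option.some.injEq, hp]
  rcases lt_trichotomy (i : ℕ) (j : ℕ) with h | h | h
  · rw [Fin.contractNth_apply_of_lt _ _ _ _ (by simpa using h)]
    have : (Finset.univ.filter fun l : Fin (n + 1) =>
        if (j : ℕ) < l then (l : ℕ) = i + 1 else (l : ℕ) = i) = {i.castSucc} := by
      ext l
      simp only [Finset.mem_filter, Finset.mem_univ, true_and, Finset.mem_singleton, Fin.ext_iff,
        Fin.val_castSucc]
      split_ifs <;> omega
    rw [this, Finset.prod_singleton]
  · rw [Fin.contractNth_apply_of_eq _ _ _ _ (by simpa using h)]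
    have : (Finset.univ.filter fun l : Fin (n + 1) =>
        if (j : ℕ) < l then (l : ℕ) = i + 1 else (l : ℕ) = i) = {i.castSucc, i.succ} := by
      ext l
      simp only [Finset.mem_filter, Finset.mem_univ, true_and, Finset.mem_insert,
        Finset.mem_singleton, Fin.ext_iff, Fin.val_castSucc, Fin.val_succ]
      split_ifs <;> omega
    rw [this, Finset.prod_pair (by simp [Fin.ext_iff])]
  · rw [Fin.contractNth_apply_of_gt _ _ _ _ (by simpa using h)]
    have : (Finset.univ.filter fun l : Fin (n + 1) =>
        if (j : ℕ) < l then (l : ℕ) = i + 1 else (l : ℕ) = i) = {i.succ} := by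
      ext l
      simp only [Finset.mem_filter, Finset.mem_univ, true_and, Finset.mem_singleton, Fin.ext_iff,
        Fin.val_succ]
      split_ifs <;> omega
    rw [this, Finset.prod_singleton]

lemma exists_genOp_contractNth (j : Fin n) (P : PolyDiffSymbol d n) :
    ∃ Q : PolyDiffSymbol d (n + 1), ∀ (B : Type) [CommRing B] [Algebra ℂ B] [DiffAlg d B]
      (f : Fin (n + 1) → B), genOp B Q f =
        genOp B P (Fin.contractNth j.castSucc (· * ·) f) := by
  obtain ⟨Q, hQ⟩ := exists_genOp_fibreProd (fun l => some (j.predAbove l)) P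
  refine ⟨Q, fun B _ _ _ f => ?_⟩
  rw [hQ, contractNth_eq_fibreProd]
  simp [fibreProd]

lemma exists_genOp_mul_last (P : PolyDiffSymbol d n) :
    ∃ Q : PolyDiffSymbol d (n + 1), ∀ (B : Type) [CommRing B] [Algebra ℂ B] [DiffAlg d B]
      (f : Fin (n + 1) → B), genOp B Q f =
        genOp B P (fun i => f i.castSucc) * f (Fin.last n) := by
  obtain ⟨Q, hQ⟩ := exists_genOp_fibreProd (Fin.snoc (α := fun _ => Option (Fin n)) some none) P
  refine ⟨Q, fun B _ _ _ f => ?_⟩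
  rw [hQ, mul_comm]
  simp [fibreProd, Finset.prod_filter, Fin.prod_univ_castSucc]

lemma exists_genOp_mul_first (P : PolyDiffSymbol d n) :
    ∃ Q : PolyDiffSymbol d (n + 1), ∀ (B : Type) [CommRing B] [Algebra ℂ B] [DiffAlg d B]
      (f : Fin (n + 1) → B), genOp B Q f = f 0 * genOp B P (Fin.tail f) := by
  obtain ⟨Q, hQ⟩ := exists_genOp_fibreProd (Fin.cons (α := fun _ => Option (Fin n)) none some) P
  refine ⟨Q, fun B _ _ _ f => ?_⟩
  rw [hQ]
  simp [fibreProd, Finset.prod_filter, Fin.prod_univ_succ, Fin.tail_def]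

lemma exists_genOp_insert_one (P : PolyDiffSymbol d (n + 1)) :
    ∃ Q : PolyDiffSymbol d n, ∀ (B : Type) [CommRing B] [Algebra ℂ B] [DiffAlg d B]
      (f : Fin n → B), genOp B Q f = genOp B P (Fin.cons 1 f) := by
  obtain ⟨Q, hQ⟩ := exists_genOp_fibreProd (fun l : Fin n => some l.succ) P
  refine ⟨Q, fun B _ _ _ f => ?_⟩
  rw [hQ]
  have : (fun i => fibreProd (fun l : Fin n => some l.succ) f (some i)) = Fin.cons 1 f := by
    funext i
    refine Fin.cases ?_ (fun i => ?_) i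
    · simp [fibreProd, Fin.succ_ne_zero]
    · simp [fibreProd, Finset.prod_filter]
  rw [this]
  simp [fibreProd]

lemma exists_genOp_bar (P : PolyDiffSymbol d n) :
    ∃ Q : PolyDiffSymbol d (n + 1), ∀ (B : Type) [CommRing B] [Algebra ℂ B] [DiffAlg d B],
      genOp B Q = barOp n (genOp B P) := by
  choose Q hQ using fun j : Fin n => exists_genOp_contractNth j P
  obtain ⟨Q', hQ'⟩ := exists_genOp_mul_last P
  refine ⟨∑ j : Fin n, (-1 : ℂ) ^ ((j : ℕ) + 1) • Q j + (-1 : ℂ) ^ (n + 1) • Q',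
    fun B _ _ _ => ?_⟩
  have hs : ∀ (k : ℕ) (x : B), (-1 : ℂ) ^ k • x = (-1) ^ k * x := by
    intro k x
    rcases Nat.even_or_odd k with h | h <;> simp [h.neg_one_pow]
  funext f
  rw [barOp_apply, map_add, map_sum, Pi.add_apply, Finset.sum_apply]
  simp only [map_smul, Pi.smul_apply, hQ, hQ', hs]

/-- The polydifferential operators on polynomials. -/
abbrev PolyDiff (d n : ℕ) : Submodule ℂ (Cochain d n) := LinearMap.range (polyOp d n)

lemma PolyDiff.induction {motive : Cochain d n → Prop}
    (base : ∀ a, motive fun f => a * ∏ i, f i)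
    (add : ∀ φ ψ, φ ∈ PolyDiff d n → ψ ∈ PolyDiff d n → motive φ → motive ψ → motive (φ + ψ))
    (shift : ∀ i j φ, φ ∈ PolyDiff d n → motive φ →
      motive fun f => φ (Function.update f i (MvPolynomial.pderiv j (f i))))
    {φ : Cochain d n} (hφ : φ ∈ PolyDiff d n) : motive φ := by
  obtain ⟨P, rfl⟩ := hφ
  induction P using symbol_induction with
  | base a =>
    convert base a using 1
    funext f
    rw [polyOp_eq_genOp, genOp_single_zero]
    rfl
  | add P Q hP hQ => rw [map_add]; exact add _ _ ⟨P, rfl⟩ ⟨Q, rfl⟩ hP hQ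
  | shift i j P hP =>
    convert shift i j _ ⟨P, rfl⟩ hP using 1
    funext f
    rw [polyOp_eq_genOp, genOp_shift]
    rfl

lemma PolyDiff.shift_mem (i : Fin n) (j : Fin d) {φ : Cochain d n} (hφ : φ ∈ PolyDiff d n) :
    (fun f => φ (Function.update f i (MvPolynomial.pderiv j (f i)))) ∈ PolyDiff d n := by
  obtain ⟨P, rfl⟩ := hφ
  refine ⟨shift i j P, ?_⟩
  funext f
  rw [polyOp_eq_genOp, genOp_shift]
  rfl

lemma PolyDiff.exists_multilinear {φ : Cochain d n} (hφ : φ ∈ PolyDiff d n) :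
    ∃ ψ : MultilinearMap ℂ (fun _ : Fin n => Poly d) (Poly d), φ = ψ := by
  obtain ⟨P, rfl⟩ := hφ
  obtain ⟨ψ, hψ⟩ := exists_multilinear_genOp (B := Poly d) P
  exact ⟨ψ, funext fun f => (hψ f).symm⟩

lemma barOp_mem {φ : Cochain d n} (hφ : φ ∈ PolyDiff d n) : barOp n φ ∈ PolyDiff d (n + 1) := by
  obtain ⟨P, rfl⟩ := hφ
  obtain ⟨Q, hQ⟩ := exists_genOp_bar P
  exact ⟨Q, hQ (Poly d)⟩

/-- The bar differential on polydifferential operators. -/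
def barP (d n : ℕ) : PolyDiff d n →ₗ[ℂ] PolyDiff d (n + 1) :=
  (barOp n).restrict fun _ => barOp_mem

/-- Multiplication by a new first argument. -/
def mulFirst (d n : ℕ) : PolyDiff d n →ₗ[ℂ] PolyDiff d (n + 1) :=
  LinearMap.restrict
    (⟨⟨fun φ f => f 0 * φ (Fin.tail f), fun _ _ => by funext f; simp [mul_add]⟩,
      fun _ _ => by funext f; simp⟩ : Cochain d n →ₗ[ℂ] Cochain d (n + 1)) (by
    rintro _ ⟨P, rfl⟩
    obtain ⟨Q, hQ⟩ := exists_genOp_mul_first P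
    exact ⟨Q, funext (hQ (Poly d))⟩)

/-- The Hochschild differential on polydifferential operators. -/
def hochP (d n : ℕ) : PolyDiff d n →ₗ[ℂ] PolyDiff d (n + 1) := mulFirst d n + barP d n

/-- Insertion of `1` as the first argument. -/
def insertOne (d n : ℕ) : PolyDiff d (n + 1) →ₗ[ℂ] PolyDiff d n :=
  LinearMap.restrict
    (⟨⟨fun φ f => φ (Fin.cons 1 f), fun _ _ => rfl⟩, fun _ _ => rfl⟩ :
      Cochain d (n + 1) →ₗ[ℂ] Cochain d n) (by
    rintro _ ⟨P, rfl⟩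
    obtain ⟨Q, hQ⟩ := exists_genOp_insert_one P
    exact ⟨Q, funext (hQ (Poly d))⟩)

/-- Since [∂_k, x_j] = δ_{kj}, the commutator with x_j is again polydifferential, as one sees on the
generators. -/
lemma PolyDiff.commX_mem (j : Fin d) {φ : Cochain d (n + 1)} (hφ : φ ∈ PolyDiff d (n + 1)) :
    (fun f => φ (Function.update f 0 (MvPolynomial.X j * f 0)) - MvPolynomial.X j * φ f) ∈
      PolyDiff d (n + 1) := by
  refine PolyDiff.induction (motive := fun φ =>
    (fun f => φ (Function.update f 0 (MvPolynomial.X j * f 0)) - MvPolynomial.X j * φ f) ∈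
      PolyDiff d (n + 1))
    (fun a => ?_) (fun φ ψ _ _ hφ hψ => ?_) (fun i k φ hmem hφ => ?_) hφ
  · convert (PolyDiff d (n + 1)).zero_mem using 1
    funext f
    simp only [Fin.prod_univ_succ]
    simp
    ring
  · convert add_mem hφ hψ using 1
    funext f
    simp
    ring
  · by_cases hi : i = 0
    · subst hi
      have h := PolyDiff.shift_mem 0 k hφ
      obtain ⟨ψ, rfl⟩ := PolyDiff.exists_multilinear hmem
      have h2 : (if k = j then 1 else 0 : ℂ) • (ψ : Cochain d (n + 1)) ∈ PolyDiff d (n + 1) :=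
        Submodule.smul_mem _ _ hmem
      convert add_mem h h2 using 1
      funext f
      simp only [Function.update_idem, Function.update_self, Derivation.leibniz, smul_eq_mul,
        MvPolynomial.pderiv_X, ψ.map_update_add, Pi.add_apply, Pi.smul_apply]
      by_cases hk : k = j
      · subst hk; simp; ring
      · simp [hk, Ne.symm hk]
    · convert PolyDiff.shift_mem i k hφ using 1
      funext f
      simp only [Function.update_of_ne hi, Function.update_of_ne (Ne.symm hi)]
      rw [Function.update_comm hi]

/-- The commutator with `x_j` in the first argument. -/
def commX (n : ℕ) (j : Fin d) : PolyDiff d (n + 1) →ₗ[ℂ] PolyDiff d (n + 1) :=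
  LinearMap.restrict
    (⟨⟨fun φ f => φ (Function.update f 0 (MvPolynomial.X j * f 0)) - MvPolynomial.X j * φ f,
      fun _ _ => by funext f; simp; ring⟩, fun _ _ => by funext f; simp [smul_sub]⟩ :
      Cochain d (n + 1) →ₗ[ℂ] Cochain d (n + 1)) fun _ => PolyDiff.commX_mem j

/-- Precomposition of the first argument with `∂_j`. -/
def precD (n : ℕ) (j : Fin d) : PolyDiff d (n + 1) →ₗ[ℂ] PolyDiff d (n + 1) :=
  LinearMap.restrict
    (⟨⟨fun φ f => φ (Function.update f 0 (MvPolynomial.pderiv j (f 0))),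
      fun _ _ => rfl⟩, fun _ _ => rfl⟩ :
      Cochain d (n + 1) →ₗ[ℂ] Cochain d (n + 1)) fun _ => PolyDiff.shift_mem 0 j

@[simp] lemma barP_coe (φ : PolyDiff d n) : (barP d n φ).1 = barOp n φ.1 := rfl

@[simp] lemma mulFirst_apply (φ : PolyDiff d n) (f : Fin (n + 1) → Poly d) :
    (mulFirst d n φ).1 f = f 0 * φ.1 (Fin.tail f) := rfl

@[simp] lemma insertOne_apply (φ : PolyDiff d (n + 1)) (f : Fin n → Poly d) :
    (insertOne d n φ).1 f = φ.1 (Fin.cons 1 f) := rfl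

lemma commX_apply (j : Fin d) (φ : PolyDiff d (n + 1)) (f : Fin (n + 1) → Poly d) :
    (commX n j φ).1 f = φ.1 (Function.update f 0 (MvPolynomial.X j * f 0)) -
      MvPolynomial.X j * φ.1 f := rfl

lemma precD_apply (j : Fin d) (φ : PolyDiff d (n + 1)) (f : Fin (n + 1) → Poly d) :
    (precD n j φ).1 f = φ.1 (Function.update f 0 (MvPolynomial.pderiv j (f 0))) := rfl

lemma hochP_coe (φ : PolyDiff d n) : (hochP d n φ).1 = hochschildD d n φ.1 := by
  funext a
  rw [hochschildD_eq]
  rfl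

lemma barP_barP (φ : PolyDiff d n) : barP d (n + 1) (barP d n φ) = 0 :=
  Subtype.ext (barOp_barOp φ.1)

lemma insertOne_barP (φ : PolyDiff d (n + 1)) :
    insertOne d (n + 1) (barP d (n + 1) φ) = -φ - barP d n (insertOne d n φ) :=
  Subtype.ext (funext fun a => barOp_insert_one φ.1 a)

lemma insertOne_barP_zero (φ : PolyDiff d 0) : insertOne d 0 (barP d 0 φ) = -φ := by
  refine Subtype.ext (funext fun a => ?_)
  rw [insertOne_apply, barP_coe, barOp_zero_apply, Subsingleton.elim a ![]]
  simp

lemma barP_mulFirst (φ : PolyDiff d n) :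
    barP d (n + 1) (mulFirst d n φ) = -mulFirst d (n + 1) (hochP d n φ) := by
  refine Subtype.ext (funext fun a => ?_)
  exact barOp_mul_tail φ.1 a

lemma insertOne_mulFirst (φ : PolyDiff d n) : insertOne d n (mulFirst d n φ) = φ := by
  refine Subtype.ext (funext fun a => ?_)
  simp

/-! ### Relations between the commutators with x_j, the bar differential and precomposition with ∂_j
-/

lemma commX_comm (i j : Fin d) (φ : PolyDiff d (n + 1)) :
    commX n i (commX n j φ) = commX n j (commX n i φ) := by
  refine Subtype.ext (funext fun a => ?_)
  simp only [commX_apply, Function.update_idem, Function.update_self,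
    mul_left_comm (MvPolynomial.X i) (MvPolynomial.X j)]
  ring

lemma commX_barP (j : Fin d) (φ : PolyDiff d (n + 1)) :
    commX (n + 1) j (barP d (n + 1) φ) = barP d (n + 1) (commX n j φ) := by
  refine Subtype.ext (funext fun a => ?_)
  have h : (commX n j φ).1 = (fun f => φ.1 (Function.update f 0 (MvPolynomial.X j * f 0))) -
      fun f => MvPolynomial.X j * φ.1 f := funext fun f => commX_apply j φ f
  rw [commX_apply, barP_coe, barP_coe, ← barOp_mul_first, h, map_sub, Pi.sub_apply,
    barOp_mul_left]

lemma commX_barP_zero (j : Fin d) (φ : PolyDiff d 0) : commX 0 j (barP d 0 φ) = 0 := by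
  refine Subtype.ext (funext fun a => ?_)
  rw [commX_apply, barP_coe, barOp_zero_apply, barOp_zero_apply]
  simp
  ring

lemma commX_mulFirst (j : Fin d) (φ : PolyDiff d n) : commX n j (mulFirst d n φ) = 0 := by
  refine Subtype.ext (funext fun a => ?_)
  have : Fin.tail (Function.update a 0 (MvPolynomial.X j * a 0)) = Fin.tail a := by
    funext i; simp [Fin.tail]
  rw [commX_apply, mulFirst_apply, mulFirst_apply, this]
  simp
  ring

/-- The Weyl relation that makes the Poincaré lemma available with D = `commX` and e = `precD`. -/
lemma commX_precD (i j : Fin d) (φ : PolyDiff d (n + 1)) :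
    commX n i (precD n j φ) = precD n j (commX n i φ) + if i = j then φ else 0 := by
  refine Subtype.ext (funext fun f => ?_)
  obtain ⟨ψ, hψ⟩ := PolyDiff.exists_multilinear φ.2
  simp only [commX_apply, precD_apply, Submodule.coe_add, Pi.add_apply, hψ]
  simp only [Function.update_idem, Function.update_self, Derivation.leibniz, smul_eq_mul,
    MvPolynomial.pderiv_X, ψ.map_update_add]
  by_cases hk : i = j
  · subst hk; simp [hψ]; ring
  · simp [hk]

/-- Commuting with every x_j means being A-linear in the first slot, so that slot is determined by
its value at 1. Hence the degree-zero Koszul cohomology is the image of `mulFirst`. -/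
lemma eq_mulFirst_insertOne (φ : PolyDiff d (n + 1)) (h : ∀ j, commX n j φ = 0) :
    φ = mulFirst d n (insertOne d n φ) := by
  refine Subtype.ext (funext fun f => ?_)
  obtain ⟨ψ, hψ⟩ := PolyDiff.exists_multilinear φ.2
  have hX : ∀ j f, φ.1 (Function.update f 0 (MvPolynomial.X j * f 0)) =
      MvPolynomial.X j * φ.1 f := by
    intro j f
    have := congrArg (fun χ : PolyDiff d (n + 1) => χ.1 f) (h j)
    exact sub_eq_zero.1 this
  have key : ∀ (p : Poly d) (g : Fin n → Poly d),
      φ.1 (Fin.cons p g) = p * φ.1 (Fin.cons 1 g) := by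
    intro p g
    induction p using MvPolynomial.induction_on with
    | C c =>
      have := ψ.map_update_smul (Fin.cons 1 g) 0 c 1
      rw [cons_update_zero, cons_update_zero, ← hψ] at this
      rw [MvPolynomial.C_eq_smul_one, this, smul_mul_assoc, one_mul]
    | add p q hp hq =>
      have := ψ.map_update_add (Fin.cons 1 g) 0 p q
      rw [cons_update_zero, cons_update_zero, cons_update_zero, ← hψ] at this
      rw [this, hp, hq, add_mul]
    | mul_X p j hp =>
      have := hX j (Fin.cons p g)
      rw [cons_update_zero, Fin.cons_zero] at this
      rw [mul_comm p, this, hp, mul_assoc]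
  rw [mulFirst_apply, insertOne_apply, ← key, Fin.cons_self_tail]

/-- A differential operator has finite order in its first slot, and each commutator with a
coordinate lowers that order. -/
lemma exists_mem_nilFil_commX (φ : PolyDiff d (n + 1)) : ∃ m, φ ∈ nilFil (commX (d := d) n) m := by
  obtain ⟨φ, hφ⟩ := φ
  refine PolyDiff.induction
    (motive := fun φ => ∀ hφ, ∃ m, (⟨φ, hφ⟩ : PolyDiff d (n + 1)) ∈ nilFil (commX (d := d) n) m)
    (fun a hφ => ?_) (fun φ ψ h1 h2 hφ hψ h => ?_) (fun i k φ hmem ih hφ => ?_) hφ hφ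
  · refine ⟨1, mem_nilFil_succ.2 fun j => ?_⟩
    have : commX n j ⟨_, hφ⟩ = 0 := by
      refine Subtype.ext (funext fun f => ?_)
      rw [commX_apply]
      simp only [Fin.prod_univ_succ]
      simp
      ring
    rw [this]
    exact zero_mem _
  · obtain ⟨m, hm⟩ := hφ h1
    obtain ⟨m', hm'⟩ := hψ h2
    exact ⟨max m m', add_mem (nilFil_mono _ (le_max_left _ _) hm)
      (nilFil_mono _ (le_max_right _ _) hm')⟩
  · obtain ⟨m, hm⟩ := ih hmem
    by_cases hi : i = 0
    · subst hi
      exact ⟨m + 1, nilFil_weyl_map commX_precD k hm⟩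
    · refine ⟨m, ?_⟩
      let T : PolyDiff d (n + 1) →ₗ[ℂ] PolyDiff d (n + 1) := LinearMap.restrict
        (⟨⟨fun φ f => φ (Function.update f i (MvPolynomial.pderiv k (f i))),
          fun _ _ => rfl⟩, fun _ _ => rfl⟩ :
          Cochain d (n + 1) →ₗ[ℂ] Cochain d (n + 1)) fun _ => PolyDiff.shift_mem i k
      refine nilFil_comm_map T (fun j x => ?_) hm
      refine Subtype.ext (funext fun f => ?_)
      simp only [T, commX_apply, LinearMap.coe_restrict_apply, LinearMap.coe_mk, AddHom.coe_mk,
        Function.update_of_ne hi, Function.update_of_ne (Ne.symm hi)]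
      rw [Function.update_comm hi]

end PolyDiff

end

end CyclicHKR

namespace CyclicHKR

noncomputable section

/-! ### The Hochschild–Kostant–Rosenberg theorem -/

section HKR

variable {d n p q : ℕ}

/-- The Leibniz defects of the δ_b cancel successively and only the defect of `L` is left. It
vanishes when `L` is multiplication by a fixed element, which shows that f_0 γ(df_1, …, df_n) is
b'-closed. -/
lemma barOp_mul_prod_der {B : Type} [CommRing B] [Algebra ℂ B] (L : B → B)
    (δ : Fin n → Derivation ℂ B B) (a : Fin (n + 2) → B) :
    barOp (n + 1) (fun f => L (f 0) * ∏ b, δ b (f b.succ)) a =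
      (L (a 0) * a 1 - L (a 0 * a 1)) * ∏ b : Fin n, δ b (a b.succ.succ) := by
  induction n generalizing L with
  | zero =>
    obtain ⟨x, a, rfl⟩ : ∃ y a', a = Fin.cons y a' :=
      ⟨a 0, Fin.tail a, (Fin.cons_self_tail a).symm⟩
    rw [barOp_cons, barOp_zero_apply, show (1 : Fin 2) = Fin.succ 0 from rfl]
    simp
    ring
  | succ n ih =>
    obtain ⟨x, a, rfl⟩ : ∃ y a', a = Fin.cons y a' :=
      ⟨a 0, Fin.tail a, (Fin.cons_self_tail a).symm⟩
    have h : (fun f : Fin (n + 1) → B => L ((Fin.cons x f : Fin (n + 2) → B) 0) *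
        ∏ b, δ b ((Fin.cons x f : Fin (n + 2) → B) b.succ)) =
        fun f => L x * (δ 0 (f 0) * ∏ b : Fin n, δ b.succ (f b.succ)) := by
      funext f
      simp [Fin.prod_univ_succ]
    rw [barOp_cons, h, barOp_mul_left, ih (δ 0) (fun b => δ b.succ),
      show (1 : Fin (n + 3)) = Fin.succ 0 from rfl, Fin.prod_univ_succ, Fin.prod_univ_succ]
    simp only [Function.update_self, Fin.cons_succ, Fin.cons_zero, Derivation.leibniz,
      smul_eq_mul, ne_eq, Fin.succ_ne_zero, not_false_eq_true, Function.update_of_ne]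
    rw [show (Fin.succ 0 : Fin (n + 2)) = 1 from rfl]
    ring

/-- The symbol of `a ∂_{i_1} ⊗ ⋯ ⊗ ∂_{i_n}`. -/
def monoSymbol (i : Fin n → Fin d) : Poly d →ₗ[ℂ] PolyDiffSymbol d n :=
  Finsupp.lsingle fun b => Pi.single (i b) 1

lemma genOp_monoSymbol {B : Type} [CommRing B] [Algebra ℂ B] [DiffAlg d B] (i : Fin n → Fin d)
    (a : Poly d) (f : Fin n → B) :
    genOp B (monoSymbol i a) f = coeffHom a * ∏ b, der (i b) (f b) := by
  simp only [genOp, LinearMap.coe_mk, AddHom.coe_mk, monoSymbol, Finsupp.lsingle_apply]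
  rw [Finsupp.sum_single_index (by simp)]
  congr 1
  refine Finset.prod_congr rfl fun b _ => ?_
  have := multiDeriv_add_single (fun j => (der j : B → B)) DiffAlg.der_comm 0 (i b) (f b)
  rwa [zero_add, multiDeriv_zero] at this

/-- The operator `a ∂_{i_1} ⊗ ⋯ ⊗ ∂_{i_n}`. -/
def monoP (i : Fin n → Fin d) : Poly d →ₗ[ℂ] PolyDiff d n :=
  (polyOp d n).rangeRestrict ∘ₗ monoSymbol i

lemma monoP_apply (i : Fin n → Fin d) (a : Poly d) (f : Fin n → Poly d) :
    (monoP i a).1 f = a * ∏ b, MvPolynomial.pderiv (i b) (f b) :=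
  genOp_monoSymbol i a f

lemma barP_mulFirst_monoP (i : Fin n → Fin d) (a : Poly d) :
    barP d (n + 1) (mulFirst d n (monoP i a)) = 0 := by
  refine Subtype.ext (funext fun f => ?_)
  have h : (mulFirst d n (monoP i a)).1 =
      fun f => (f 0 * a) * ∏ b, MvPolynomial.pderiv (i b) (f b.succ) := by
    funext f
    rw [mulFirst_apply, monoP_apply, mul_assoc]
    rfl
  rw [barP_coe, h,
    barOp_mul_prod_der (fun x => x * a) (fun b => MvPolynomial.pderiv (i b))]
  simp
  ring_nf
  simp

lemma commX_monoP (i : Fin (n + 1) → Fin d) (a : Poly d) (j : Fin d) :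
    commX n j (monoP i a) = (Pi.single (i 0) 1 : Fin d → ℂ) j •
      mulFirst d n (monoP (Fin.tail i) a) := by
  refine Subtype.ext (funext fun f => ?_)
  rw [commX_apply, monoP_apply, monoP_apply, SetLike.val_smul, Pi.smul_apply, mulFirst_apply,
    monoP_apply, Fin.prod_univ_succ, Fin.prod_univ_succ]
  simp only [Function.update_self, Derivation.leibniz, smul_eq_mul, MvPolynomial.pderiv_X, ne_eq,
    Fin.succ_ne_zero, not_false_eq_true, Function.update_of_ne, Fin.tail]
  by_cases h : i 0 = j
  · subst h
    simp
    ring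
  · simp [Ne.symm h]
    ring

lemma sum_fin_cons {M α : Type} [AddCommMonoid M] [Fintype α] (F : (Fin (n + 1) → α) → M) :
    ∑ i, F i = ∑ i : Fin n → α, ∑ j, F (Fin.cons j i) := by
  rw [← (Fin.consEquiv fun _ => α).sum_comp, Fintype.sum_prod_type_right]
  rfl

/-- Reindexing of alternating maps along an equality of degrees. -/
def castAlt {M : Type} [AddCommGroup M] [Module ℂ M] {n m : ℕ} (h : n = m) :
    Alt d n M ≃ₗ[ℂ] Alt d m M := by
  subst h
  exact LinearEquiv.refl ℂ _

lemma castAlt_curryLeft {M : Type} [AddCommGroup M] [Module ℂ M] {n m : ℕ} (h : n = m)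
    (h' : n + 1 = m + 1) (γ : Alt d (n + 1) M) (w : Fin d → ℂ) :
    (castAlt h' γ).curryLeft w = castAlt h (γ.curryLeft w) := by
  subst h
  rfl

/-- Evaluation of the first `q` arguments of an alternating map. -/
def evalFirst {M : Type} [AddCommGroup M] [Module ℂ M] (p : ℕ) :
    ∀ q, (Fin q → Fin d → ℂ) → Alt d (p + q) M →ₗ[ℂ] Alt d p M
  | 0, _ => LinearMap.id
  | q + 1, u => evalFirst p q (Fin.tail u) ∘ₗ
      (⟨⟨fun γ => AlternatingMap.curryLeft γ (u 0), fun _ _ => by simp⟩, fun _ _ => by simp⟩ :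
        Alt d (p + q + 1) M →ₗ[ℂ] Alt d (p + q) M)

section

variable {M : Type} [AddCommGroup M] [Module ℂ M]

lemma evalFirst_succ (u : Fin (q + 1) → Fin d → ℂ) (γ : Alt d (p + (q + 1)) M) :
    evalFirst p (q + 1) u γ = evalFirst p q (Fin.tail u)
      (AlternatingMap.curryLeft (n := p + q) γ (u 0)) := rfl

lemma curryLeft_swap {n : ℕ} (γ : Alt d (n + 2) M) (x y : Fin d → ℂ) :
    (γ.curryLeft x).curryLeft y = -(γ.curryLeft y).curryLeft x := by
  ext v
  simp [Alt.map_vecCons_swap γ x y]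

/-- The sign is that of moving `w` past the q evaluated vectors. -/
lemma evalFirst_cons (w : Fin d → ℂ) (u : Fin q → Fin d → ℂ) (γ : Alt d (p + (q + 1)) M)
    (h : p + (q + 1) = p + 1 + q) (v : Fin p → Fin d → ℂ) :
    evalFirst p (q + 1) (Fin.cons w u) γ v =
      (-1 : ℂ) ^ q • evalFirst (p + 1) q u (castAlt h γ) (Matrix.vecCons w v) := by
  induction q with
  | zero =>
    simp only [evalFirst_succ, pow_zero, one_smul]
    rfl
  | succ q ih =>
    rw [evalFirst_succ, Fin.tail_cons, Fin.cons_zero, evalFirst_succ, evalFirst_succ,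
      curryLeft_swap]
    have h1 := ih (Fin.tail u) (AlternatingMap.curryLeft (n := p + (q + 1)) γ (u 0)) (by omega)
    rw [evalFirst_succ, Fin.tail_cons, Fin.cons_zero] at h1
    rw [map_neg, AlternatingMap.neg_apply, h1,
      castAlt_curryLeft (n := p + (q + 1)) (m := p + 1 + q) (by omega) h γ (u 0), pow_succ]
    simp

lemma evalFirst_zero_apply (u : Fin q → Fin d → ℂ) (γ : Alt d (0 + q) M) (h : 0 + q = q)
    (v : Fin 0 → Fin d → ℂ) : evalFirst 0 q u γ v = castAlt h γ u := by
  induction q with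
  | zero =>
    rw [Subsingleton.elim v u]
    rfl
  | succ q ih =>
    rw [evalFirst_succ, ih (Fin.tail u) _ (by omega), ← castAlt_curryLeft (n := 0 + q) _ h,
      AlternatingMap.curryLeft_apply_apply]
    congr 1
    exact Fin.cons_self_tail u

lemma curryLeft_eq_sum {n : ℕ} (γ : Alt d (n + 1) M) (w : Fin d → ℂ) :
    γ.curryLeft w = ∑ j, w j • γ.curryLeft (bvec j) := by
  have hv : w = ∑ j, w j • bvec j := by
    ext k; simp [bvec, Pi.single_apply, Finset.sum_apply]
  conv_lhs => rw [hv]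
  rw [map_sum]
  simp only [map_smul]

end

/-- The form `v ↦ f_0 γ(df_1, …, df_q, v)`. -/
def hkrForm (d p q : ℕ) : Alt d (p + q) (Poly d) →ₗ[ℂ] Alt d p (PolyDiff d (q + 1)) :=
  ∑ i : Fin q → Fin d, compAlt p (mulFirst d q ∘ₗ monoP i) ∘ₗ
    evalFirst p q fun b => bvec (i b)

lemma hkrForm_apply (γ : Alt d (p + q) (Poly d)) (v : Fin p → Fin d → ℂ) :
    hkrForm d p q γ v = ∑ i : Fin q → Fin d,
      mulFirst d q (monoP i (evalFirst p q (fun b => bvec (i b)) γ v)) := by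
  simp [hkrForm, Alt.sum_apply]

lemma barP_hkrForm (γ : Alt d (p + q) (Poly d)) :
    compAlt p (barP d (q + 1)) (hkrForm d p q γ) = 0 := by
  ext1 v
  rw [compAlt_apply, hkrForm_apply, map_sum]
  exact Finset.sum_eq_zero fun i _ => barP_mulFirst_monoP _ _

lemma linComb_commX_monoP (i : Fin (n + 1) → Fin d) (a : Poly d) (w : Fin d → ℂ) :
    linComb (commX (d := d) n) w (monoP i a) = w (i 0) • mulFirst d n (monoP (Fin.tail i) a) := by
  rw [linComb_apply]
  simp only [commX_monoP, Pi.single_apply, ite_smul, one_smul, zero_smul, smul_ite, smul_zero]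
  simp

/-- One step of the zigzag: removing f_0 exposes df_1 in the first slot, and its commutator with x_j
turns it into a free vector variable, so bidegree (p, q + 1) goes to (p + 1, q). Each of the p + 1
vectors contributes the same term, and (-1)^q moves it past the remaining differentials. -/
lemma wedge_insertOne_hkrForm (γ : Alt d (p + (q + 1)) (Poly d))
    (h : p + (q + 1) = p + 1 + q) :
    wedge p (commX (d := d) q) (compAlt p (insertOne d (q + 1)) (hkrForm d p (q + 1) γ)) =
      ((-1 : ℂ) ^ q * (p + 1)) • hkrForm d (p + 1) q (castAlt h γ) := by
  ext1 v
  rw [wedge_apply]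
  have key : ∀ k : Fin (p + 1), (-1 : ℂ) ^ (k : ℕ) • linComb (commX (d := d) q) (v k)
      (compAlt p (insertOne d (q + 1)) (hkrForm d p (q + 1) γ) (k.removeNth v)) =
      (-1 : ℂ) ^ q • hkrForm d (p + 1) q (castAlt h γ) v := by
    intro k
    rw [compAlt_apply, hkrForm_apply, hkrForm_apply, map_sum, map_sum]
    simp only [insertOne_mulFirst, linComb_commX_monoP]
    rw [sum_fin_cons, Finset.smul_sum, Finset.smul_sum]
    refine Finset.sum_congr rfl fun i _ => ?_
    have h1 : ∀ j, (fun b => bvec ((Fin.cons j i : Fin (q + 1) → Fin d) b)) =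
        (Fin.cons (bvec j) fun b => bvec (i b) : Fin (q + 1) → Fin d → ℂ) := by
      intro j
      funext b
      refine Fin.cases ?_ (fun b => ?_) b <;> simp
    simp only [Fin.cons_zero, Fin.tail_cons, h1]
    simp only [← map_smul, ← map_sum]
    congr 2
    have h2 : ∑ j, v k j • evalFirst p (q + 1) (Fin.cons (bvec j) fun b => bvec (i b)) γ
        (k.removeNth v) =
        evalFirst p (q + 1) (Fin.cons (v k) fun b => bvec (i b)) γ (k.removeNth v) := by
      simp only [evalFirst_succ, Fin.tail_cons, Fin.cons_zero]
      rw [curryLeft_eq_sum _ (v k), map_sum, Alt.sum_apply]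
      simp
    rw [h2, evalFirst_cons _ _ _ h]
    have h3 := AlternatingMap.map_insertNth
      (evalFirst (p + 1) q (fun b => bvec (i b)) (castAlt h γ)) k (v k) (k.removeNth v)
    rw [Fin.insertNth_self_removeNth] at h3
    rw [h3]
    rcases Nat.even_or_odd (k : ℕ) with h | h <;> simp [h.neg_one_pow]
  rw [Finset.sum_congr rfl fun k _ => key k]
  simp only [Finset.sum_const, Finset.card_univ, Fintype.card_fin, ← Nat.cast_smul_eq_nsmul ℂ,
    smul_smul, AlternatingMap.smul_apply]
  push_cast
  ring_nf

lemma compAlt_eq_neg_of_barP_eq_zero (τ : Alt d p (PolyDiff d (q + 1)))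
    (hτ : compAlt p (barP d (q + 1)) τ = 0) :
    compAlt p (barP d q) (compAlt p (insertOne d q) τ) = -τ := by
  ext1 v
  have h1 : barP d (q + 1) (τ v) = 0 := by
    rw [← compAlt_apply, hτ]; rfl
  have := insertOne_barP (τ v)
  rw [h1, map_zero] at this
  rw [compAlt_apply, compAlt_apply, AlternatingMap.neg_apply]
  rw [eq_comm, sub_eq_zero] at this
  exact this.symm

/-- The bottom of the zigzag: a b'-closed operator of one argument is f ↦ f a, so such a form is
just an alternating map with values in A. -/
lemma exists_hkrForm_zero (τ : Alt d p (PolyDiff d 1))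
    (hb : compAlt p (barP d 1) τ = 0) :
    ∃ γ : Alt d (p + 0) (Poly d), τ = hkrForm d p 0 γ := by
  let ev : PolyDiff d 0 →ₗ[ℂ] Poly d := ⟨⟨fun φ => φ.1 ![], fun _ _ => rfl⟩, fun _ _ => rfl⟩
  refine ⟨compAlt p (ev ∘ₗ insertOne d 0) τ, ?_⟩
  have h := compAlt_eq_neg_of_barP_eq_zero τ hb
  ext1 v
  rw [hkrForm_apply]
  have h1 : τ v = -barP d 0 (insertOne d 0 (τ v)) := by
    rw [← compAlt_apply, ← compAlt_apply, h, AlternatingMap.neg_apply, neg_neg]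
  rw [h1]
  refine Subtype.ext (funext fun f => ?_)
  have h2 : ((-barP d 0 (insertOne d 0 (τ v)) : PolyDiff d 1)).1 f =
      -barOp 0 (insertOne d 0 (τ v)).1 f := rfl
  rw [h2, barOp_zero_apply, neg_neg, Fintype.sum_unique, mulFirst_apply, monoP_apply]
  simp only [Finset.univ_eq_empty, Finset.prod_empty, mul_one]
  rw [mul_comm]
  rfl

/-- A b'-closed τ is -b' of `insertOne τ`, but that primitive need not be Koszul-closed. If its
Koszul differential is an HKR form plus the Koszul differential of b'ζ, subtracting ζ's term and a
suitable multiple of the HKR form corrects it. The factor (-1)^q (p + 1) is inverted when choosing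
γ. -/
lemma exists_hkrForm_step (τ : Alt d p (PolyDiff d (q + 2)))
    (hb : compAlt p (barP d (q + 2)) τ = 0)
    (hs : ∃ (γ : Alt d (p + 1 + q) (Poly d)) (ζ : Alt d p (PolyDiff d q)),
      wedge p (commX (d := d) q) (compAlt p (insertOne d (q + 1)) τ) =
        hkrForm d (p + 1) q γ + wedge p (commX (d := d) q) (compAlt p (barP d q) ζ)) :
    ∃ (γ : Alt d (p + (q + 1)) (Poly d)) (η : Alt d p (PolyDiff d (q + 1))),
      wedge p (commX (d := d) q) η = 0 ∧
        τ = hkrForm d p (q + 1) γ + compAlt p (barP d (q + 1)) η := by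
  obtain ⟨γ', ζ, hγ⟩ := hs
  have hN : p + (q + 1) = p + 1 + q := by omega
  have hc : ((-1 : ℂ) ^ q * (p + 1)) ≠ 0 :=
    mul_ne_zero (pow_ne_zero _ (by norm_num)) (by exact_mod_cast Nat.succ_ne_zero p)
  let γ : Alt d (p + (q + 1)) (Poly d) := ((-1 : ℂ) ^ q * (p + 1))⁻¹ • (castAlt hN).symm γ'
  have hγ' : wedge p (commX (d := d) q)
      (compAlt p (insertOne d (q + 1)) (hkrForm d p (q + 1) γ)) = hkrForm d (p + 1) q γ' := by
    have h : castAlt hN γ = ((-1 : ℂ) ^ q * (p + 1))⁻¹ • γ' := by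
      simp only [γ, map_smul, LinearEquiv.apply_symm_apply]
    rw [wedge_insertOne_hkrForm γ hN, h, map_smul, smul_smul, mul_inv_cancel₀ hc, one_smul]
  refine ⟨γ, -(compAlt p (insertOne d (q + 1)) τ -
    compAlt p (insertOne d (q + 1)) (hkrForm d p (q + 1) γ) - compAlt p (barP d q) ζ), ?_, ?_⟩
  · rw [wedge_neg, wedge_sub, wedge_sub, hγ, hγ']
    exact Alt.neg_add_sub_sub _ _
  · rw [compAlt_neg, compAlt_sub, compAlt_sub, compAlt_eq_neg_of_barP_eq_zero τ hb,
      compAlt_eq_neg_of_barP_eq_zero _ (barP_hkrForm γ)]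
    have : compAlt p (barP d (q + 1)) (compAlt p (barP d q) ζ) = 0 := by
      ext1 v
      exact barP_barP _
    rw [this]
    abel

/-- The zigzag in the double complex, by induction on q with p free: the Koszul differential of
`insertOne τ` is again closed for both differentials, with one argument fewer and form degree one
higher. The induction hypothesis leaves a Koszul-closed η, whose primitive ζ comes from the Poincaré
lemma in form degree p + 1 > 0. -/
theorem exists_hkrForm (q : ℕ) : ∀ (p : ℕ) (τ : Alt d p (PolyDiff d (q + 2))),
    compAlt p (barP d (q + 2)) τ = 0 → wedge p (commX (d := d) (q + 1)) τ = 0 →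
    ∃ (γ : Alt d (p + (q + 1)) (Poly d)) (η : Alt d p (PolyDiff d (q + 1))),
      wedge p (commX (d := d) q) η = 0 ∧
        τ = hkrForm d p (q + 1) γ + compAlt p (barP d (q + 1)) η := by
  have hclosed : ∀ (q p : ℕ) (τ : Alt d p (PolyDiff d (q + 2))),
      compAlt p (barP d (q + 2)) τ = 0 → wedge p (commX (d := d) (q + 1)) τ = 0 →
      compAlt (p + 1) (barP d (q + 1))
        (wedge p (commX (d := d) q) (compAlt p (insertOne d (q + 1)) τ)) = 0 := by
    intro q p τ hb hw
    rw [compAlt_wedge _ (commX (d := d) (q + 1)) _ fun j x => (commX_barP j x).symm,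
      compAlt_eq_neg_of_barP_eq_zero τ hb, wedge_neg, hw, Alt.neg_zero]
  induction q with
  | zero =>
    intro p τ hb hw
    obtain ⟨γ, hγ⟩ := exists_hkrForm_zero _ (hclosed 0 p τ hb hw)
    exact exists_hkrForm_step τ hb ⟨γ, 0, by simpa using hγ⟩
  | succ q ih =>
    intro p τ hb hw
    obtain ⟨γ, η, hη, h⟩ := ih (p + 1) _ (hclosed (q + 1) p τ hb hw) (wedge_wedge _ commX_comm _)
    obtain ⟨ζ, rfl⟩ := exists_wedge_eq commX_precD commX_comm exists_mem_nilFil_commX η hη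
    refine exists_hkrForm_step τ hb ⟨γ, ζ, ?_⟩
    rw [h, compAlt_wedge _ (commX (d := d) (q + 1)) _ fun j x => (commX_barP j x).symm]

lemma hkrForm_zero_injective (γ : Alt d (p + 0) (Poly d)) (h : hkrForm d p 0 γ = 0) : γ = 0 := by
  ext1 v
  have h1 := hkrForm_apply γ v
  rw [h, Fintype.sum_unique] at h1
  have h2 := congrArg (fun φ : PolyDiff d 1 => φ.1 1) h1
  simp only [mulFirst_apply, monoP_apply] at h2
  simp only [Finset.univ_eq_empty, Finset.prod_empty, mul_one, Pi.one_apply, one_mul] at h2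
  exact h2.symm

/-- The same zigzag for uniqueness: applying `insertOne` and then the Koszul differential carries a
relation `hkrForm γ = b'η` one step down. At the bottom the right side disappears, since b' of a
zero-argument operator is A-linear and so killed by `commX`. -/
theorem hkrForm_injective (q : ℕ) : ∀ (p : ℕ) (γ : Alt d (p + (q + 1)) (Poly d))
    (η : Alt d p (PolyDiff d (q + 1))), wedge p (commX (d := d) q) η = 0 →
    hkrForm d p (q + 1) γ = compAlt p (barP d (q + 1)) η → γ = 0 := by
  have hstep : ∀ (q p : ℕ) (γ : Alt d (p + (q + 1)) (Poly d)) (η : Alt d p (PolyDiff d (q + 1))),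
      wedge p (commX (d := d) q) η = 0 →
      hkrForm d p (q + 1) γ = compAlt p (barP d (q + 1)) η → ∀ hN : p + (q + 1) = p + 1 + q,
      hkrForm d (p + 1) q (castAlt hN γ) = -((-1 : ℂ) ^ q * (p + 1))⁻¹ •
        wedge p (commX (d := d) q) (compAlt p (barP d q) (compAlt p (insertOne d q) η)) := by
    intro q p γ η hη h hN
    have hc : ((-1 : ℂ) ^ q * (p + 1)) ≠ 0 :=
      mul_ne_zero (pow_ne_zero _ (by norm_num)) (by exact_mod_cast Nat.succ_ne_zero p)
    have h1 := wedge_insertOne_hkrForm γ hN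
    have h2 : compAlt p (insertOne d (q + 1)) (compAlt p (barP d (q + 1)) η) =
        -η - compAlt p (barP d q) (compAlt p (insertOne d q) η) := by
      ext1 v
      exact insertOne_barP (η v)
    rw [h, h2, wedge_sub, wedge_neg, hη, Alt.neg_zero_sub] at h1
    exact Alt.eq_neg_inv_smul hc h1
  induction q with
  | zero =>
    intro p γ η hη h
    have h1 := hstep 0 p γ η hη h (by omega)
    have h2 : ∀ ζ : Alt d p (PolyDiff d 0),
        wedge p (commX (d := d) 0) (compAlt p (barP d 0) ζ) = 0 := by
      intro ζ
      ext1 v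
      rw [wedge_apply]
      refine Finset.sum_eq_zero fun k _ => ?_
      rw [linComb_apply, compAlt_apply]
      simp only [commX_barP_zero, smul_zero, Finset.sum_const_zero]
    rw [h2, smul_zero] at h1
    exact (castAlt _).map_eq_zero_iff.1 (hkrForm_zero_injective _ h1)
  | succ q ih =>
    intro p γ η hη h
    have hN : p + (q + 1 + 1) = p + 1 + (q + 1) := by omega
    have h1 := hstep (q + 1) p γ η hη h hN
    rw [← compAlt_wedge _ (commX (d := d) (q + 1)) _ fun j x => (commX_barP j x).symm,
      ← map_smul] at h1
    refine (castAlt hN).map_eq_zero_iff.1 (ih (p + 1) _ _ ?_ h1)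
    rw [map_smul, wedge_wedge _ commX_comm, smul_zero]

/-- The polydifferential operator `(f_1, …, f_n) ↦ γ(df_1, …, df_n)`. -/
def hkP (d n : ℕ) : Alt d n (Poly d) →ₗ[ℂ] PolyDiff d n :=
  ∑ i : Fin n → Fin d, monoP i ∘ₗ
    (⟨⟨fun γ => γ fun b => bvec (i b), fun _ _ => rfl⟩, fun _ _ => rfl⟩ :
      Alt d n (Poly d) →ₗ[ℂ] Poly d)

lemma hkP_eq (γ : Alt d n (Poly d)) :
    hkP d n γ = ∑ i : Fin n → Fin d, monoP i (γ fun b => bvec (i b)) := by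
  simp [hkP]

lemma hkrForm_zero_apply (γ : Alt d (0 + n) (Poly d)) (h : 0 + n = n) (v : Fin 0 → Fin d → ℂ) :
    hkrForm d 0 n γ v = mulFirst d n (hkP d n (castAlt h γ)) := by
  rw [hkrForm_apply, hkP_eq, map_sum]
  simp only [evalFirst_zero_apply _ _ h]

lemma mulFirst_injective : Function.Injective (mulFirst d n) := fun φ ψ h => by
  rw [← insertOne_mulFirst φ, h, insertOne_mulFirst]

lemma hochP_hkP (γ : Alt d n (Poly d)) : hochP d n (hkP d n γ) = 0 := by
  apply mulFirst_injective
  rw [← neg_inj, ← barP_mulFirst, hkP_eq, map_sum, map_sum, map_zero, neg_zero]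
  exact Finset.sum_eq_zero fun i _ => barP_mulFirst_monoP _ _

lemma wedge_zero_eq_zero_iff (η : Alt d 0 (PolyDiff d (n + 1))) :
    wedge 0 (commX (d := d) n) η = 0 ↔ ∀ j, commX n j (η ![]) = 0 := by
  have h : ∀ v, wedge 0 (commX (d := d) n) η v = linComb (commX (d := d) n) (v 0) (η ![]) := by
    intro v
    rw [wedge_apply, Fin.sum_univ_succ]
    simp only [Fin.val_zero, pow_zero, one_smul, Finset.univ_eq_empty, Finset.sum_empty, add_zero]
    rw [Subsingleton.elim (Fin.removeNth 0 v) ![]]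
  constructor
  · intro h0 j
    have := h ![bvec j]
    rw [h0] at this
    simpa [linComb_bvec] using this.symm
  · intro h0
    ext1 v
    rw [h, linComb_apply]
    simp [h0]

/-- Hochschild cocycles are cohomologous to polyvector fields. -/
theorem exists_hkP_add (x : PolyDiff d (n + 1)) (hx : hochP d (n + 1) x = 0) :
    ∃ (γ : Alt d (n + 1) (Poly d)) (y : PolyDiff d n), x = hkP d (n + 1) γ + hochP d n y := by
  have hN : 0 + (n + 1) = n + 1 := by omega
  obtain ⟨γ, η, hη, h⟩ := exists_hkrForm n 0
    (constAlt (mulFirst d (n + 1) x))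
    (by
      ext1 v
      rw [compAlt_apply, constAlt_apply, barP_mulFirst, hx, map_zero, neg_zero]
      rfl)
    (by
      rw [wedge_zero_eq_zero_iff]
      intro j
      exact commX_mulFirst j x)
  -- η is A-linear in its first slot, so it descends to an honest cochain; the minus sign below
  -- comes from `barP_mulFirst`.
  have h1 := eq_mulFirst_insertOne (η ![]) ((wedge_zero_eq_zero_iff η).1 hη)
  refine ⟨castAlt hN γ, -insertOne d n (η ![]), mulFirst_injective ?_⟩
  have h2 := congrArg (fun τ : Alt d 0 (PolyDiff d (n + 2)) => τ ![]) h
  simp only [constAlt_apply, AlternatingMap.add_apply, compAlt_apply] at h2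
  rw [h2, hkrForm_zero_apply _ hN, map_add, map_neg, map_neg, ← barP_mulFirst, ← h1]

theorem hkP_eq_hochP (γ : Alt d (n + 1) (Poly d)) (y : PolyDiff d n)
    (h : hkP d (n + 1) γ = hochP d n y) : γ = 0 := by
  have hN : 0 + (n + 1) = n + 1 := by omega
  have h1 := hkrForm_injective n 0 ((castAlt hN).symm γ)
    (constAlt (-mulFirst d n y))
    (by
      rw [wedge_zero_eq_zero_iff]
      intro j
      rw [constAlt_apply, map_neg, commX_mulFirst, neg_zero])
    (by
      ext1 v
      rw [hkrForm_zero_apply _ hN, compAlt_apply, constAlt_apply, map_neg,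
        barP_mulFirst, neg_neg, LinearEquiv.apply_symm_apply, h])
  exact (castAlt hN).symm.map_eq_zero_iff.1 h1

lemma hkP_zero_apply (γ : Alt d 0 (Poly d)) (f : Fin 0 → Poly d) :
    (hkP d 0 γ).1 f = γ ![] := by
  rw [hkP_eq, Fintype.sum_unique, monoP_apply]
  simp only [Finset.univ_eq_empty, Finset.prod_empty, mul_one]
  congr 1
  exact Subsingleton.elim _ _

lemma hkP_zero_bijective : Function.Bijective (hkP d 0) := by
  constructor
  · intro γ γ' h
    ext1 v
    have := congrArg (fun φ : PolyDiff d 0 => φ.1 ![]) h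
    simp only [hkP_zero_apply] at this
    rwa [Subsingleton.elim v ![]]
  · intro φ
    refine ⟨constAlt (φ.1 ![]), ?_⟩
    refine Subtype.ext (funext fun f => ?_)
    rw [hkP_zero_apply, Subsingleton.elim f ![]]
    rfl

end HKR

end

end CyclicHKR

namespace CyclicHKR

noncomputable section

/-! ### Faithfulness of polydifferential operators -/

section Faithful

variable {d n : ℕ}

lemma iterate_pderiv_monomial (j : Fin d) (k : ℕ) (s : Fin d →₀ ℕ) (c : ℂ) :
    (fun f : Poly d => polyPartial j f)^[k] (MvPolynomial.monomial s c) =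
      MvPolynomial.monomial (s - Finsupp.single j k) (c * (s j).descFactorial k) := by
  induction k with
  | zero => simp
  | succ k ih =>
    rw [Function.iterate_succ_apply', ih, polyPartial, MvPolynomial.pderiv_monomial,
      tsub_tsub, ← Finsupp.single_add, Nat.descFactorial_succ]
    congr 1
    simp only [Finsupp.coe_tsub, Pi.sub_apply, Finsupp.single_eq_same]
    push_cast
    ring

lemma multiDeriv_monomial (β : Fin d → ℕ) (s : Fin d →₀ ℕ) :
    ∃ t, multiDeriv polyPartial β (MvPolynomial.monomial s (1 : ℂ)) =
      MvPolynomial.monomial t (∏ j, ((s j).descFactorial (β j) : ℂ)) := by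
  have key : ∀ l : List (Fin d), l.Nodup → ∃ t : Fin d →₀ ℕ, (∀ j, j ∉ l → t j = s j) ∧
      l.foldr (fun j g => (polyPartial j)^[β j] g) (MvPolynomial.monomial s (1 : ℂ)) =
        MvPolynomial.monomial t (l.map fun j => ((s j).descFactorial (β j) : ℂ)).prod := by
    intro l hl
    induction l with
    | nil => exact ⟨s, fun _ _ => rfl, by simp⟩
    | cons i l ih =>
      rw [List.nodup_cons] at hl
      obtain ⟨t, ht, h⟩ := ih hl.2
      refine ⟨t - Finsupp.single i (β i), fun j hj => ?_, ?_⟩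
      · rw [List.mem_cons, not_or] at hj
        simp [ht j hj.2, Finsupp.single_eq_of_ne hj.1]
      · rw [List.foldr_cons, h, List.map_cons, List.prod_cons, mul_comm, ← ht i hl.1]
        exact iterate_pderiv_monomial i (β i) t _
  obtain ⟨t, -, h⟩ := key _ (List.nodup_finRange d)
  refine ⟨t, ?_⟩
  rw [← List.prod_ofFn, List.ofFn_eq_map]
  exact h

/-- A polydifferential operator on polynomials determines its coefficients. -/
theorem polyOp_injective : Function.Injective (polyOp d n) := by
  rw [injective_iff_map_eq_zero]
  intro P hP
  by_contra hne
  -- Test on the monomials x^{α_i} for a minimal α in the support. Any other β there is not ≤ α, so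
  -- some ∂^{β_i} kills x^{α_i}; the α term leaves its coefficient times factorials.
  obtain ⟨α, hα, hmin⟩ := P.support.exists_minimal (Finsupp.support_nonempty_iff.2 hne)
  choose t ht using fun (β : Fin n → Fin d → ℕ) i =>
    multiDeriv_monomial (β i) (Finsupp.equivFunOnFinite.symm (α i))
  have h := congrFun hP fun i =>
    MvPolynomial.monomial (Finsupp.equivFunOnFinite.symm (α i)) (1 : ℂ)
  simp only [polyOp, LinearMap.coe_mk, AddHom.coe_mk, Finsupp.sum, ht,
    Finsupp.equivFunOnFinite_symm_apply_apply, Pi.zero_apply] at h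
  rw [Finset.sum_eq_single α] at h
  · rw [mul_eq_zero, Finset.prod_eq_zero_iff] at h
    rcases h with h | ⟨i, -, h⟩
    · exact (Finsupp.mem_support_iff.1 hα) h
    · rw [MvPolynomial.monomial_eq_zero, Finset.prod_eq_zero_iff] at h
      obtain ⟨j, -, h⟩ := h
      rw [Nat.descFactorial_self, Nat.cast_eq_zero] at h
      exact Nat.factorial_ne_zero _ h
  · intro β hβ hβα
    have : ¬β ≤ α := fun hle => hβα (le_antisymm hle (hmin hβ hle))
    rw [Pi.le_def] at this
    push Not at this
    obtain ⟨i, hi⟩ := this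
    rw [Pi.le_def] at hi
    push Not at hi
    obtain ⟨j, hj⟩ := hi
    rw [Finset.prod_eq_zero (Finset.mem_univ i), mul_zero]
    rw [Finset.prod_eq_zero (Finset.mem_univ j), MvPolynomial.monomial_zero]
    exact_mod_cast Nat.descFactorial_eq_zero_iff_lt.2 hj
  · exact fun h => absurd hα h

lemma genOp_coeffHom {B : Type} [CommRing B] [Algebra ℂ B] [DiffAlg d B] (P : PolyDiffSymbol d n)
    (p : Fin n → Poly d) :
    genOp B P (fun i => coeffHom (p i)) = coeffHom (polyOp d n P p) := by
  induction P using symbol_induction generalizing p with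
  | base a =>
    rw [polyOp_eq_genOp, genOp_single_zero, genOp_single_zero, map_mul, map_prod]
    rfl
  | add P Q hP hQ => simp [hP, hQ]
  | shift i j P hP =>
    rw [polyOp_eq_genOp, genOp_shift, genOp_shift, ← polyOp_eq_genOp, ← hP]
    refine congrArg _ (funext fun k => ?_)
    by_cases hk : k = i
    · subst hk
      simp only [Function.update_self]
      exact DiffAlg.der_coeff j (p k)
    · simp [hk]

lemma exists_genOp_der (j : Fin d) (P : PolyDiffSymbol d n) :
    ∃ Q : PolyDiffSymbol d n, ∀ (B : Type) [CommRing B] [Algebra ℂ B] [DiffAlg d B]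
      (f : Fin n → B), genOp B Q f = der j (genOp B P f) := by
  induction P using symbol_induction with
  | base a =>
    refine ⟨Finsupp.single 0 (MvPolynomial.pderiv j a) +
      ∑ i, shift i j (Finsupp.single 0 a), fun B _ _ _ f => ?_⟩
    rw [map_add, Pi.add_apply, map_sum, Finset.sum_apply, genOp_single_zero, genOp_single_zero,
      Derivation.leibniz, der_prod, DiffAlg.der_coeff]
    simp only [genOp_shift, genOp_single_zero, smul_eq_mul, Finset.mul_sum]
    ring
  | add P Q hP hQ =>
    obtain ⟨P', hP'⟩ := hP
    obtain ⟨Q', hQ'⟩ := hQ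
    exact ⟨P' + Q', fun B _ _ _ f => by simp [hP', hQ']⟩
  | shift i k P hP =>
    obtain ⟨Q, hQ⟩ := hP
    exact ⟨shift i k Q, fun B _ _ _ f => by rw [genOp_shift, genOp_shift, hQ]⟩

end Faithful

/-! ### Smooth functions and test functions -/

section Smooth

variable {d n : ℕ}

/-- The algebra of smooth functions on `ℝ^d`. -/
def smoothAlg (d : ℕ) : Subalgebra ℂ ((Fin d → ℝ) → ℂ) where
  carrier := {f | ContDiff ℝ ∞ f}
  mul_mem' hf hg := ContDiff.mul (𝕜 := ℝ) (n := ∞) hf hg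
  add_mem' hf hg := ContDiff.add (𝕜 := ℝ) (n := ∞) hf hg
  algebraMap_mem' c := (contDiff_const : ContDiff ℝ ∞ fun _ : Fin d → ℝ => c)

lemma smoothAlg.contDiff (f : smoothAlg d) : ContDiff ℝ ∞ f.1 := f.2

lemma smoothAlg.differentiable (f : smoothAlg d) : Differentiable ℝ f.1 :=
  (smoothAlg.contDiff f).differentiable (by simp)

lemma funPartial_comm (i j : Fin d) {f : (Fin d → ℝ) → ℂ} (hf : ContDiff ℝ ∞ f) :
    funPartial i (funPartial j f) = funPartial j (funPartial i f) := by
  funext x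
  have hd : DifferentiableAt ℝ (fderiv ℝ f) x :=
    ((hf.fderiv_right (m := ∞) (by simp)).differentiable (by simp)).differentiableAt
  have h : ∀ v w : Fin d → ℝ, fderiv ℝ (fun y => fderiv ℝ f y v) x w =
      fderiv ℝ (fderiv ℝ f) x w v := by
    intro v w
    rw [fderiv_clm_apply hd (differentiableAt_const _)]
    simp
  unfold funPartial
  rw [h, h]
  exact (hf.contDiffAt.isSymmSndFDerivAt (by simpa using (WithTop.coe_le_coe.2 (le_top : (2 : ℕ∞) ≤ ⊤) : (2 : WithTop ℕ∞) ≤ ∞))).eq _ _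

lemma funPartial_evalReal (j : Fin d) (p : Poly d) :
    funPartial j (evalReal p) = evalReal (MvPolynomial.pderiv j p) := by
  have hdiff : ∀ p : Poly d, Differentiable ℝ (evalReal p) := fun p =>
    (contDiff_evalReal p).differentiable (by simp)
  induction p using MvPolynomial.induction_on with
  | C a =>
    funext x
    have h1 : evalReal (MvPolynomial.C a : Poly d) = fun _ => a := by
      funext y; simp [evalReal]
    simp only [funPartial, h1, fderiv_fun_const]
    simp [evalReal]
  | add p q hp hq =>
    funext x
    have h1 : evalReal (p + q) = evalReal p + evalReal q := by
      funext y; simp [evalReal]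
    have h2 := congrFun hp x
    have h3 := congrFun hq x
    simp only [funPartial] at h2 h3 ⊢
    rw [h1, fderiv_add (hdiff p x) (hdiff q x)]
    simp only [add_apply, h2, h3]
    simp [evalReal]
  | mul_X p i hp =>
    funext x
    have h1 : evalReal (p * MvPolynomial.X i) =
        evalReal p * fun y => Complex.ofRealCLM (y i) := by
      funext y; simp [evalReal]
    have h2 := congrFun hp x
    simp only [funPartial] at h2 ⊢
    have h4 : HasFDerivAt (fun y : Fin d → ℝ => Complex.ofRealCLM (y i))
        (Complex.ofRealCLM.comp (ContinuousLinearMap.proj i)) x :=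
      (Complex.ofRealCLM.comp (ContinuousLinearMap.proj (R := ℝ) (φ := fun _ : Fin d => ℝ)
        i)).hasFDerivAt
    rw [h1, ((hdiff p x).hasFDerivAt.mul h4).fderiv]
    simp only [add_apply, smul_apply, h2, smul_eq_mul,
      ContinuousLinearMap.comp_apply, ContinuousLinearMap.proj_apply, Complex.ofRealCLM_apply]
    simp only [evalReal, Derivation.leibniz, MvPolynomial.pderiv_X, smul_eq_mul, map_add, map_mul,
      MvPolynomial.eval_X, Pi.single_apply]
    by_cases hij : i = j
    · subst hij; simp
    · simp [hij]

instance instDiffAlgSmooth (d : ℕ) : DiffAlg d (smoothAlg d) where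
  der j := Derivation.mk'
    ⟨⟨fun f => ⟨funPartial j f.1, contDiff_funPartial j f.2⟩, fun f g => by
      refine Subtype.ext (funext fun x => ?_)
      have hf := smoothAlg.differentiable f
      have hg := smoothAlg.differentiable g
      simp [funPartial, fderiv_add (hf x) (hg x)]⟩, fun c f => by
      refine Subtype.ext (funext fun x => ?_)
      have hf := smoothAlg.differentiable f
      simp [funPartial, fderiv_const_smul (hf x) c]⟩ fun f g => by
      refine Subtype.ext (funext fun x => ?_)
      have hf := smoothAlg.differentiable f
      have hg := smoothAlg.differentiable g
      simp [funPartial, fderiv_mul (hf x) (hg x)]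
  der_comm i j f := Subtype.ext (funPartial_comm i j f.2)
  coeff :=
    { toFun := fun p => ⟨evalReal p, contDiff_evalReal p⟩
      map_one' := by refine Subtype.ext (funext fun x => ?_); simp [evalReal]
      map_mul' := fun p q => by refine Subtype.ext (funext fun x => ?_); simp [evalReal]
      map_zero' := by refine Subtype.ext (funext fun x => ?_); simp [evalReal]
      map_add' := fun p q => by refine Subtype.ext (funext fun x => ?_); simp [evalReal]
      commutes' := fun c => by
        refine Subtype.ext (funext fun x => ?_)
        simp [evalReal, MvPolynomial.algebraMap_eq] }
  der_coeff j p := Subtype.ext (funPartial_evalReal j p)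

lemma coe_der (j : Fin d) (f : smoothAlg d) : (der j f).1 = funPartial j f.1 := rfl

lemma coe_coeffHom (p : Poly d) : (coeffHom p : smoothAlg d).1 = evalReal p := rfl

lemma coe_multiDeriv (α : Fin d → ℕ) (f : smoothAlg d) :
    (multiDeriv (fun j => der j) α f).1 = multiDeriv funPartial α f.1 := by
  have hit : ∀ (j : Fin d) k (g : smoothAlg d), ((der j : smoothAlg d → smoothAlg d)^[k] g).1 =
      (funPartial j)^[k] g.1 := by
    intro j k g
    induction k with
    | zero => rfl
    | succ k ih => rw [Function.iterate_succ_apply', Function.iterate_succ_apply', coe_der, ih]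
  unfold multiDeriv
  induction List.finRange d with
  | nil => rfl
  | cons j l ih => rw [List.foldr_cons, List.foldr_cons, hit, ih]

lemma smoothOp_eq_genOp (P : PolyDiffSymbol d n) (f : Fin n → smoothAlg d) (x : Fin d → ℝ) :
    smoothOp P (fun i => (f i).1) x = (genOp (smoothAlg d) P f).1 x := by
  simp only [smoothOp, genOp, LinearMap.coe_mk, AddHom.coe_mk, Finsupp.sum]
  rw [AddSubmonoidClass.coe_finsetSum, Finset.sum_apply]
  refine Finset.sum_congr rfl fun α _ => ?_
  simp only [MulMemClass.coe_mul, Pi.mul_apply, SubmonoidClass.coe_finsetProd, Finset.prod_apply,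
    coe_multiDeriv, coe_coeffHom]

/-- Test functions on `ℝ^d`. -/
@[ext] structure TestFn (d : ℕ) : Type where
  /-- The underlying smooth function. -/
  val : smoothAlg d
  hasCompactSupport : HasCompactSupport val.1

instance (d : ℕ) : CommSemigroup (TestFn d) where
  mul f g := ⟨f.1 * g.1, f.2.mul_right⟩
  mul_assoc f g h := TestFn.ext (mul_assoc f.1 g.1 h.1)
  mul_comm f g := TestFn.ext (mul_comm f.1 g.1)

lemma TestFn.coe_mul (f g : TestFn d) : (f * g).1 = f.1 * g.1 := rfl

lemma hasCompactSupport_der (j : Fin d) {f : smoothAlg d} (hf : HasCompactSupport f.1) :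
    HasCompactSupport (der j f).1 :=
  hf.fderiv_apply (𝕜 := ℝ) (Pi.single j 1)

/-- Partial derivatives of test functions. -/
def TestFn.der (j : Fin d) (f : TestFn d) : TestFn d :=
  ⟨CyclicHKR.der j f.1, hasCompactSupport_der j f.2⟩

lemma TestFn.coe_update_der (f : Fin n → TestFn d) (i : Fin n) (j : Fin d) :
    (fun k => (Function.update f i ((f i).der j) k).1) =
      Function.update (fun k => (f k).1) i (CyclicHKR.der j (f i).1) := by
  funext k
  by_cases hk : k = i
  · subst hk
    rw [Function.update_self, Function.update_self]
    rfl
  · rw [Function.update_of_ne hk, Function.update_of_ne hk]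

/-- The integral of a function on `ℝ^d`. -/
def totalInt (f : smoothAlg d) : ℂ := ∫ x, f.1 x

lemma integrable_of_compact {f : smoothAlg d} (hf : HasCompactSupport f.1) : Integrable f.1 :=
  (smoothAlg.contDiff f).continuous.integrable_of_hasCompactSupport hf

lemma totalInt_add {f g : smoothAlg d} (hf : HasCompactSupport f.1) (hg : HasCompactSupport g.1) :
    totalInt (f + g) = totalInt f + totalInt g :=
  integral_add (integrable_of_compact hf) (integrable_of_compact hg)

lemma totalInt_smul (c : ℂ) (f : smoothAlg d) : totalInt (c • f) = c * totalInt f :=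
  integral_const_mul c f.1

lemma hasCompactSupport_mul_right {f g : smoothAlg d} (hg : HasCompactSupport g.1) :
    HasCompactSupport (f * g).1 := hg.mul_left (f := f.1)

lemma totalInt_mul_der (j : Fin d) (f : smoothAlg d) {g : smoothAlg d}
    (hg : HasCompactSupport g.1) :
    totalInt (f * der j g) = -totalInt (der j f * g) := by
  have hf' := smoothAlg.differentiable f
  have hg' := smoothAlg.differentiable g
  exact integral_mul_fderiv_eq_neg_fderiv_mul_of_integrable
    (integrable_of_compact (hasCompactSupport_mul_right (f := der j f) hg))
    (integrable_of_compact (hasCompactSupport_mul_right (f := f) (hasCompactSupport_der j hg)))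
    (integrable_of_compact (hasCompactSupport_mul_right (f := f) hg))
    (fun x _ => hf' x) (fun x _ => hg' x)

/-- The functional `(f_1, …, f_{n+1}) ↦ ∫ ψ(f_1, …, f_n) f_{n+1}`. -/
def pairing (d n : ℕ) : PolyDiffSymbol d n →ₗ[ℂ] Functional (TestFn d) n where
  toFun P f := totalInt (genOp (smoothAlg d) P (fun i => (f i.castSucc).1) * (f (Fin.last n)).1)
  map_add' P Q := by
    funext f
    rw [map_add, Pi.add_apply, add_mul, totalInt_add (hasCompactSupport_mul_right (f _).2)
      (hasCompactSupport_mul_right (f _).2)]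
    rfl
  map_smul' c P := by
    funext f
    rw [map_smul, Pi.smul_apply, smul_mul_assoc, totalInt_smul]
    rfl

lemma pairing_apply (P : PolyDiffSymbol d n) (f : Fin (n + 1) → TestFn d) :
    pairing d n P f =
      totalInt (genOp (smoothAlg d) P (fun i => (f i.castSucc).1) * (f (Fin.last n)).1) := rfl

lemma hasCompactSupport_genOp (P : PolyDiffSymbol d (n + 1)) (f : Fin (n + 1) → TestFn d) :
    HasCompactSupport (genOp (smoothAlg d) P fun i => (f i).1).1 := by
  induction P using symbol_induction generalizing f with
  | base a =>
    rw [genOp_single_zero, Fin.prod_univ_castSucc, ← mul_assoc]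
    exact hasCompactSupport_mul_right (f _).2
  | add P Q hP hQ =>
    rw [map_add]
    exact (hP f).add (hQ f)
  | shift i j P hP =>
    rw [genOp_shift]
    rw [← TestFn.coe_update_der]
    exact hP (Function.update f i ((f i).der j))

/-- Integration by parts moves every derivative off the last argument; the product rule keeps the
result polydifferential. -/
lemma totalInt_genOp_eq_pairing (Q : PolyDiffSymbol d (n + 1)) :
    ∃ P : PolyDiffSymbol d n, ∀ f : Fin (n + 1) → TestFn d,
      totalInt (genOp (smoothAlg d) Q fun i => (f i).1) = pairing d n P f := by
  induction Q using symbol_induction with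
  | base a =>
    refine ⟨Finsupp.single 0 a, fun f => ?_⟩
    rw [pairing_apply, genOp_single_zero, genOp_single_zero, Fin.prod_univ_castSucc, mul_assoc]
  | add P Q hP hQ =>
    obtain ⟨P', hP'⟩ := hP
    obtain ⟨Q', hQ'⟩ := hQ
    refine ⟨P' + Q', fun f => ?_⟩
    rw [map_add, Pi.add_apply, totalInt_add (hasCompactSupport_genOp P f)
      (hasCompactSupport_genOp Q f), hP', hQ', map_add, Pi.add_apply]
  | shift i j Q hQ =>
    obtain ⟨P, hP⟩ := hQ
    have h1 : ∀ f : Fin (n + 1) → TestFn d,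
        totalInt (genOp (smoothAlg d) (shift i j Q) fun i => (f i).1) =
          pairing d n P (Function.update f i ((f i).der j)) := by
      intro f
      rw [genOp_shift, ← hP, TestFn.coe_update_der]
    revert h1
    refine Fin.lastCases ?_ (fun i => ?_) i
    · intro h1
      obtain ⟨P', hP'⟩ := exists_genOp_der j P
      refine ⟨-P', fun f => ?_⟩
      rw [h1, map_neg, Pi.neg_apply, pairing_apply, pairing_apply, hP', Function.update_self,
        ← totalInt_mul_der _ _ (f _).2]
      have h2 : (fun k : Fin n => (Function.update f (Fin.last n) ((f (Fin.last n)).der j)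
          k.castSucc).1) = fun k => (f k.castSucc).1 :=
        funext fun k => by rw [Function.update_of_ne (Fin.castSucc_ne_last k)]
      rw [h2]
      rfl
    · intro h1
      refine ⟨shift i j P, fun f => ?_⟩
      rw [h1, pairing_apply, pairing_apply, genOp_shift,
        Function.update_of_ne (Fin.castSucc_ne_last i).symm]
      have h2 : (fun k : Fin n => (Function.update f i.castSucc ((f i.castSucc).der j)
          k.castSucc).1) = fun k => (Function.update (fun k : Fin n => f k.castSucc) i
            ((f i.castSucc).der j) k).1 := by
        funext k
        by_cases hk : k = i
        · subst hk
          rw [Function.update_self, Function.update_self]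
        · rw [Function.update_of_ne hk, Function.update_of_ne
            (fun h => hk (Fin.castSucc_injective _ h))]
      rw [h2, TestFn.coe_update_der (fun k : Fin n => f k.castSucc)]

lemma exists_pairing_eq_cyc (P : PolyDiffSymbol d n) :
    ∃ P' : PolyDiffSymbol d n, pairing d n P' = cyc n (pairing d n P) := by
  obtain ⟨Q, hQ⟩ := exists_genOp_mul_first P
  obtain ⟨P', hP'⟩ := totalInt_genOp_eq_pairing Q
  refine ⟨(-1 : ℂ) ^ n • P', funext fun f => ?_⟩
  rw [map_smul, Pi.smul_apply, ← hP', hQ]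
  simp only [cyc, LinearMap.coe_mk, AddHom.coe_mk, pairing_apply, smul_eq_mul,
    Fin.coeSucc_eq_succ, Fin.last_add_one]
  rw [mul_comm (f 0).1]
  rfl

/-- Locality: it allows polynomials to be replaced by compactly supported functions near a point. -/
lemma genOp_congr_germ (P : PolyDiffSymbol d n) (f g : Fin n → smoothAlg d) (x : Fin d → ℝ)
    (h : ∀ i, (f i).1 =ᶠ[nhds x] (g i).1) :
    (genOp (smoothAlg d) P f).1 x = (genOp (smoothAlg d) P g).1 x := by
  induction P using symbol_induction generalizing f g with
  | base a =>
    simp only [genOp_single_zero, MulMemClass.coe_mul, Pi.mul_apply,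
      SubmonoidClass.coe_finsetProd, Finset.prod_apply]
    congr 1
    exact Finset.prod_congr rfl fun i _ => (h i).self_of_nhds
  | add P Q hP hQ =>
    simp only [map_add, Pi.add_apply, AddMemClass.coe_add, hP f g h, hQ f g h]
  | shift i j P hP =>
    rw [genOp_shift, genOp_shift]
    refine hP _ _ fun k => ?_
    by_cases hk : k = i
    · subst hk
      simp only [Function.update_self, coe_der]
      filter_upwards [(h k).fderiv (𝕜 := ℝ)] with y hy
      simp [funPartial, hy]
    · simpa [hk] using h k

lemma evalReal_injective {p : Poly d} (h : ∀ x, evalReal p x = 0) : p = 0 := by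
  refine MvPolynomial.funext_set (fun _ => Set.range ((↑) : ℝ → ℂ))
    (fun _ => Set.infinite_range_of_injective Complex.ofReal_injective) fun x hx => ?_
  choose y hy using fun i => hx i (Set.mem_univ i)
  have := h y
  rw [evalReal, show (fun j => ((y j : ℝ) : ℂ)) = x from funext hy] at this
  simpa using this

/-- A polydifferential operator is determined by its pairing with test functions. -/
theorem pairing_injective : Function.Injective (pairing d n) := by
  rw [injective_iff_map_eq_zero]
  intro P hP
  -- The fundamental lemma of the calculus of variations in the last argument, plus continuity.
  have h1 : ∀ f : Fin n → TestFn d, (genOp (smoothAlg d) P fun i => (f i).1).1 = 0 := by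
    intro f
    set F := genOp (smoothAlg d) P fun i => (f i).1 with hF
    have hc : Continuous F.1 := (smoothAlg.contDiff F).continuous
    have hae : ∀ᵐ x, F.1 x = 0 := by
      refine ae_eq_zero_of_integral_contDiff_smul_eq_zero (hc.locallyIntegrable) fun g hg hgs => ?_
      have hg' : ContDiff ℝ ∞ fun x => (g x : ℂ) := Complex.ofRealCLM.contDiff.comp hg
      have hgs' : HasCompactSupport fun x => (g x : ℂ) :=
        hgs.comp_left (g := ((↑) : ℝ → ℂ)) Complex.ofReal_zero
      let G : TestFn d := ⟨⟨fun x => (g x : ℂ), hg'⟩, hgs'⟩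
      have := congrFun hP (Fin.snoc (α := fun _ => TestFn d) f G)
      rw [pairing_apply] at this
      simp only [Fin.snoc_castSucc, Fin.snoc_last] at this
      rw [← hF] at this
      calc ∫ x, g x • F.1 x = ∫ x, F.1 x * (g x : ℂ) := by
            refine integral_congr_ae (Filter.Eventually.of_forall fun x => ?_)
            simp [mul_comm]
        _ = 0 := this
    exact (Continuous.ae_eq_iff_eq (μ := volume) hc continuous_const).1 hae
  refine polyOp_injective ?_
  rw [map_zero]
  funext p
  refine evalReal_injective fun x => ?_
  -- Cutting polynomials off by a bump function equal to 1 near x transfers the vanishing from test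
  -- functions to polynomials.
  let χ : ContDiffBump x := ⟨1, 2, zero_lt_one, one_lt_two⟩
  have hχ : ContDiff ℝ ∞ fun y => (χ y : ℂ) := Complex.ofRealCLM.contDiff.comp χ.contDiff
  have hχs : HasCompactSupport fun y => (χ y : ℂ) :=
    χ.hasCompactSupport.comp_left (g := ((↑) : ℝ → ℂ)) Complex.ofReal_zero
  let X : smoothAlg d := ⟨fun y => (χ y : ℂ), hχ⟩
  have h2 := h1 fun i => ⟨coeffHom (p i) * X, hasCompactSupport_mul_right hχs⟩
  have h3 := genOp_congr_germ P (fun i => coeffHom (p i) * X) (fun i => coeffHom (p i)) x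
    (fun i => by
      filter_upwards [χ.eventuallyEq_one] with y hy
      have hX : X.1 y = 1 := by simp [X, hy]
      simp [hX])
  rw [genOp_coeffHom, coe_coeffHom] at h3
  rw [← h3, h2]
  rfl

end Smooth

end

end CyclicHKR

namespace CyclicHKR

noncomputable section

/-! ### The cyclic structure on polydifferential operators -/

section Cyclic

variable {d n : ℕ}

/-- The functional `(f_1, …, f_{n+1}) ↦ ∫ φ(f_1, …, f_n) f_{n+1}` on test functions. -/
def toFunctional (d n : ℕ) : PolyDiff d n →ₗ[ℂ] Functional (TestFn d) n :=
  pairing d n ∘ₗ (LinearEquiv.ofInjective (polyOp d n) polyOp_injective).symm.toLinearMap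

lemma toFunctional_injective : Function.Injective (toFunctional d n) :=
  pairing_injective.comp (LinearEquiv.injective _)

lemma toFunctional_eq {φ : PolyDiff d n} {P : PolyDiffSymbol d n} (h : polyOp d n P = φ.1) :
    toFunctional d n φ = pairing d n P := by
  have : φ = LinearEquiv.ofInjective (polyOp d n) polyOp_injective P := Subtype.ext h.symm
  rw [this]
  simp [toFunctional]

lemma exists_toFunctional_eq_cyc (φ : PolyDiff d n) :
    cyc n (toFunctional d n φ) ∈ LinearMap.range (toFunctional d n) := by
  obtain ⟨P, hP⟩ := φ.2
  obtain ⟨Q, hQ⟩ := exists_pairing_eq_cyc P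
  exact ⟨⟨_, Q, rfl⟩, by rw [toFunctional_eq hP, ← hQ]; exact toFunctional_eq rfl⟩

/-- The signed cyclic shift of polydifferential operators. -/
def cycP (d n : ℕ) : PolyDiff d n →ₗ[ℂ] PolyDiff d n :=
  (LinearEquiv.ofInjective (toFunctional d n) toFunctional_injective).symm.toLinearMap ∘ₗ
    (cyc n ∘ₗ toFunctional d n).codRestrict _ exists_toFunctional_eq_cyc

lemma toFunctional_cycP (φ : PolyDiff d n) :
    toFunctional d n (cycP d n φ) = cyc n (toFunctional d n φ) := by
  have h := LinearEquiv.apply_symm_apply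
    (LinearEquiv.ofInjective (toFunctional d n) toFunctional_injective)
    ((cyc n ∘ₗ toFunctional d n).codRestrict _ exists_toFunctional_eq_cyc φ)
  exact congrArg Subtype.val h

lemma neg_one_pow_smul {B : Type} [CommRing B] [Algebra ℂ B] (k : ℕ) (x : B) :
    (-1 : ℂ) ^ k • x = (-1) ^ k * x := by
  rcases Nat.even_or_odd k with h | h <;> simp [h.neg_one_pow]

/-- Integration against a test function. -/
def intMul (g : TestFn d) : smoothAlg d →ₗ[ℂ] ℂ where
  toFun F := totalInt (F * g.1)
  map_add' F G := by
    rw [add_mul, totalInt_add (hasCompactSupport_mul_right g.2) (hasCompactSupport_mul_right g.2)]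
  map_smul' c F := by
    rw [smul_mul_assoc, totalInt_smul]
    rfl

lemma intMul_apply (g : TestFn d) (F : smoothAlg d) : intMul g F = totalInt (F * g.1) := rfl

lemma intMul_neg_one_pow (g : TestFn d) (k : ℕ) (F : smoothAlg d) :
    intMul g ((-1) ^ k * F) = (-1) ^ k * intMul g F := by
  rw [← neg_one_pow_smul, map_smul, smul_eq_mul]

lemma pairing_eq_intMul (P : PolyDiffSymbol d n) (f : Fin (n + 1) → TestFn d) :
    pairing d n P f = intMul (f (Fin.last n)) (genOp (smoothAlg d) P fun i => (f i.castSucc).1) :=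
  rfl

lemma coe_contractNth (j : Fin (n + 1)) (f : Fin (n + 1) → TestFn d) (i : Fin n) :
    (Fin.contractNth j (· * ·) f i).1 = Fin.contractNth j (· * ·) (fun k => (f k).1) i := by
  unfold Fin.contractNth
  split_ifs <;> rfl

lemma contractNth_castSucc_comp {α : Type} (op : α → α → α) (j : Fin n) (a : Fin (n + 2) → α)
    (i : Fin n) :
    Fin.contractNth j.castSucc.castSucc op a i.castSucc =
      Fin.contractNth j.castSucc op (fun k => a k.castSucc) i := by
  unfold Fin.contractNth
  simp only [Fin.val_castSucc]
  split_ifs <;> simp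

lemma contractNth_last_castSucc {α : Type} (op : α → α → α) (a : Fin (n + 2) → α) (i : Fin n) :
    Fin.contractNth (Fin.last n).castSucc op a i.castSucc = a i.castSucc.castSucc :=
  Fin.contractNth_apply_of_lt _ _ _ _ (by simp)

lemma contractNth_last_last {α : Type} (op : α → α → α) (a : Fin (n + 2) → α) :
    Fin.contractNth (Fin.last n).castSucc op a (Fin.last n) =
      op (a (Fin.last n).castSucc) (a (Fin.last (n + 1))) := by
  rw [Fin.contractNth_apply_of_eq _ _ _ _ (by simp), Fin.succ_last]

lemma toFunctional_barP (φ : PolyDiff d n) :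
    toFunctional d (n + 1) (barP d n φ) = barF n (toFunctional d n φ) := by
  obtain ⟨P, hP⟩ := φ.2
  obtain ⟨Q, hQ⟩ := exists_genOp_bar P
  have hQ' : polyOp d (n + 1) Q = (barP d n φ).1 := by
    rw [barP_coe, ← hP]
    exact hQ (Poly d)
  rw [toFunctional_eq hP, toFunctional_eq hQ']
  funext f
  rw [pairing_eq_intMul, hQ, barOp_apply, map_add, map_sum, barF, LinearMap.sum_apply,
    Finset.sum_apply, Fin.sum_univ_castSucc]
  simp only [intMul_neg_one_pow, LinearMap.smul_apply, Pi.smul_apply, smul_eq_mul, face,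
    LinearMap.coe_mk, AddHom.coe_mk, pairing_eq_intMul, contractNth_castSucc_last,
    contractNth_last_last, coe_contractNth, contractNth_castSucc_comp, Fin.val_castSucc,
    contractNth_last_castSucc, Fin.val_last]
  refine congrArg₂ _ rfl (congrArg _ ?_)
  rw [intMul_apply, intMul_apply, TestFn.coe_mul, mul_assoc]

lemma toFunctional_mulFirst (φ : PolyDiff d n) :
    toFunctional d (n + 1) (mulFirst d n φ) = wrapFace (toFunctional d n φ) := by
  obtain ⟨P, hP⟩ := φ.2
  obtain ⟨Q, hQ⟩ := exists_genOp_mul_first P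
  have hQ' : polyOp d (n + 1) Q = (mulFirst d n φ).1 := by
    funext f
    rw [mulFirst_apply, ← hP]
    exact hQ (Poly d) f
  rw [toFunctional_eq hP, toFunctional_eq hQ']
  funext f
  simp only [wrapFace, LinearMap.coe_mk, AddHom.coe_mk, pairing_eq_intMul, hQ,
    contractNth_last_castSucc, contractNth_last_last, Fin.coeSucc_eq_succ, Fin.last_add_one,
    intMul_apply, TestFn.coe_mul, Fin.succ_last]
  rw [mul_comm (f (Fin.last (n + 1))).1, ← mul_assoc, mul_comm _ (f 0).1]
  rfl

lemma toFunctional_hochP (φ : PolyDiff d n) :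
    toFunctional d (n + 1) (hochP d n φ) = hochF n (toFunctional d n φ) := by
  rw [hochP, LinearMap.add_apply, map_add, toFunctional_barP, toFunctional_mulFirst, hochF,
    LinearMap.add_apply]
  exact add_comm _ _

lemma barP_sub_cycP (φ : PolyDiff d n) :
    barP d n (φ - cycP d n φ) = hochP d n φ - cycP d (n + 1) (hochP d n φ) := by
  apply toFunctional_injective
  rw [toFunctional_barP, map_sub, toFunctional_cycP, barF_sub_cyc, map_sub, toFunctional_cycP,
    toFunctional_hochP]

lemma toFunctional_cycP_pow (k : ℕ) (φ : PolyDiff d n) :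
    toFunctional d n ((cycP d n ^ k) φ) = (cyc n ^ k) (toFunctional d n φ) := by
  induction k generalizing φ with
  | zero => rfl
  | succ k ih => rw [pow_succ, pow_succ, Module.End.mul_apply, Module.End.mul_apply, ih,
      toFunctional_cycP]

lemma cycP_pow_card : cycP d n ^ (n + 1) = 1 := by
  refine LinearMap.ext fun φ => toFunctional_injective ?_
  rw [toFunctional_cycP_pow, cyc_pow_card]
  rfl

/-- The sum over the cyclic group. -/
def cycSumP (d n : ℕ) : PolyDiff d n →ₗ[ℂ] PolyDiff d n :=
  ∑ i ∈ Finset.range (n + 1), cycP d n ^ i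

lemma toFunctional_cycSumP (φ : PolyDiff d n) :
    toFunctional d n (cycSumP d n φ) = cycSum n (toFunctional d n φ) := by
  rw [cycSumP, cycSum, LinearMap.sum_apply, LinearMap.sum_apply, map_sum]
  exact Finset.sum_congr rfl fun i _ => toFunctional_cycP_pow i φ

lemma cycSumP_mulFirst (φ : PolyDiff d n) (h : cycP d n φ = φ) :
    cycSumP d (n + 1) (mulFirst d n φ) = hochP d n φ := by
  apply toFunctional_injective
  rw [toFunctional_cycSumP, toFunctional_mulFirst, toFunctional_hochP, cycSum_wrapFace]
  rw [← toFunctional_cycP, h]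

lemma cycP_zero (φ : PolyDiff d 0) : cycP d 0 φ = φ := by
  apply toFunctional_injective
  rw [toFunctional_cycP]
  funext f
  simp only [cyc, LinearMap.coe_mk, AddHom.coe_mk, pow_zero, one_mul]
  congr 1

/-! ### Polyvector fields and the cyclic shift -/

/-- Partial derivatives as linear maps. -/
def partialL (j : Fin d) : Poly d →ₗ[ℂ] Poly d := (MvPolynomial.pderiv j).toLinearMap

lemma partialL_apply (j : Fin d) (p : Poly d) : partialL j p = MvPolynomial.pderiv j p := rfl

/-- The symbol of `(f_1, …, f_n) ↦ γ(df_1, …, df_n)`. -/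
def hkSymbol (γ : Alt d n (Poly d)) : PolyDiffSymbol d n :=
  ∑ i : Fin n → Fin d, monoSymbol i (γ fun b => bvec (i b))

lemma polyOp_hkSymbol (γ : Alt d n (Poly d)) : polyOp d n (hkSymbol γ) = (hkP d n γ).1 := by
  rw [hkP_eq, hkSymbol, map_sum, AddSubmonoidClass.coe_finsetSum]
  rfl

section

variable {B : Type} [CommRing B] [Algebra ℂ B] [DiffAlg d B]

lemma genOp_hkSymbol (γ : Alt d n (Poly d)) (f : Fin n → B) :
    genOp B (hkSymbol γ) f =
      ∑ i : Fin n → Fin d, coeffHom (γ fun b => bvec (i b)) * ∏ b, der (i b) (f b) := by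
  simp only [hkSymbol, map_sum, Finset.sum_apply, genOp_monoSymbol]

lemma bvec_cons (j : Fin d) (i : Fin n → Fin d) :
    (fun b => bvec ((Fin.cons j i : Fin (n + 1) → Fin d) b)) =
      Matrix.vecCons (bvec j) fun b => bvec (i b) := by
  funext b
  refine Fin.cases ?_ (fun b => ?_) b <;> simp

lemma genOp_hkSymbol_cons (γ : Alt d (n + 1) (Poly d)) (x : B) (f : Fin n → B) :
    genOp B (hkSymbol γ) (Fin.cons x f) =
      ∑ j, der j x * genOp B (hkSymbol (γ.curryLeft (bvec j))) f := by
  rw [genOp_hkSymbol, sum_fin_cons, Finset.sum_comm]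
  refine Finset.sum_congr rfl fun j _ => ?_
  rw [genOp_hkSymbol, Finset.mul_sum]
  refine Finset.sum_congr rfl fun i _ => ?_
  rw [bvec_cons, Fin.prod_univ_succ]
  simp only [Fin.cons_zero, Fin.cons_succ, AlternatingMap.curryLeft_apply_apply]
  ring

lemma genOp_hkSymbol_snoc (γ : Alt d (n + 1) (Poly d)) (x : B) (f : Fin n → B) :
    genOp B (hkSymbol γ) (Fin.snoc f x : Fin (n + 1) → B) =
      (-1) ^ n * ∑ j, der j x * genOp B (hkSymbol (γ.curryLeft (bvec j))) f := by
  rw [genOp_hkSymbol, ← (Fin.snocEquiv fun _ : Fin (n + 1) => Fin d).sum_comp,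
    Fintype.sum_prod_type, Finset.mul_sum]
  refine Finset.sum_congr rfl fun j _ => ?_
  rw [genOp_hkSymbol, Finset.mul_sum, Finset.mul_sum]
  refine Finset.sum_congr rfl fun i _ => ?_
  have h1 : (fun b => bvec ((Fin.snocEquiv fun _ : Fin (n + 1) => Fin d) (j, i) b)) =
      (Fin.last n).insertNth (bvec j) fun b => bvec (i b) := by
    rw [Fin.insertNth_last']
    funext b
    refine Fin.lastCases ?_ (fun b => ?_) b <;> simp
  have h2 : ∀ y : B, ((-1 : ℤ) ^ n) • y = (-1) ^ n * y := fun y => by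
    rcases Nat.even_or_odd n with h | h <;> simp [h.neg_one_pow]
  rw [h1, AlternatingMap.map_insertNth, Fin.prod_univ_castSucc, map_zsmul, Fin.val_last, h2]
  simp only [Fin.snocEquiv_apply, Fin.snoc_castSucc, Fin.snoc_last,
    AlternatingMap.curryLeft_apply_apply]
  ring

/-- The divergence of the coefficients appears from the derivatives of γ. The remaining terms
contain a second derivative of some f_b, symmetric in its two indices, contracted with the
antisymmetric γ, and they cancel. -/
lemma sum_der_genOp_hkSymbol (γ : Alt d (n + 1) (Poly d)) (f : Fin n → B) :
    ∑ j, der j (genOp B (hkSymbol (γ.curryLeft (bvec j))) f) =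
      genOp B (hkSymbol (contr n partialL γ)) f := by
  let T : Fin n → (Fin (n + 1) → Fin d) → B := fun b k =>
    coeffHom (γ fun c => bvec (k c)) *
      ∏ c, Function.update (fun c => der (k c.succ) (f c)) b
        (der (k 0) (der (k b.succ) (f b))) c
  have hT : ∀ b, ∑ k, T b k = 0 := by
    intro b
    let σ : Equiv.Perm (Fin (n + 1)) := Equiv.swap 0 b.succ
    have h : ∀ k, T b (k ∘ σ) = -T b k := by
      intro k
      have h1 : γ (fun c => bvec ((k ∘ σ) c)) = -γ fun c => bvec (k c) :=
        γ.map_swap (fun c => bvec (k c)) (Fin.succ_ne_zero b).symm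
      simp only [T]
      rw [h1, map_neg, neg_mul]
      congr 3
      funext c
      have h0 : σ 0 = b.succ := Equiv.swap_apply_left _ _
      have hb : σ b.succ = 0 := Equiv.swap_apply_right _ _
      by_cases hc : c = b
      · subst hc
        simp only [Function.update_self, Function.comp_apply, h0, hb]
        exact DiffAlg.der_comm _ _ _
      · have : σ c.succ = c.succ := Equiv.swap_apply_of_ne_of_ne (Fin.succ_ne_zero c)
          fun h => hc (Fin.succ_injective _ h)
        simp only [Function.update_of_ne hc, Function.comp_apply, this]
    have h2 : ∑ k, T b k = -∑ k, T b k := by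
      conv_lhs => rw [← (Equiv.arrowCongr σ (Equiv.refl (Fin d))).sum_comp]
      rw [← Finset.sum_neg_distrib]
      refine Finset.sum_congr rfl fun k _ => ?_
      rw [← h k]
      rfl
    have h3 : (2 : ℂ) • ∑ k, T b k = 0 := by
      rw [two_smul]
      nth_rewrite 1 [h2]
      exact neg_add_cancel _
    exact (smul_eq_zero.1 h3).resolve_left two_ne_zero
  have h1 : ∀ j, der j (genOp B (hkSymbol (γ.curryLeft (bvec j))) f) =
      ∑ i : Fin n → Fin d, (coeffHom (MvPolynomial.pderiv j
        (γ (Matrix.vecCons (bvec j) fun b => bvec (i b)))) * ∏ b, der (i b) (f b) +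
        ∑ b, T b (Fin.cons j i)) := by
    intro j
    rw [genOp_hkSymbol, map_sum]
    refine Finset.sum_congr rfl fun i _ => ?_
    rw [Derivation.leibniz, der_prod, DiffAlg.der_coeff, add_comm, smul_eq_mul, smul_eq_mul,
      mul_comm, Finset.mul_sum]
    congr 1
    refine Finset.sum_congr rfl fun b _ => ?_
    simp only [T, bvec_cons, Fin.cons_succ, Fin.cons_zero, AlternatingMap.curryLeft_apply_apply]
  have h2 : ∑ j, ∑ i : Fin n → Fin d, ∑ b, T b (Fin.cons j i) = 0 := by
    rw [Finset.sum_comm, ← sum_fin_cons fun k => ∑ b, T b k, Finset.sum_comm]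
    exact Finset.sum_eq_zero fun b _ => hT b
  rw [Finset.sum_congr rfl fun j _ => h1 j]
  simp only [Finset.sum_add_distrib]
  rw [h2, add_zero, genOp_hkSymbol, Finset.sum_comm]
  refine Finset.sum_congr rfl fun i _ => ?_
  rw [contr_apply, map_sum, Finset.sum_mul]
  rfl

end

lemma intMul_der_mul (j : Fin d) (F G : TestFn d) (H : smoothAlg d) :
    intMul G (der j F.1 * H) = -intMul G (F.1 * der j H) - intMul F (H * der j G.1) := by
  have h := totalInt_mul_der j (H * G.1) F.2
  have h2 : der j (H * G.1) * F.1 = F.1 * der j H * G.1 + H * der j G.1 * F.1 := by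
    rw [Derivation.leibniz, smul_eq_mul, smul_eq_mul]
    ring
  rw [h2, totalInt_add (hasCompactSupport_mul_right G.2) (hasCompactSupport_mul_right F.2)] at h
  rw [intMul_apply, intMul_apply, intMul_apply,
    show der j F.1 * H * G.1 = H * G.1 * der j F.1 by ring, h]
  ring

/-- The defect of cyclicity of a polyvector field is measured by its divergence. -/
theorem hkP_sub_cycP (γ : Alt d (n + 1) (Poly d)) :
    hkP d (n + 1) γ - cycP d (n + 1) (hkP d (n + 1) γ) =
      barP d n (hkP d n (contr n partialL γ)) := by
  -- As b kills every `hkP`, b' equals minus the term with the new first factor.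
  have h0 : barP d n (hkP d n (contr n partialL γ)) =
      -mulFirst d n (hkP d n (contr n partialL γ)) := by
    have := hochP_hkP (contr n partialL γ)
    rw [hochP, LinearMap.add_apply] at this
    exact (neg_eq_of_add_eq_zero_right this).symm
  apply toFunctional_injective
  rw [h0, map_sub, map_neg, toFunctional_cycP, toFunctional_mulFirst,
    toFunctional_eq (polyOp_hkSymbol γ), toFunctional_eq (polyOp_hkSymbol (contr n partialL γ))]
  funext f
  let F := f 0
  let G := f (Fin.last (n + 1))
  let g : Fin n → smoothAlg d := fun b => (f b.succ.castSucc).1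
  have h1 : pairing d (n + 1) (hkSymbol γ) f =
      intMul G (genOp (smoothAlg d) (hkSymbol γ) (Fin.cons F.1 g)) := by
    rw [pairing_eq_intMul]
    refine congrArg (intMul G) (congrArg _ (funext fun i => ?_))
    refine Fin.cases ?_ (fun i => ?_) i <;> rfl
  have h2 : cyc (n + 1) (pairing d (n + 1) (hkSymbol γ)) f =
      (-1) ^ (n + 1) * intMul F (genOp (smoothAlg d) (hkSymbol γ)
        (Fin.snoc g G.1 : Fin (n + 1) → smoothAlg d)) := by
    simp only [cyc, LinearMap.coe_mk, AddHom.coe_mk, pairing_eq_intMul, Fin.last_add_one,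
      Fin.coeSucc_eq_succ]
    refine congrArg _ (congrArg (intMul F) (congrArg _ (funext fun i => ?_)))
    refine Fin.lastCases ?_ (fun i => ?_) i
    · simp [G]
    · simp [g]
  have h3 : wrapFace (pairing d n (hkSymbol (contr n partialL γ))) f =
      intMul G (F.1 * genOp (smoothAlg d) (hkSymbol (contr n partialL γ)) g) := by
    simp only [wrapFace, LinearMap.coe_mk, AddHom.coe_mk, pairing_eq_intMul,
      contractNth_last_castSucc, contractNth_last_last, Fin.coeSucc_eq_succ, Fin.last_add_one,
      intMul_apply, TestFn.coe_mul, Fin.succ_last, Fin.succ_castSucc]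
    rw [mul_comm (f (Fin.last (n + 1))).1, ← mul_assoc, mul_comm _ (f 0).1]
  rw [Pi.sub_apply, Pi.neg_apply, h1, h2, h3, genOp_hkSymbol_cons, genOp_hkSymbol_snoc,
    intMul_neg_one_pow, ← mul_assoc, ← pow_add, ← sum_der_genOp_hkSymbol, Finset.mul_sum]
  have hpow : ((-1 : ℂ)) ^ (n + 1 + n) = -1 := by
    rw [show n + 1 + n = 2 * n + 1 by ring, pow_succ, pow_mul]
    simp
  -- With H_j the operator of γ(e_j, ·), the difference is the integral of ∑_j (∂_j F H_j G + F H_j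
  -- ∂_j G), which by parts equals that of -F (∑_j ∂_j H_j) G.
  rw [hpow, map_sum, map_sum, map_sum, Finset.sum_congr rfl fun j _ => intMul_der_mul j F G _,
    Finset.sum_sub_distrib, Finset.sum_neg_distrib]
  simp only [mul_comm (der _ G.1)]
  ring

/-! ### Cyclic cochains -/

lemma exists_eq_C (w : (Poly d)ˣ) : ∃ c : ℂ, c ≠ 0 ∧ (w : Poly d) = MvPolynomial.C c := by
  obtain ⟨c, hc, h⟩ := MvPolynomial.isUnit_iff_eq_C_of_isReduced.1 w.isUnit
  exact ⟨c, hc.ne_zero, h⟩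

/-- The density is a nonzero constant, so it cancels and the condition is independent of the volume
form. -/
lemma isCyclicShift_iff (w : (Poly d)ˣ) (P : PolyDiffSymbol d n) :
    IsCyclicShift w P P ↔ cyc n (pairing d n P) = pairing d n P := by
  obtain ⟨c, hc, hw⟩ := exists_eq_C w
  have hI : ∀ (g : Fin n → TestFn d) (h : TestFn d),
      ∫ x, smoothOp P (fun i => (g i).1.1) x * h.1.1 x * evalReal (w : Poly d) x =
        totalInt (genOp (smoothAlg d) P (fun i => (g i).1) * h.1) * c := by
    intro g h
    rw [totalInt, ← integral_mul_const]
    congr 1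
    funext x
    rw [smoothOp_eq_genOp P (fun i => (g i).1) x, hw]
    simp [evalReal]
  have hF : ∀ F : Fin (n + 1) → TestFn d,
      (∫ x, smoothOp P (fun i => (F i.castSucc).1.1) x * (F (Fin.last n)).1.1 x *
        evalReal (w : Poly d) x = (-1) ^ n * ∫ x, smoothOp P (fun i => (F i.succ).1.1) x *
          (F 0).1.1 x * evalReal (w : Poly d) x) ↔
        cyc n (pairing d n P) F = pairing d n P F := by
    intro F
    rw [hI (fun i => F i.castSucc) (F (Fin.last n)), hI (fun i => F i.succ) (F 0), ← mul_assoc,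
      mul_left_inj' hc, eq_comm]
    simp only [cyc, LinearMap.coe_mk, AddHom.coe_mk, pairing_apply, Fin.coeSucc_eq_succ,
      Fin.last_add_one]
  constructor
  · intro h
    funext F
    exact (hF F).1 (h (fun i => (F i).1.1) fun i => ⟨(F i).1.2, (F i).2⟩)
  · intro h f hf
    exact (hF fun i => ⟨⟨f i, (hf i).1⟩, (hf i).2⟩).2 (congrFun h _)

lemma mem_cyclicCochains_iff (w : (Poly d)ˣ) (φ : PolyDiff d n) :
    φ.1 ∈ cyclicCochains w n ↔ cycP d n φ = φ := by
  obtain ⟨φ, P, rfl⟩ := φ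
  have h : polyOp d n P ∈ cyclicCochains w n ↔ IsCyclicShift w P P := by
    constructor
    · rintro ⟨Q, hQ, h⟩
      rw [← polyOp_injective h]
      exact hQ
    · exact fun h => ⟨P, h, rfl⟩
  rw [h, isCyclicShift_iff, ← toFunctional_injective.eq_iff, toFunctional_cycP,
    toFunctional_eq (φ := ⟨polyOp d n P, P, rfl⟩) rfl]

lemma mem_polyDiff_of_mem_cyclicCochains {w : (Poly d)ˣ} {φ : Cochain d n}
    (h : φ ∈ cyclicCochains w n) : φ ∈ PolyDiff d n := by
  obtain ⟨P, -, rfl⟩ := h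
  exact ⟨P, rfl⟩

end Cyclic

end

end CyclicHKR

namespace CyclicHKR

noncomputable section

/-! ### Cohomology of the cyclic complex -/

section Chase

variable {d n : ℕ}

/-- The cyclically invariant polydifferential operators. -/
def cycInv (d n : ℕ) : Submodule ℂ (PolyDiff d n) := LinearMap.eqLocus (cycP d n) LinearMap.id

lemma mem_cycInv {φ : PolyDiff d n} : φ ∈ cycInv d n ↔ cycP d n φ = φ := Iff.rfl

/-- Cyclic cocycles. -/
def cycCocycles (d n : ℕ) : Submodule ℂ (PolyDiff d n) := cycInv d n ⊓ LinearMap.ker (hochP d n)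

lemma mem_cycCocycles {φ : PolyDiff d n} :
    φ ∈ cycCocycles d n ↔ cycP d n φ = φ ∧ hochP d n φ = 0 := Iff.rfl

/-- Cyclic coboundaries. -/
def cycCoboundaries (d : ℕ) : ∀ n, Submodule ℂ (PolyDiff d n)
  | 0 => ⊥
  | n + 1 => (cycInv d n).map (hochP d n)

/-- Inherited from b'b' = 0 through the injective map `mulFirst`. -/
lemma hochP_hochP (φ : PolyDiff d n) : hochP d (n + 1) (hochP d n φ) = 0 := by
  apply mulFirst_injective
  rw [← neg_inj, ← barP_mulFirst, ← neg_inj, ← map_neg, ← barP_mulFirst, barP_barP, map_zero,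
    neg_zero, neg_zero]

lemma cycP_hochP {φ : PolyDiff d n} (h : cycP d n φ = φ) :
    cycP d (n + 1) (hochP d n φ) = hochP d n φ := by
  have := barP_sub_cycP φ
  rw [h, sub_self, map_zero] at this
  exact (sub_eq_zero.1 this.symm).symm

lemma cycCoboundaries_le : cycCoboundaries d n ≤ cycCocycles d n := by
  cases n with
  | zero => exact bot_le
  | succ n =>
    rintro _ ⟨y, hy, rfl⟩
    exact ⟨cycP_hochP hy, hochP_hochP y⟩

lemma cycP_cycSumP (φ : PolyDiff d n) : cycP d n (cycSumP d n φ) = cycSumP d n φ := by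
  have h := Finset.sum_range_succ' (fun i => (cycP d n ^ i) φ) (n + 1)
  rw [Finset.sum_range_succ, cycP_pow_card] at h
  rw [cycSumP, LinearMap.sum_apply, map_sum]
  simp only [← Module.End.mul_apply, ← pow_succ']
  exact (add_right_cancel h).symm

lemma cycSumP_of_cycP_eq {φ : PolyDiff d n} (h : cycP d n φ = φ) :
    cycSumP d n φ = ((n : ℂ) + 1) • φ := by
  have hp : ∀ k, (cycP d n ^ k) φ = φ := by
    intro k
    induction k with
    | zero => rfl
    | succ k ih => rw [pow_succ, Module.End.mul_apply, h, ih]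
  rw [cycSumP, LinearMap.sum_apply, Finset.sum_congr rfl fun k _ => hp k, Finset.sum_const,
    Finset.card_range, ← Nat.cast_smul_eq_nsmul ℂ]
  push_cast
  rfl

/-- A primitive for `1 - t` on the kernel of the norm. -/
def cycPrim (d n : ℕ) : PolyDiff d n →ₗ[ℂ] PolyDiff d n :=
  ((n : ℂ) + 1)⁻¹ • ∑ i ∈ Finset.range (n + 1), ∑ k ∈ Finset.range i, cycP d n ^ k

lemma natCast_add_one_ne_zero (n : ℕ) : (n : ℂ) + 1 ≠ 0 := by exact_mod_cast Nat.succ_ne_zero n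

/-- (1 - t) telescopes against 1 + t + … + t^{i-1} to 1 - t^i; averaging over i gives the identity
minus the projection N/(n + 1) onto invariants. -/
lemma cycPrim_sub_cycP (φ : PolyDiff d n) :
    cycPrim d n φ - cycP d n (cycPrim d n φ) = φ - ((n : ℂ) + 1)⁻¹ • cycSumP d n φ := by
  have h1 : ∀ i, (∑ k ∈ Finset.range i, (cycP d n ^ k) φ) -
      cycP d n (∑ k ∈ Finset.range i, (cycP d n ^ k) φ) = φ - (cycP d n ^ i) φ := by
    intro i
    rw [map_sum, ← Finset.sum_sub_distrib]
    simp only [← Module.End.mul_apply, ← pow_succ']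
    rw [Finset.sum_range_sub']
    rfl
  rw [cycPrim, LinearMap.smul_apply, map_smul, ← smul_sub, LinearMap.sum_apply, map_sum,
    ← Finset.sum_sub_distrib]
  simp only [LinearMap.sum_apply, h1]
  rw [Finset.sum_sub_distrib, Finset.sum_const, Finset.card_range, ← Nat.cast_smul_eq_nsmul ℂ,
    smul_sub, smul_smul, Nat.cast_succ, inv_mul_cancel₀ (natCast_add_one_ne_zero n), one_smul,
    cycSumP, LinearMap.sum_apply]

lemma cycSumP_sub_cycP (φ : PolyDiff d n) : cycSumP d n (φ - cycP d n φ) = 0 := by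
  have h := Finset.sum_range_succ' (fun i => (cycP d n ^ i) φ) (n + 1)
  rw [Finset.sum_range_succ, cycP_pow_card] at h
  rw [cycSumP, LinearMap.sum_apply]
  simp only [map_sub, ← Module.End.mul_apply, ← pow_succ]
  rw [Finset.sum_sub_distrib, sub_eq_zero]
  exact add_right_cancel h

lemma eq_sub_cycP_of_cycSumP_eq_zero {φ : PolyDiff d n} (h : cycSumP d n φ = 0) :
    cycPrim d n φ - cycP d n (cycPrim d n φ) = φ := by
  rw [cycPrim_sub_cycP, h, smul_zero, sub_zero]

lemma cycSumP_barP_of_cycP_eq {φ : PolyDiff d n} (h : cycP d n φ = φ) :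
    cycSumP d (n + 1) (barP d n φ) = ((n : ℂ) + 1) • hochP d n φ := by
  have h1 : barP d n φ = hochP d n φ - mulFirst d n φ := by
    rw [hochP, LinearMap.add_apply, add_sub_cancel_left]
  rw [h1, map_sub, cycSumP_mulFirst φ h, cycSumP_of_cycP_eq (cycP_hochP h)]
  push_cast
  module

/-- N b' = b N. On the image of 1 - t both sides vanish, by b'(1 - t) = (1 - t)b; on invariants it
is `cycSumP_barP_of_cycP_eq`; these two parts span. -/
lemma cycSumP_barP (φ : PolyDiff d n) :
    cycSumP d (n + 1) (barP d n φ) = hochP d n (cycSumP d n φ) := by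
  have h1 : φ = (cycPrim d n φ - cycP d n (cycPrim d n φ)) +
      ((n : ℂ) + 1)⁻¹ • cycSumP d n φ := by
    rw [cycPrim_sub_cycP, sub_add_cancel]
  conv_lhs => rw [h1]
  rw [map_add, map_add, barP_sub_cycP, cycSumP_sub_cycP, zero_add, map_smul, map_smul,
    cycSumP_barP_of_cycP_eq (cycP_cycSumP φ), smul_smul,
    inv_mul_cancel₀ (natCast_add_one_ne_zero n), one_smul]

lemma exists_barP_eq {φ : PolyDiff d (n + 1)} (h : barP d (n + 1) φ = 0) :
    ∃ ρ, barP d n ρ = φ := by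
  refine ⟨-insertOne d n φ, ?_⟩
  have := insertOne_barP φ
  rw [h, map_zero] at this
  rw [map_neg]
  rw [eq_comm, sub_eq_zero] at this
  rw [← this, neg_neg]

lemma barP_zero_injective {φ : PolyDiff d 0} (h : barP d 0 φ = 0) : φ = 0 := by
  have := insertOne_barP_zero φ
  rw [h, map_zero] at this
  exact neg_eq_zero.1 this.symm

/-! ### Divergence-free alternating maps -/

/-- Divergence-free polyvector fields, as alternating maps. -/
def altDivFree (d : ℕ) : ∀ n, Submodule ℂ (Alt d n (Poly d))
  | 0 => ⊤
  | n + 1 => LinearMap.ker (contr n partialL)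

lemma mem_altDivFree_succ {γ : Alt d (n + 1) (Poly d)} :
    γ ∈ altDivFree d (n + 1) ↔ contr n partialL γ = 0 := Iff.rfl

lemma partialL_comm (i j : Fin d) (p : Poly d) :
    partialL i (partialL j p) = partialL j (partialL i p) := pderiv_comm i j p

lemma contr_mem_altDivFree (γ : Alt d (n + 1) (Poly d)) : contr n partialL γ ∈ altDivFree d n := by
  cases n with
  | zero => exact Submodule.mem_top
  | succ n => exact contr_contr _ partialL_comm γ

lemma partialL_mulRight_X (i j : Fin d) (p : Poly d) :
    partialL i (LinearMap.mulRight ℂ (MvPolynomial.X j) p) =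
      LinearMap.mulRight ℂ (MvPolynomial.X j) (partialL i p) + if i = j then p else 0 := by
  simp only [partialL_apply, LinearMap.mulRight_apply, Derivation.leibniz, smul_eq_mul,
    MvPolynomial.pderiv_X]
  by_cases hij : i = j
  · subst hij; simp; ring
  · simp [hij, Ne.symm hij]; ring

lemma exists_mem_nilFil_partialL (p : Poly d) : ∃ m, p ∈ nilFil (partialL (d := d)) m := by
  induction p using MvPolynomial.induction_on with
  | C a =>
    refine ⟨1, mem_nilFil_succ.2 fun j => ?_⟩
    rw [partialL_apply, MvPolynomial.pderiv_C]
    exact zero_mem _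
  | add p q hp hq =>
    obtain ⟨m, hm⟩ := hp
    obtain ⟨m', hm'⟩ := hq
    exact ⟨max m m', add_mem (nilFil_mono _ (le_max_left _ _) hm)
      (nilFil_mono _ (le_max_right _ _) hm')⟩
  | mul_X p j hp =>
    obtain ⟨m, hm⟩ := hp
    have h := nilFil_weyl_map (D := partialL) (e := fun j => LinearMap.mulRight ℂ (MvPolynomial.X j))
      partialL_mulRight_X j hm
    exact ⟨m + 1, h⟩

/-- The Poincaré lemma for polyvector fields. -/
theorem exists_contr_partialL_eq (hn : n < d) {γ : Alt d n (Poly d)} (h : γ ∈ altDivFree d n) :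
    ∃ η : Alt d (n + 1) (Poly d), contr n partialL η = γ := by
  refine exists_contr_eq (D := partialL) (e := fun j => LinearMap.mulRight ℂ (MvPolynomial.X j))
    partialL_mulRight_X partialL_comm exists_mem_nilFil_partialL hn γ fun q hq => ?_
  subst hq
  exact h

lemma alt_eq_zero (hn : d < n) (γ : Alt d n (Poly d)) : γ = 0 := by
  ext1 v
  refine γ.map_linearDependent v fun hv => ?_
  have := hv.fintype_card_le_finrank
  simp at this
  omega

lemma cycP_hkP {γ : Alt d n (Poly d)} (h : γ ∈ altDivFree d n) :
    cycP d n (hkP d n γ) = hkP d n γ := by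
  cases n with
  | zero => exact cycP_zero _
  | succ n =>
    have := hkP_sub_cycP γ
    rw [mem_altDivFree_succ.1 h, map_zero, map_zero] at this
    exact (sub_eq_zero.1 this).symm

lemma hkP_mem_cycCocycles {γ : Alt d n (Poly d)} (h : γ ∈ altDivFree d n) :
    hkP d n γ ∈ cycCocycles d n := ⟨cycP_hkP h, hochP_hkP γ⟩

lemma eq_zero_of_hkP_mem_cycCoboundaries {γ : Alt d n (Poly d)}
    (h : hkP d n γ ∈ cycCoboundaries d n) : γ = 0 := by
  cases n with
  | zero => exact hkP_zero_bijective.1 (h.trans (map_zero _).symm)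
  | succ n =>
    obtain ⟨y, -, hy⟩ := h
    exact hkP_eq_hochP γ y hy.symm

/-! ### The connecting construction -/

/-- If Nρ = 0 then ρ = (1 - t)σ, so (1 - t)(y - bσ) = b'ρ - b'(1 - t)σ = 0: the corrected y is
cyclic and has the same Hochschild differential. -/
lemma hochP_mem_cycCoboundaries_of_cycSumP_eq_zero {y : PolyDiff d (n + 1)} {ρ : PolyDiff d n}
    (hy : y - cycP d (n + 1) y = barP d n ρ) (hρ : cycSumP d n ρ = 0) :
    hochP d (n + 1) y ∈ cycCoboundaries d (n + 2) := by
  refine ⟨y - hochP d n (cycPrim d n ρ), ?_, ?_⟩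
  · rw [SetLike.mem_coe, mem_cycInv, map_sub, ← sub_eq_zero]
    have h1 := barP_sub_cycP (cycPrim d n ρ)
    rw [eq_sub_cycP_of_cycSumP_eq_zero hρ, ← hy] at h1
    rw [← neg_eq_zero, ← sub_eq_zero.2 h1]
    abel
  · rw [map_sub, hochP_hochP, sub_zero]

/-- If Nρ = bσ with σ cyclic, subtracting a multiple of b'σ from ρ makes its norm zero and leaves
b'ρ unchanged. -/
lemma hochP_mem_cycCoboundaries {y : PolyDiff d (n + 1)} {ρ : PolyDiff d n}
    (hy : y - cycP d (n + 1) y = barP d n ρ) (hρ : cycSumP d n ρ ∈ cycCoboundaries d n) :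
    hochP d (n + 1) y ∈ cycCoboundaries d (n + 2) := by
  cases n with
  | zero => exact hochP_mem_cycCoboundaries_of_cycSumP_eq_zero hy hρ
  | succ n =>
    obtain ⟨σ, hσ, hρ⟩ := hρ
    refine hochP_mem_cycCoboundaries_of_cycSumP_eq_zero
      (ρ := ρ - ((n : ℂ) + 1)⁻¹ • barP d n σ) ?_ ?_
    · rw [map_sub, map_smul, barP_barP, smul_zero, sub_zero, hy]
    · rw [map_sub, map_smul, cycSumP_barP_of_cycP_eq hσ, smul_smul,
        inv_mul_cancel₀ (natCast_add_one_ne_zero n), one_smul, hρ, sub_self]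

/-- Applying 1 - t to x gives b'(hkP (div γ) + (1 - t)y) = 0. A b'-primitive ρ of the bracket
satisfies b(Nρ) = N hkP (div γ), a nonzero multiple of hkP (div γ) because div γ is divergence-free;
uniqueness in HKR forces div γ = 0. Without arguments t = 1 and b' is injective, so no ρ is needed.
-/
lemma contr_eq_zero_of_cyclic {γ : Alt d (n + 1) (Poly d)} {y : PolyDiff d n}
    (hx : cycP d (n + 1) (hkP d (n + 1) γ + hochP d n y) = hkP d (n + 1) γ + hochP d n y) :
    contr n partialL γ = 0 ∧ barP d n (y - cycP d n y) = 0 := by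
  have h1 : barP d n (hkP d n (contr n partialL γ) + (y - cycP d n y)) = 0 := by
    rw [map_add, barP_sub_cycP, ← hkP_sub_cycP]
    rw [map_add] at hx
    rw [← sub_eq_zero.2 hx.symm]
    abel
  have h2 : contr n partialL γ = 0 := by
    have hc := cycSumP_of_cycP_eq (cycP_hkP (contr_mem_altDivFree γ))
    cases n with
    | zero =>
      have h2 := barP_zero_injective h1
      rw [cycP_zero, sub_self, add_zero] at h2
      exact hkP_zero_bijective.1 (h2.trans (map_zero _).symm)
    | succ n =>
      obtain ⟨ρ, hρ⟩ := exists_barP_eq h1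
      have h3 := congrArg (cycSumP d (n + 1)) hρ
      rw [cycSumP_barP, map_add, cycSumP_sub_cycP, add_zero, hc] at h3
      refine hkP_eq_hochP _ ((((n + 1 : ℕ) : ℂ) + 1)⁻¹ • cycSumP d n ρ) ?_
      rw [map_smul, h3, smul_smul, inv_mul_cancel₀ (natCast_add_one_ne_zero (n + 1)), one_smul]
  refine ⟨h2, ?_⟩
  rwa [h2, map_zero, zero_add] at h1

lemma exists_of_mem_cycCocycles_succ {x : PolyDiff d (n + 1)} (hx : x ∈ cycCocycles d (n + 1)) :
    ∃ γ ∈ altDivFree d (n + 1), ∃ y, x = hkP d (n + 1) γ + hochP d n y ∧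
      barP d n (y - cycP d n y) = 0 := by
  obtain ⟨γ, y, rfl⟩ := exists_hkP_add x hx.2
  obtain ⟨h1, h2⟩ := contr_eq_zero_of_cyclic hx.1
  exact ⟨γ, h1, y, rfl, h2⟩

lemma cycSumP_mem_cycCocycles {y : PolyDiff d (n + 1)} {ρ : PolyDiff d n}
    (hy : y - cycP d (n + 1) y = barP d n ρ) : cycSumP d n ρ ∈ cycCocycles d n := by
  refine ⟨cycP_cycSumP ρ, ?_⟩
  change hochP d n (cycSumP d n ρ) = 0
  rw [← cycSumP_barP, ← hy, cycSumP_sub_cycP]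

/-- In low degrees, cyclic cocycles are cohomologous to divergence-free polyvector fields. -/
theorem exists_sub_hkP_mem_cycCoboundaries (n : ℕ) (hn : n ≤ d + 1) :
    ∀ x ∈ cycCocycles d n, ∃ γ ∈ altDivFree d n, x - hkP d n γ ∈ cycCoboundaries d n := by
  induction n using Nat.strong_induction_on with
  | _ n ih =>
    intro x hx
    match n, hn, ih, x, hx with
    | 0, _, _, x, _ =>
      obtain ⟨γ, rfl⟩ := hkP_zero_bijective.2 x
      exact ⟨γ, Submodule.mem_top, by rw [sub_self]; exact zero_mem _⟩
    | 1, _, _, x, hx =>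
      obtain ⟨γ, hγ, y, rfl, -⟩ := exists_of_mem_cycCocycles_succ hx
      exact ⟨γ, hγ, by rw [add_sub_cancel_left]; exact ⟨y, cycP_zero y, rfl⟩⟩
    | n + 2, hn, ih, x, hx =>
      obtain ⟨γ, hγ, y, rfl, hy⟩ := exists_of_mem_cycCocycles_succ hx
      refine ⟨γ, hγ, ?_⟩
      rw [add_sub_cancel_left]
      obtain ⟨ρ, hρ⟩ := exists_barP_eq hy
      obtain ⟨γ', hγ', h⟩ := ih n (by omega) (by omega) _ (cycSumP_mem_cycCocycles hρ.symm)
      -- The bound n + 2 ≤ d + 1 gives n < d, exactly the range of the Poincaré lemma.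
      obtain ⟨γ'', rfl⟩ := exists_contr_partialL_eq (by omega) hγ'
      have h1 : hochP d (n + 1) y =
          hochP d (n + 1) (y - ((n : ℂ) + 1)⁻¹ • hkP d (n + 1) γ'') := by
        rw [map_sub, map_smul, hochP_hkP, smul_zero, sub_zero]
      rw [h1]
      -- Subtracting hkP γ''/(n + 1) from y does not change b y. It subtracts hkP (div γ'')/(n + 1)
      -- from ρ, hence hkP (div γ'') from Nρ, which becomes a coboundary.
      refine hochP_mem_cycCoboundaries
        (ρ := ρ - ((n : ℂ) + 1)⁻¹ • hkP d n (contr n partialL γ'')) ?_ ?_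
      · rw [map_sub, map_sub, map_smul, map_smul, hρ, ← hkP_sub_cycP]
        module
      · rw [map_sub, map_smul, cycSumP_of_cycP_eq (cycP_hkP hγ'), smul_smul,
          inv_mul_cancel₀ (natCast_add_one_ne_zero n), one_smul]
        exact h

/-! ### Periodicity -/

/-- The periodicity operator. -/
def periodicity (d n : ℕ) : PolyDiff d n →ₗ[ℂ] PolyDiff d (n + 2) :=
  hochP d (n + 1) ∘ₗ cycPrim d (n + 1) ∘ₗ barP d n

/-- N b'z = (n + 1) b z = 0 for a cyclic cocycle z, so b'z lies in the image of 1 - t. Applying b to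
the preimage defines the periodicity operator. -/
lemma cycPrim_barP {z : PolyDiff d n} (hz : z ∈ cycCocycles d n) :
    cycPrim d (n + 1) (barP d n z) - cycP d (n + 1) (cycPrim d (n + 1) (barP d n z)) =
      barP d n z := by
  apply eq_sub_cycP_of_cycSumP_eq_zero
  rw [cycSumP_barP_of_cycP_eq hz.1, LinearMap.mem_ker.1 hz.2, smul_zero]

lemma periodicity_mem {z : PolyDiff d n} (hz : z ∈ cycCocycles d n) :
    periodicity d n z ∈ cycCocycles d (n + 2) := by
  refine ⟨?_, hochP_hochP _⟩
  have h := barP_sub_cycP (cycPrim d (n + 1) (barP d n z))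
  rw [cycPrim_barP hz, barP_barP] at h
  exact (sub_eq_zero.1 h.symm).symm

lemma periodicity_mem_cycCoboundaries {z : PolyDiff d n} (hz : z ∈ cycCoboundaries d n) :
    periodicity d n z ∈ cycCoboundaries d (n + 2) := by
  have hz' := cycCoboundaries_le hz
  refine hochP_mem_cycCoboundaries (cycPrim_barP hz') ?_
  rw [cycSumP_of_cycP_eq hz'.1]
  exact Submodule.smul_mem _ _ hz

lemma exists_hochP_eq (hn : d ≤ n) {x : PolyDiff d (n + 1)} (hx : hochP d (n + 1) x = 0) :
    ∃ y, hochP d n y = x := by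
  obtain ⟨γ, y, rfl⟩ := exists_hkP_add x hx
  rw [alt_eq_zero (by omega) γ, map_zero, zero_add]
  exact ⟨y, rfl⟩

/-- Let (1 - t)y = b'z and b y = b y' with y' cyclic. Position n + 1 has no Hochschild cohomology,
so y - y' = b w, and applying 1 - t gives b'(z - (1 - t)w) = 0. If z - (1 - t)w = b'θ, then taking N
yields (n + 1)z = b(Nθ). -/
lemma mem_cycCoboundaries_of_periodicity (hn : d ≤ n) {z : PolyDiff d n}
    (hz : z ∈ cycCocycles d n) (h : periodicity d n z ∈ cycCoboundaries d (n + 2)) :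
    z ∈ cycCoboundaries d n := by
  obtain ⟨y', hy', h⟩ := h
  have h1 : hochP d (n + 1) (cycPrim d (n + 1) (barP d n z) - y') = 0 := by
    rw [map_sub, h]
    exact sub_self _
  obtain ⟨w, hw⟩ := exists_hochP_eq hn h1
  have h2 : barP d n (z - (w - cycP d n w)) = 0 := by
    rw [map_sub, barP_sub_cycP, hw, map_sub, mem_cycInv.1 hy']
    nth_rewrite 1 [← cycPrim_barP hz]
    abel
  have hzN := cycSumP_of_cycP_eq hz.1
  cases n with
  | zero =>
    have h3 := barP_zero_injective h2
    rw [cycP_zero, sub_self, sub_zero] at h3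
    exact h3
  | succ n =>
    obtain ⟨θ, hθ⟩ := exists_barP_eq h2
    have h3 := congrArg (cycSumP d (n + 1)) hθ
    rw [map_sub, cycSumP_sub_cycP, sub_zero, hzN, cycSumP_barP] at h3
    refine ⟨(((n + 1 : ℕ) : ℂ) + 1)⁻¹ • cycSumP d n θ,
      Submodule.smul_mem _ _ (cycP_cycSumP θ), ?_⟩
    rw [map_smul, h3, smul_smul, inv_mul_cancel₀ (natCast_add_one_ne_zero (n + 1)), one_smul]

/-- Here x = b y and (1 - t)y = b'ρ. The choice z = Nρ/(n + 1) makes N(ρ - z) = 0, so after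
subtracting the primitive for b'z from y the vanishing-norm criterion applies. -/
lemma exists_periodicity (hn : d ≤ n) {x : PolyDiff d (n + 2)} (hx : x ∈ cycCocycles d (n + 2)) :
    ∃ z ∈ cycCocycles d n, x - periodicity d n z ∈ cycCoboundaries d (n + 2) := by
  obtain ⟨γ, hγ, y, rfl, hy⟩ := exists_of_mem_cycCocycles_succ hx
  rw [alt_eq_zero (by omega) γ, map_zero, zero_add]
  obtain ⟨ρ, hρ⟩ := exists_barP_eq hy
  have hz := Submodule.smul_mem _ ((n : ℂ) + 1)⁻¹ (cycSumP_mem_cycCocycles hρ.symm)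
  refine ⟨_, hz, ?_⟩
  have h1 : hochP d (n + 1) y - periodicity d n (((n : ℂ) + 1)⁻¹ • cycSumP d n ρ) =
      hochP d (n + 1) (y - cycPrim d (n + 1) (barP d n (((n : ℂ) + 1)⁻¹ • cycSumP d n ρ))) := by
    rw [map_sub]
    rfl
  rw [h1]
  refine hochP_mem_cycCoboundaries_of_cycSumP_eq_zero
    (ρ := ρ - ((n : ℂ) + 1)⁻¹ • cycSumP d n ρ) ?_ ?_
  · rw [map_sub, map_sub, hρ]
    nth_rewrite 3 [← cycPrim_barP hz]
    abel
  · rw [map_sub, map_smul, cycSumP_of_cycP_eq (cycP_cycSumP ρ), smul_smul,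
      inv_mul_cancel₀ (natCast_add_one_ne_zero n), one_smul, sub_self]

end Chase

end

end CyclicHKR

namespace CyclicHKR

noncomputable section

/-! ### Polyvector fields as alternating maps -/

section Polyvec

variable {d n : ℕ}

/-- The alternating map attached to a polyvector field. -/
def toAlt (d n : ℕ) : Polyvec d →ₗ[ℂ] Alt d n (Poly d) where
  toFun γ := ∑ I : {I : Finset (Fin d) // I.card = n},
    (LinearMap.toSpanSingleton ℂ (Poly d) (γ I.1)).compAlternatingMap
      (Matrix.detRowAlternating.compLinearMap (LinearMap.funLeft ℂ ℂ (I.1.orderEmbOfFin I.2)))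
  map_add' γ γ' := by
    ext1 v
    simp [Alt.sum_apply, Finset.sum_add_distrib]
  map_smul' c γ := by
    ext1 v
    simp [Alt.sum_apply, Finset.smul_sum, smul_comm c]

lemma toAlt_apply (γ : Polyvec d) (v : Fin n → Fin d → ℂ) :
    toAlt d n γ v = ∑ I : {I : Finset (Fin d) // I.card = n},
      (Matrix.of fun b a => v b (I.1.orderEmbOfFin I.2 a)).det • γ I.1 := by
  simp only [toAlt, LinearMap.coe_mk, AddHom.coe_mk, Alt.sum_apply]
  rfl

/-- The basis vectors indexed by `I` in increasing order. -/
def bvecs (I : Finset (Fin d)) (hI : I.card = n) : Fin n → Fin d → ℂ :=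
  fun b => bvec (I.orderEmbOfFin hI b)

lemma toAlt_bvecs (γ : Polyvec d) (I : Finset (Fin d)) (hI : I.card = n) :
    toAlt d n γ (bvecs I hI) = γ I := by
  rw [toAlt_apply, Finset.sum_eq_single ⟨I, hI⟩]
  · have : (Matrix.of fun b a => bvecs I hI b (I.orderEmbOfFin hI a)) =
        (1 : Matrix (Fin n) (Fin n) ℂ) := by
      ext b a
      simp [bvecs, bvec, Pi.single_apply, Matrix.one_apply, eq_comm]
    rw [this, Matrix.det_one, one_smul]
  · rintro ⟨J, hJ⟩ - hne
    have hne' : J ≠ I := fun h => hne (Subtype.ext h)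
    obtain ⟨i, hi, hiJ⟩ : ∃ i ∈ I, i ∉ J := by
      by_contra! h
      exact hne' (Finset.eq_of_subset_of_card_le h (by omega)).symm
    obtain ⟨b, rfl⟩ : i ∈ Set.range (I.orderEmbOfFin hI) := by
      rw [Finset.range_orderEmbOfFin]
      exact hi
    rw [Matrix.det_eq_zero_of_row_eq_zero b, zero_smul]
    intro a
    have : J.orderEmbOfFin hJ a ≠ I.orderEmbOfFin hI b :=
      fun h => hiJ (h ▸ Finset.orderEmbOfFin_mem J hJ a)
    simp [bvecs, bvec, this]
  · simp

lemma alt_ext {τ τ' : Alt d n (Poly d)} (h : ∀ I hI, τ (bvecs I hI) = τ' (bvecs I hI)) :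
    τ = τ' := by
  refine Module.Basis.ext_alternating (Pi.basisFun ℂ (Fin d)) fun i hi => ?_
  let I := Finset.univ.image i
  have hI : I.card = n := by
    rw [Finset.card_image_of_injective _ hi, Finset.card_univ, Fintype.card_fin]
  have hmem : ∀ b, i b ∈ Set.range (I.orderEmbOfFin hI) := by
    intro b
    rw [Finset.range_orderEmbOfFin]
    exact Finset.mem_coe.2 (Finset.mem_image_of_mem i (Finset.mem_univ b))
  choose σ hσ using hmem
  have hinj : Function.Injective σ := fun a b hab => hi (by rw [← hσ a, ← hσ b, hab])
  let e : Equiv.Perm (Fin n) := Equiv.ofBijective σ (Finite.injective_iff_bijective.1 hinj)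
  have hv : (fun b => Pi.basisFun ℂ (Fin d) (i b)) = bvecs I hI ∘ e := by
    funext b
    rw [Pi.basisFun_apply, ← hσ b]
    rfl
  rw [hv, τ.map_perm, τ'.map_perm, h]

lemma toAlt_injective {γ γ' : Polyvec d} (hγ : γ ∈ polyvecDeg d n) (hγ' : γ' ∈ polyvecDeg d n)
    (h : toAlt d n γ = toAlt d n γ') : γ = γ' := by
  funext I
  by_cases hI : I.card = n
  · rw [← toAlt_bvecs γ I hI, h, toAlt_bvecs]
  · rw [hγ I hI, hγ' I hI]

lemma exists_toAlt_eq (τ : Alt d n (Poly d)) : ∃ γ ∈ polyvecDeg d n, toAlt d n γ = τ := by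
  refine ⟨fun I => if hI : I.card = n then τ (bvecs I hI) else 0, fun I hI => dif_neg hI,
    alt_ext fun I hI => ?_⟩
  rw [toAlt_bvecs, dif_pos hI]

/-! ### The divergence -/

lemma inversions_insert (j : Fin d) (I : Finset (Fin d)) (J : Finset (Fin d)) (hj : j ∉ I) :
    (((insert j I) ×ˢ J).filter fun p => p.2 < p.1).card =
      ((I ×ˢ J).filter fun p => p.2 < p.1).card + (J.filter (· < j)).card := by
  have h : ∀ K : Finset (Fin d), ((K ×ˢ J).filter fun p => p.2 < p.1).card =
      ∑ i ∈ K, (J.filter (· < i)).card := by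
    intro K
    rw [Finset.card_filter, Finset.sum_product]
    exact Finset.sum_congr rfl fun i _ => (Finset.card_filter _ _).symm
  rw [h, h, Finset.sum_insert hj, add_comm]

lemma inversions_erase (j : Fin d) (I : Finset (Fin d)) (J : Finset (Fin d)) (hj : j ∈ J) :
    ((I ×ˢ J).filter fun p => p.2 < p.1).card =
      ((I ×ˢ J.erase j).filter fun p => p.2 < p.1).card + (I.filter (j < ·)).card := by
  have h : ∀ K : Finset (Fin d), ((I ×ˢ K).filter fun p => p.2 < p.1).card =
      ∑ i ∈ K, (I.filter (i < ·)).card := by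
    intro K
    rw [Finset.card_filter, Finset.sum_product_right]
    exact Finset.sum_congr rfl fun i _ => (Finset.card_filter _ _).symm
  rw [h, h, Finset.sum_erase_add _ _ hj]

/-- Counting inversions: moving j between I and its complement changes the shuffle sign by elements
of the complement below j and elements of I above j; the former cancel against the de Rham sign. -/
lemma divergence_sign (j : Fin d) (I : Finset (Fin d)) (hj : j ∉ I) :
    shuffleSign I Iᶜ * ((-1) ^ (Iᶜ.filter (· < j)).card * shuffleSign (insert j I) (Iᶜ.erase j)) =
      (-1) ^ (I.filter (j < ·)).card := by
  unfold shuffleSign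
  have hj' : j ∈ Iᶜ := Finset.mem_compl.2 hj
  have h1 : (Iᶜ.erase j).filter (· < j) = Iᶜ.filter (· < j) := by
    ext k
    simp only [Finset.mem_filter, Finset.mem_erase]
    exact ⟨fun h => ⟨h.1.2, h.2⟩, fun h => ⟨⟨h.2.ne, h.1⟩, h.2⟩⟩
  rw [inversions_insert j I _ hj, inversions_erase j I _ hj', h1]
  have h2 : ∀ a b c : ℕ, (-1 : ℂ) ^ (a + b) * ((-1) ^ c * (-1) ^ (a + c)) = (-1) ^ b := by
    intro a b c
    rw [← pow_add, ← pow_add, show a + b + (c + (a + c)) = b + 2 * (a + c) by ring, pow_add,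
      pow_mul (-1 : ℂ) 2]
    simp
  exact h2 _ _ _

lemma divergence_apply (w : (Poly d)ˣ) (γ : Polyvec d) (I : Finset (Fin d)) :
    divergence w γ I = ∑ j ∈ Iᶜ, (-1 : ℂ) ^ (I.filter (j < ·)).card •
      MvPolynomial.pderiv j (γ (insert j I)) := by
  obtain ⟨c, hc, hw⟩ := exists_eq_C w
  have h1 : divergence w γ I = shuffleSign I Iᶜ • (((w⁻¹ : (Poly d)ˣ) : Poly d) *
      ∑ j ∈ Iᶜ, ((-1 : ℂ) ^ (Iᶜ.filter (· < j)).card) • MvPolynomial.pderiv j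
        (shuffleSign (Iᶜ.erase j)ᶜ (Iᶜ.erase j) • ((w : Poly d) * γ (Iᶜ.erase j)ᶜ))) := rfl
  rw [h1, Finset.mul_sum, Finset.smul_sum]
  refine Finset.sum_congr rfl fun j hj => ?_
  rw [Finset.mem_compl] at hj
  have h2 : (Iᶜ.erase j)ᶜ = insert j I := by
    ext k
    simp only [Finset.mem_compl, Finset.mem_erase, Finset.mem_insert]
    tauto
  have h3 : MvPolynomial.pderiv j ((w : Poly d) * γ (insert j I)) =
      (w : Poly d) * MvPolynomial.pderiv j (γ (insert j I)) := by
    rw [hw, MvPolynomial.pderiv_C_mul]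
  rw [h2, Derivation.map_smul, h3, mul_smul_comm, mul_smul_comm, ← mul_assoc, Units.inv_mul, one_mul,
    smul_smul, smul_smul, mul_assoc, divergence_sign j I hj]

lemma divergence_mem {w : (Poly d)ˣ} {γ : Polyvec d} (hγ : γ ∈ polyvecDeg d (n + 1)) :
    divergence w γ ∈ polyvecDeg d n := by
  intro I hI
  rw [divergence_apply]
  refine Finset.sum_eq_zero fun j hj => ?_
  rw [hγ _ (by rw [Finset.card_insert_of_notMem (Finset.mem_compl.1 hj)]; omega), map_zero,
    smul_zero]

lemma divergence_zero {w : (Poly d)ˣ} {γ : Polyvec d} (hγ : γ ∈ polyvecDeg d 0) :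
    divergence w γ = 0 := by
  funext I
  rw [divergence_apply]
  refine Finset.sum_eq_zero fun j hj => ?_
  rw [hγ _ (by rw [Finset.card_insert_of_notMem (Finset.mem_compl.1 hj)]; omega), map_zero,
    smul_zero]

lemma bvecs_insert (I : Finset (Fin d)) (hI : I.card = n) (j : Fin d)
    (hjI : (insert j I).card = n + 1) :
    ∃ p : Fin (n + 1), (p : ℕ) = (I.filter (· < j)).card ∧
      bvecs (insert j I) hjI = p.insertNth (bvec j) (bvecs I hI) := by
  have hj : j ∉ I := fun h => by rw [Finset.insert_eq_of_mem h] at hjI; omega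
  set E := (insert j I).orderEmbOfFin hjI with hE
  obtain ⟨p, hp⟩ : j ∈ Set.range E := by
    rw [hE, Finset.range_orderEmbOfFin]
    exact Finset.mem_coe.2 (Finset.mem_insert_self j I)
  refine ⟨p, ?_, ?_⟩
  · have : I.filter (· < j) = (Finset.Iio p).map E.toEmbedding := by
      ext k
      simp only [Finset.mem_filter, Finset.mem_map, Finset.mem_Iio, RelEmbedding.coe_toEmbedding]
      constructor
      · rintro ⟨hk, hkj⟩
        obtain ⟨q, rfl⟩ : k ∈ Set.range E := by
          rw [hE, Finset.range_orderEmbOfFin]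
          exact Finset.mem_coe.2 (Finset.mem_insert_of_mem hk)
        exact ⟨q, by rwa [← hp, E.lt_iff_lt] at hkj, rfl⟩
      · rintro ⟨q, hq, rfl⟩
        have hlt : E q < j := by rwa [← hp, E.lt_iff_lt]
        exact ⟨Finset.mem_of_mem_insert_of_ne (Finset.orderEmbOfFin_mem _ hjI q) hlt.ne, hlt⟩
    rw [this, Finset.card_map, Fin.card_Iio]
  · have h1 : (fun b => E (p.succAbove b)) = I.orderEmbOfFin hI := by
      refine Finset.orderEmbOfFin_unique hI (fun b => ?_) fun a b hab => ?_
      · refine Finset.mem_of_mem_insert_of_ne (Finset.orderEmbOfFin_mem _ hjI _) ?_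
        exact fun h => Fin.succAbove_ne p b (E.injective (h.trans hp.symm))
      · exact E.strictMono (Fin.strictMono_succAbove p hab)
    rw [Fin.eq_insertNth_iff]
    refine ⟨?_, ?_⟩
    · simp only [bvecs]
      rw [← hE, hp]
    · funext b
      simp only [bvecs, Fin.removeNth]
      rw [← hE, ← h1]

lemma toAlt_vecCons_bvecs (γ : Polyvec d) (I : Finset (Fin d)) (hI : I.card = n) (j : Fin d) :
    toAlt d (n + 1) γ (Matrix.vecCons (bvec j) (bvecs I hI)) =
      if j ∈ I then 0 else (-1 : ℂ) ^ (I.filter (· < j)).card • γ (insert j I) := by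
  split_ifs with hj
  · obtain ⟨b, rfl⟩ : j ∈ Set.range (I.orderEmbOfFin hI) := by
      rw [Finset.range_orderEmbOfFin]
      exact hj
    refine AlternatingMap.map_eq_zero_of_eq _ _ (i := 0) (j := b.succ) ?_ (Fin.succ_ne_zero b).symm
    simp [bvecs]
  · have hjI : (insert j I).card = n + 1 := by rw [Finset.card_insert_of_notMem hj, hI]
    obtain ⟨p, hp, h⟩ := bvecs_insert I hI j hjI
    have h1 := toAlt_bvecs γ (insert j I) hjI
    rw [h, AlternatingMap.map_insertNth] at h1
    rw [← h1, ← hp]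
    rcases Nat.even_or_odd (p : ℕ) with h | h <;> simp [h.neg_one_pow]

/-- The divergence counts the elements of I above j, the contraction those below j; the two counts
add up to n, hence the global sign. -/
lemma toAlt_divergence (w : (Poly d)ˣ) (γ : Polyvec d) :
    toAlt d n (divergence w γ) = (-1 : ℂ) ^ n • contr n partialL (toAlt d (n + 1) γ) := by
  refine alt_ext fun I hI => ?_
  rw [toAlt_bvecs, divergence_apply, AlternatingMap.smul_apply, contr_apply, Finset.smul_sum,
    ← Finset.sum_compl_add_sum I]
  have h0 : ∑ j ∈ I, (-1 : ℂ) ^ n • partialL j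
      (toAlt d (n + 1) γ (Matrix.vecCons (bvec j) (bvecs I hI))) = 0 := by
    refine Finset.sum_eq_zero fun j hj => ?_
    rw [toAlt_vecCons_bvecs, if_pos hj, map_zero, smul_zero]
  rw [h0, add_zero]
  refine Finset.sum_congr rfl fun j hj => ?_
  rw [Finset.mem_compl] at hj
  rw [toAlt_vecCons_bvecs, if_neg hj, map_smul, smul_smul, partialL_apply]
  congr 1
  have hcard : (I.filter (· < j)).card + (I.filter (j < ·)).card = n := by
    rw [← hI, ← Finset.card_filter_add_card_filter_not (s := I) (· < j)]
    congr 2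
    refine Finset.filter_congr fun k hk => ?_
    rw [not_lt]
    exact ⟨le_of_lt, fun h => lt_of_le_of_ne h fun h => hj (h ▸ hk)⟩
  rw [← hcard, ← pow_add]
  rw [show (I.filter (· < j)).card + (I.filter (j < ·)).card + (I.filter (· < j)).card =
    (I.filter (j < ·)).card + 2 * (I.filter (· < j)).card by ring, pow_add, pow_mul]
  simp

lemma mem_polyvecDiv_iff {w : (Poly d)ˣ} {γ : Polyvec d} (hγ : γ ∈ polyvecDeg d n) :
    γ ∈ polyvecDiv w n ↔ toAlt d n γ ∈ altDivFree d n := by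
  have h0 : γ ∈ polyvecDiv w n ↔ divergence w γ = 0 := ⟨fun h => h.2, fun h => ⟨hγ, h⟩⟩
  rw [h0]
  cases n with
  | zero => exact iff_of_true (divergence_zero hγ) Submodule.mem_top
  | succ n =>
    rw [mem_altDivFree_succ]
    have h1 := toAlt_divergence (n := n) w γ
    constructor
    · intro h
      rw [h, map_zero] at h1
      exact (smul_eq_zero.1 h1.symm).resolve_left (pow_ne_zero _ (by norm_num))
    · intro h
      rw [h, smul_zero] at h1
      exact toAlt_injective (divergence_mem hγ) (zero_mem _) (h1.trans (map_zero _).symm)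

lemma divergence_divergence (w : (Poly d)ˣ) {γ : Polyvec d} (hγ : γ ∈ polyvecDeg d n) :
    divergence w (divergence w γ) = 0 := by
  match n, hγ with
  | 0, hγ => rw [divergence_zero hγ, map_zero]
  | 1, hγ => exact divergence_zero (divergence_mem hγ)
  | n + 2, hγ =>
    refine toAlt_injective (divergence_mem (divergence_mem hγ)) (zero_mem _) ?_
    rw [toAlt_divergence, toAlt_divergence, map_smul, contr_contr _ partialL_comm, smul_zero,
      smul_zero, map_zero]

/-- The Poincaré lemma for the divergence. -/
theorem exists_divergence_eq (w : (Poly d)ˣ) (hn : n < d) {γ : Polyvec d}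
    (hγ : γ ∈ polyvecDiv w n) : ∃ η ∈ polyvecDeg d (n + 1), divergence w η = γ := by
  obtain ⟨τ, hτ⟩ := exists_contr_partialL_eq hn ((mem_polyvecDiv_iff hγ.1).1 hγ)
  obtain ⟨η, hη, rfl⟩ := exists_toAlt_eq τ
  refine ⟨(-1 : ℂ) ^ n • η, Submodule.smul_mem _ _ hη, ?_⟩
  refine toAlt_injective (divergence_mem (Submodule.smul_mem _ _ hη)) hγ.1 ?_
  rw [map_smul, map_smul, toAlt_divergence, hτ, smul_smul, ← pow_add, ← two_mul, pow_mul]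
  simp

/-! ### The Hochschild–Kostant–Rosenberg map on polyvector fields -/

/-- Each df_b is expanded in the basis dx_k; multilinearity of the determinant collapses the sum
over all index tuples. -/
lemma sum_det_mul_prod (I : Fin n → Fin d) (f : Fin n → Poly d) :
    ∑ i : Fin n → Fin d, (Matrix.of fun b a => bvec (i b) (I a)).det •
      ∏ b, MvPolynomial.pderiv (i b) (f b) =
      (Matrix.of fun a b => MvPolynomial.pderiv (I a) (f b)).det := by
  simp only [← Matrix.det_transpose (Matrix.of fun b a => bvec _ _), Matrix.det_apply',
    Finset.sum_smul]
  rw [Finset.sum_comm]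
  refine Finset.sum_congr rfl fun σ _ => ?_
  have h : ∏ b, MvPolynomial.pderiv (I (σ b)) (f b) =
      ∏ b, ∑ k, (bvec k (I (σ b)) : ℂ) • MvPolynomial.pderiv k (f b) := by
    refine Finset.prod_congr rfl fun b _ => ?_
    simp [bvec, Pi.single_apply]
  simp only [Matrix.of_apply, Matrix.transpose_apply]
  rw [h, Fintype.prod_sum, Finset.mul_sum]
  refine Finset.sum_congr rfl fun i _ => ?_
  rw [Finset.prod_smul, mul_smul, Algebra.smul_def]
  simp

lemma hkr_eq (γ : Polyvec d) :
    hkr n γ = ((n.factorial : ℂ)⁻¹ • hkP d n (toAlt d n γ)).1 := by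
  funext f
  have h : (hkP d n (toAlt d n γ)).1 f = ∑ I : {I : Finset (Fin d) // I.card = n},
      γ I.1 * (Matrix.of fun a b : Fin n =>
        MvPolynomial.pderiv (I.1.orderEmbOfFin I.2 a) (f b)).det := by
    rw [hkP_eq, AddSubmonoidClass.coe_finsetSum, Finset.sum_apply]
    simp only [monoP_apply, toAlt_apply, Finset.sum_mul]
    rw [Finset.sum_comm]
    refine Finset.sum_congr rfl fun I _ => ?_
    rw [← sum_det_mul_prod, Finset.mul_sum]
    refine Finset.sum_congr rfl fun i _ => ?_
    rw [smul_mul_assoc, mul_smul_comm]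
  rw [SetLike.val_smul, Pi.smul_apply, h]
  rfl

/-! ### Top degree -/

lemma exists_eq_C_of_pderiv_eq_zero {p : Poly d} (h : ∀ j, MvPolynomial.pderiv j p = 0) :
    ∃ c, p = MvPolynomial.C c := by
  refine ⟨MvPolynomial.coeff 0 p, MvPolynomial.ext _ _ fun m => ?_⟩
  rw [MvPolynomial.coeff_C]
  split_ifs with hm
  · rw [hm]
  · obtain ⟨j, hj⟩ : ∃ j, m j ≠ 0 := by
      by_contra! h
      exact hm (Finsupp.ext h).symm
    have h1 := congrArg (MvPolynomial.coeff (m - Finsupp.single j 1)) (h j)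
    have h2 : m - Finsupp.single j 1 + Finsupp.single j 1 = m :=
      tsub_add_cancel_of_le (Finsupp.single_le_iff.2 (Nat.one_le_iff_ne_zero.2 hj))
    rw [MvPolynomial.coeff_pderiv, h2, MvPolynomial.coeff_zero, mul_eq_zero] at h1
    refine h1.resolve_right ?_
    exact natCast_add_one_ne_zero _

lemma single_univ_mem_polyvecDiv (w : (Poly d)ˣ) (c : ℂ) :
    (Pi.single Finset.univ (MvPolynomial.C c) : Polyvec d) ∈ polyvecDiv w d := by
  refine ⟨fun I hI => Pi.single_eq_of_ne (fun h => hI ?_) _, ?_⟩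
  · rw [h, Finset.card_univ, Fintype.card_fin]
  · change divergence w _ = 0
    funext I
    rw [divergence_apply]
    refine Finset.sum_eq_zero fun j _ => ?_
    by_cases h : insert j I = Finset.univ
    · rw [h, Pi.single_eq_same, MvPolynomial.pderiv_C, smul_zero]
    · rw [Pi.single_eq_of_ne h, map_zero, smul_zero]

/-- Divergence-free polyvector fields of top degree are constant. -/
def polyvecDivTop (w : (Poly d)ˣ) : ℂ →ₗ[ℂ] polyvecDiv w d where
  toFun c := ⟨Pi.single Finset.univ (MvPolynomial.C c), single_univ_mem_polyvecDiv w c⟩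
  map_add' a b := Subtype.ext (by simp [Pi.single_add])
  map_smul' a b := Subtype.ext (by
    simp [← Pi.single_smul, MvPolynomial.smul_eq_C_mul])

lemma polyvecDivTop_bijective (w : (Poly d)ˣ) : Function.Bijective (polyvecDivTop w) := by
  constructor
  · intro a b h
    have := congrFun (congrArg Subtype.val h) Finset.univ
    simpa [polyvecDivTop] using this
  · rintro ⟨γ, hγ, hdiv⟩
    have h1 : ∀ j, MvPolynomial.pderiv j (γ Finset.univ) = 0 := by
      intro j
      have := congrFun (LinearMap.mem_ker.1 hdiv) (Finset.univ.erase j)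
      rw [divergence_apply] at this
      have hc : (Finset.univ.erase j)ᶜ = {j} := by
        ext k; simp
      rw [hc, Finset.sum_singleton, Finset.insert_erase (Finset.mem_univ j)] at this
      exact (smul_eq_zero.1 this).resolve_left (pow_ne_zero _ (by norm_num))
    obtain ⟨c, hc⟩ := exists_eq_C_of_pderiv_eq_zero h1
    refine ⟨c, Subtype.ext (funext fun I => ?_)⟩
    change (Pi.single Finset.univ (MvPolynomial.C c) : Polyvec d) I = γ I
    by_cases hI : I = Finset.univ
    · rw [hI, Pi.single_eq_same, hc]
    · rw [Pi.single_eq_of_ne hI,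
        hγ I fun h => hI ((Finset.card_eq_iff_eq_univ I).1 (by simpa using h))]

end Polyvec

end

end CyclicHKR

namespace CyclicHKR

noncomputable section

/-! ### Quotients of cocycles by coboundaries -/

section Quotients

variable {V M M' : Type} [AddCommGroup V] [Module ℂ V] [AddCommGroup M] [Module ℂ M]
  [AddCommGroup M'] [Module ℂ M']

lemma exists_equiv_quotient (Z B : Submodule ℂ M) (f : V →ₗ[ℂ] Z)
    (hinj : ∀ v, (f v : M) ∈ B → v = 0) (hsurj : ∀ z ∈ Z, ∃ v, z - f v ∈ B) :
    ∃ e : V ≃ₗ[ℂ] Z ⧸ B.submoduleOf Z, ∀ v, e v = Submodule.Quotient.mk (f v) := by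
  refine ⟨LinearEquiv.ofBijective ((B.submoduleOf Z).mkQ ∘ₗ f) ⟨?_, fun q => ?_⟩, fun v => rfl⟩
  · rw [injective_iff_map_eq_zero]
    intro v hv
    exact hinj v ((Submodule.Quotient.mk_eq_zero (B.submoduleOf Z)).1 hv)
  · obtain ⟨z, rfl⟩ := Submodule.Quotient.mk_surjective _ q
    obtain ⟨v, hv⟩ := hsurj z z.2
    exact ⟨v, ((Submodule.Quotient.eq (B.submoduleOf Z)).2 hv).symm⟩

lemma nonempty_equiv_quotient {Z B : Submodule ℂ M} {Z' B' : Submodule ℂ M'} (f : Z →ₗ[ℂ] Z')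
    (hB : ∀ z, (f z : M') ∈ B' ↔ (z : M) ∈ B) (hsurj : ∀ z' ∈ Z', ∃ z, z' - f z ∈ B') :
    Nonempty ((Z ⧸ B.submoduleOf Z) ≃ₗ[ℂ] Z' ⧸ B'.submoduleOf Z') := by
  have hle : B.submoduleOf Z ≤ (B'.submoduleOf Z').comap f := fun z hz => (hB z).2 hz
  refine ⟨LinearEquiv.ofBijective (Submodule.mapQ _ _ f hle) ⟨?_, fun q => ?_⟩⟩
  · rw [injective_iff_map_eq_zero]
    intro q hq
    obtain ⟨z, rfl⟩ := Submodule.Quotient.mk_surjective _ q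
    rw [Submodule.mapQ_apply] at hq
    exact (Submodule.Quotient.mk_eq_zero (B.submoduleOf Z)).2
      ((hB z).1 ((Submodule.Quotient.mk_eq_zero (B'.submoduleOf Z')).1 hq))
  · obtain ⟨z', rfl⟩ := Submodule.Quotient.mk_surjective _ q
    obtain ⟨z, h⟩ := hsurj z' z'.2
    refine ⟨Submodule.Quotient.mk z, ?_⟩
    rw [Submodule.mapQ_apply]
    exact ((Submodule.Quotient.eq (B'.submoduleOf Z')).2 h).symm

lemma subsingleton_quotient {Z B : Submodule ℂ M} (h : Z ≤ B) :
    Subsingleton (Z ⧸ B.submoduleOf Z) := by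
  rw [Submodule.Quotient.subsingleton_iff, eq_top_iff]
  exact fun z _ => h z.2

end Quotients

/-! ### The complex `T_poly ⊗ ℂ[u]` -/

section PolyvecU

variable {d n m k : ℕ}

/-- The coefficient of `u^k`. -/
def coeffU (d k : ℕ) : PolyvecU d →ₗ[ℂ] Polyvec d :=
  (TensorProduct.rid ℂ (Polyvec d)).toLinearMap ∘ₗ
    LinearMap.lTensor (Polyvec d) (Polynomial.lcoeff ℂ k)

lemma coeffU_tmul (γ : Polyvec d) (p : Polynomial ℂ) : coeffU d k (γ ⊗ₜ p) = p.coeff k • γ := by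
  simp [coeffU]

lemma coeffU_tmul_X_pow (γ : Polyvec d) (j : ℕ) :
    coeffU d k (γ ⊗ₜ (Polynomial.X ^ j)) = if k = j then γ else 0 := by
  rw [coeffU_tmul, Polynomial.coeff_X_pow]
  split_ifs <;> simp

lemma coeffU_dDiv (w : (Poly d)ˣ) (x : PolyvecU d) :
    coeffU d (k + 1) (dDiv w x) = divergence w (coeffU d k x) := by
  induction x using TensorProduct.induction_on with
  | zero => simp
  | tmul γ p => simp [dDiv, coeffU_tmul, Polynomial.coeff_X_mul]
  | add x y hx hy => simp only [map_add, hx, hy]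

lemma coeffU_zero_dDiv (w : (Poly d)ˣ) (x : PolyvecU d) : coeffU d 0 (dDiv w x) = 0 := by
  induction x using TensorProduct.induction_on with
  | zero => simp
  | tmul γ p => simp [dDiv, coeffU_tmul]
  | add x y hx hy => simp only [map_add, hx, hy, add_zero]

lemma dDiv_tmul_X_pow (w : (Poly d)ˣ) (γ : Polyvec d) :
    dDiv w (γ ⊗ₜ (Polynomial.X ^ k)) = divergence w γ ⊗ₜ (Polynomial.X ^ (k + 1)) := by
  simp [dDiv, pow_succ']

lemma tmul_mem_polyvecUDeg {γ : Polyvec d} (hγ : γ ∈ polyvecDeg d m) (h : m + 2 * k = n) :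
    γ ⊗ₜ[ℂ] (Polynomial.X ^ k : Polynomial ℂ) ∈ polyvecUDeg d n :=
  Submodule.subset_span ⟨m, k, h, γ, hγ, rfl⟩

lemma coeffU_mem {x : PolyvecU d} (hx : x ∈ polyvecUDeg d n) (h : m + 2 * k = n) :
    coeffU d k x ∈ polyvecDeg d m := by
  induction hx using Submodule.span_induction with
  | mem x hx =>
    obtain ⟨m', k', h', γ, hγ, rfl⟩ := hx
    rw [coeffU_tmul_X_pow]
    split_ifs with hk
    · obtain rfl : m' = m := by omega
      exact hγ
    · exact zero_mem _
  | zero => rw [map_zero]; exact zero_mem _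
  | add x y _ _ hx hy => rw [map_add]; exact add_mem hx hy
  | smul c x _ hx => rw [map_smul]; exact Submodule.smul_mem _ _ hx

lemma coeffU_eq_zero {x : PolyvecU d} (hx : x ∈ polyvecUDeg d n) (h : n < 2 * k) :
    coeffU d k x = 0 := by
  induction hx using Submodule.span_induction with
  | mem x hx =>
    obtain ⟨m', k', h', γ, hγ, rfl⟩ := hx
    rw [coeffU_tmul_X_pow, if_neg (by omega)]
  | zero => rw [map_zero]
  | add x y _ _ hx hy => rw [map_add, hx, hy, add_zero]
  | smul c x _ hx => rw [map_smul, hx, smul_zero]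

lemma eq_sum_coeffU {x : PolyvecU d} (hx : x ∈ polyvecUDeg d n) :
    x = ∑ k ∈ Finset.range (n + 1), coeffU d k x ⊗ₜ[ℂ] (Polynomial.X ^ k : Polynomial ℂ) := by
  induction hx using Submodule.span_induction with
  | mem x hx =>
    obtain ⟨m', k', h', γ, hγ, rfl⟩ := hx
    rw [Finset.sum_eq_single k']
    · rw [coeffU_tmul_X_pow, if_pos rfl]
    · intro k _ hk
      rw [coeffU_tmul_X_pow, if_neg hk, TensorProduct.zero_tmul]
    · intro hk
      exact absurd (Finset.mem_range.2 (by omega)) hk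
  | zero => simp
  | add x y _ _ hx hy =>
    simp only [map_add, TensorProduct.add_tmul, Finset.sum_add_distrib]
    rw [← hx, ← hy]
  | smul c x _ hx =>
    simp only [map_smul, ← TensorProduct.smul_tmul', ← Finset.smul_sum]
    rw [← hx]

lemma polyvecDeg_eq_zero (hn : d < n) {γ : Polyvec d} (hγ : γ ∈ polyvecDeg d n) : γ = 0 := by
  funext I
  refine hγ I fun h => ?_
  have := Finset.card_le_univ I
  rw [Fintype.card_fin] at this
  omega

/-- Cocycles of `T_poly ⊗ ℂ[u]`. -/
abbrev divCocycles (w : (Poly d)ˣ) (n : ℕ) : Submodule ℂ (PolyvecU d) :=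
  cocycles (M := fun _ => PolyvecU d) (fun _ => dDiv w) (polyvecUDeg d) n

/-- Coboundaries of `T_poly ⊗ ℂ[u]`. -/
abbrev divCoboundaries (w : (Poly d)ˣ) (n : ℕ) : Submodule ℂ (PolyvecU d) :=
  coboundaries (M := fun _ => PolyvecU d) (fun _ => dDiv w) (polyvecUDeg d) n

lemma dDiv_mem_polyvecUDeg (w : (Poly d)ˣ) {x : PolyvecU d} (hx : x ∈ polyvecUDeg d n) :
    dDiv w x ∈ polyvecUDeg d (n + 1) ∧ dDiv w (dDiv w x) = 0 := by
  induction hx using Submodule.span_induction with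
  | mem x hx =>
    obtain ⟨m, k, h, γ, hγ, rfl⟩ := hx
    rw [dDiv_tmul_X_pow, dDiv_tmul_X_pow, divergence_divergence w hγ, TensorProduct.zero_tmul]
    refine ⟨?_, rfl⟩
    cases m with
    | zero => rw [divergence_zero hγ, TensorProduct.zero_tmul]; exact zero_mem _
    | succ m => exact tmul_mem_polyvecUDeg (divergence_mem hγ) (by omega)
  | zero => simp
  | add x y _ _ hx hy =>
    simp only [map_add]
    exact ⟨add_mem hx.1 hy.1, by rw [hx.2, hy.2, add_zero]⟩
  | smul c x _ hx =>
    simp only [map_smul]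
    exact ⟨Submodule.smul_mem _ _ hx.1, by rw [hx.2, smul_zero]⟩

theorem isSubcomplex_polyvecU (w : (Poly d)ˣ) :
    IsSubcomplex (M := fun _ => PolyvecU d) (fun _ => dDiv w) (polyvecUDeg d) :=
  fun _ _ hx => dDiv_mem_polyvecUDeg w hx

lemma coeffU_mem_polyvecDiv {w : (Poly d)ˣ} {x : PolyvecU d} (hx : x ∈ divCocycles w n)
    (h : m + 2 * k = n) : coeffU d k x ∈ polyvecDiv w m := by
  refine ⟨coeffU_mem hx.1 h, ?_⟩
  have h2 : dDiv w x = 0 := hx.2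
  change divergence w _ = 0
  rw [← coeffU_dDiv, h2, map_zero]

lemma tmul_mem_divCoboundaries {w : (Poly d)ˣ} {γ : Polyvec d} (hγ : γ ∈ polyvecDiv w m)
    (hm : m < d) (h : m + 2 * (k + 1) = n) :
    γ ⊗ₜ[ℂ] (Polynomial.X ^ (k + 1) : Polynomial ℂ) ∈ divCoboundaries w n := by
  obtain ⟨η, hη, rfl⟩ := exists_divergence_eq w hm hγ
  obtain ⟨n, rfl⟩ : ∃ n', n = n' + 1 := ⟨n - 1, by omega⟩
  exact ⟨η ⊗ₜ (Polynomial.X ^ k), tmul_mem_polyvecUDeg hη (by omega), dDiv_tmul_X_pow w η⟩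

/-- The three cases are: the power of u exceeds the total degree, k > 0 with the coefficient below
top degree (exact by Poincaré), or the coefficient above top degree. The first and last coefficients
are zero. -/
lemma coeffU_tmul_mem_divCoboundaries {w : (Poly d)ˣ} {x : PolyvecU d} (hx : x ∈ divCocycles w n)
    (h : n < 2 * k ∨ (k ≠ 0 ∧ n < d + 2 * k) ∨ d + 2 * k < n) :
    coeffU d k x ⊗ₜ[ℂ] (Polynomial.X ^ k : Polynomial ℂ) ∈ divCoboundaries w n := by
  have h0 : coeffU d k x = 0 →
      coeffU d k x ⊗ₜ[ℂ] (Polynomial.X ^ k : Polynomial ℂ) ∈ divCoboundaries w n := by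
    intro h
    rw [h, TensorProduct.zero_tmul]
    exact zero_mem _
  by_cases hn : n < 2 * k
  · exact h0 (coeffU_eq_zero hx.1 hn)
  · have hmn : n - 2 * k + 2 * k = n := by omega
    rcases h with h | ⟨hk, h⟩ | h
    · exact absurd h hn
    · obtain ⟨k, rfl⟩ := Nat.exists_eq_succ_of_ne_zero hk
      exact tmul_mem_divCoboundaries (coeffU_mem_polyvecDiv hx hmn) (by omega) hmn
    · exact h0 (polyvecDeg_eq_zero (by omega) (coeffU_mem hx.1 hmn))

lemma tmul_mem_divCocycles {w : (Poly d)ˣ} {γ : Polyvec d} (hγ : γ ∈ polyvecDiv w m) (k : ℕ) :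
    γ ⊗ₜ[ℂ] (Polynomial.X ^ k : Polynomial ℂ) ∈ divCocycles w (m + 2 * k) := by
  refine ⟨tmul_mem_polyvecUDeg hγ.1 rfl, ?_⟩
  change dDiv w _ = 0
  rw [dDiv_tmul_X_pow, LinearMap.mem_ker.1 hγ.2, TensorProduct.zero_tmul]

/-- Only this coefficient can carry cohomology. It is not exact: for k = 0 the differential has no
u^0 part, and for m = d a primitive would involve a (d + 1)-vector field. -/
theorem exists_equiv_HDiv (w : (Poly d)ˣ) (hm : m ≤ d) (hk : k = 0 ∨ m = d) :
    ∃ e : polyvecDiv w m ≃ₗ[ℂ] HDiv w (m + 2 * k), ∀ γ,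
      e γ = Submodule.Quotient.mk ⟨γ.1 ⊗ₜ (Polynomial.X ^ k), tmul_mem_divCocycles γ.2 k⟩ := by
  refine exists_equiv_quotient (divCocycles w (m + 2 * k)) (divCoboundaries w (m + 2 * k))
    (((TensorProduct.mk ℂ (Polyvec d) (Polynomial ℂ)).flip (Polynomial.X ^ k)).restrict
      fun γ hγ => tmul_mem_divCocycles hγ k) (fun γ hγ => Subtype.ext ?_) fun x hx => ?_
  · change γ.1 ⊗ₜ[ℂ] (Polynomial.X ^ k : Polynomial ℂ) ∈ divCoboundaries w (m + 2 * k) at hγ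
    have h1 : coeffU d k (γ.1 ⊗ₜ (Polynomial.X ^ k)) = γ.1 := by
      rw [coeffU_tmul_X_pow, if_pos rfl]
    rw [← h1]
    generalize hn : m + 2 * k = n at hγ
    cases n with
    | zero =>
      have : γ.1 ⊗ₜ[ℂ] (Polynomial.X ^ k : Polynomial ℂ) = 0 := hγ
      rw [this, map_zero]
      rfl
    | succ n =>
      obtain ⟨y, hy, h⟩ := hγ
      rw [← h]
      cases k with
      | zero => exact coeffU_zero_dDiv w y
      | succ k =>
        rw [coeffU_dDiv, polyvecDeg_eq_zero (n := d + 1) (Nat.lt_succ_self d)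
          (coeffU_mem hy (by omega)), map_zero]
        rfl
  · refine ⟨⟨coeffU d k x, coeffU_mem_polyvecDiv hx rfl⟩, ?_⟩
    change x - coeffU d k x ⊗ₜ[ℂ] (Polynomial.X ^ k : Polynomial ℂ) ∈ _
    have h1 := eq_sum_coeffU hx.1
    rw [← Finset.add_sum_erase _ _ (Finset.mem_range.2 (by omega : k < m + 2 * k + 1))] at h1
    rw [sub_eq_of_eq_add' h1]
    refine Submodule.sum_mem _ fun j hj => coeffU_tmul_mem_divCoboundaries hx ?_
    have := Finset.ne_of_mem_erase hj
    omega

theorem subsingleton_HDiv (w : (Poly d)ˣ) (k : ℕ) : Subsingleton (HDiv w (d + 2 * k + 1)) := by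
  refine subsingleton_quotient fun x hx => ?_
  rw [eq_sum_coeffU hx.1]
  exact Submodule.sum_mem _ fun j _ => coeffU_tmul_mem_divCoboundaries hx (by omega)

end PolyvecU

/-! ### Cyclic cohomology -/

section HCyc

variable {d n : ℕ}

lemma mem_cocycles_iff (w : (Poly d)ˣ) (φ : PolyDiff d n) :
    φ.1 ∈ cocycles (hochschildD d) (cyclicCochains w) n ↔ φ ∈ cycCocycles d n := by
  rw [mem_cycCocycles, ← mem_cyclicCochains_iff w, Subtype.ext_iff, hochP_coe]
  rfl

lemma mem_coboundaries_iff (w : (Poly d)ˣ) (φ : PolyDiff d n) :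
    φ.1 ∈ coboundaries (hochschildD d) (cyclicCochains w) n ↔ φ ∈ cycCoboundaries d n := by
  cases n with
  | zero => exact (Subtype.ext_iff (a1 := φ) (a2 := 0)).symm
  | succ n =>
    constructor
    · rintro ⟨y, hy, h⟩
      refine ⟨⟨y, mem_polyDiff_of_mem_cyclicCochains hy⟩, (mem_cyclicCochains_iff w _).1 hy, ?_⟩
      exact Subtype.ext ((hochP_coe _).trans h)
    · rintro ⟨y, hy, rfl⟩
      exact ⟨y.1, (mem_cyclicCochains_iff w y).2 hy, (hochP_coe y).symm⟩

/-- Cyclic cochains are polydifferential operators. -/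
def toPolyDiff (w : (Poly d)ˣ) (n : ℕ) :
    cocycles (hochschildD d) (cyclicCochains w) n →ₗ[ℂ] PolyDiff d n :=
  Submodule.inclusion fun _ hz => mem_polyDiff_of_mem_cyclicCochains hz.1

lemma toPolyDiff_mem (w : (Poly d)ˣ) (z : cocycles (hochschildD d) (cyclicCochains w) n) :
    toPolyDiff w n z ∈ cycCocycles d n := (mem_cocycles_iff w (toPolyDiff w n z)).1 z.2

lemma nonempty_equiv_HCyc_add_two (w : (Poly d)ˣ) (hn : d ≤ n) :
    Nonempty (HCyc w n ≃ₗ[ℂ] HCyc w (n + 2)) := by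
  refine nonempty_equiv_quotient
    (((PolyDiff d (n + 2)).subtype ∘ₗ periodicity d n ∘ₗ toPolyDiff w n).codRestrict
      (cocycles (hochschildD d) (cyclicCochains w) (n + 2))
      fun z => (mem_cocycles_iff w _).2 (periodicity_mem (toPolyDiff_mem w z)))
    (fun z => (mem_coboundaries_iff w (periodicity d n (toPolyDiff w n z))).trans
      (Iff.trans ⟨mem_cycCoboundaries_of_periodicity hn (toPolyDiff_mem w z),
        periodicity_mem_cycCoboundaries⟩ (mem_coboundaries_iff w (toPolyDiff w n z)).symm))
    fun x hx => ?_
  obtain ⟨z, hz, h⟩ := exists_periodicity hn (toPolyDiff_mem w ⟨x, hx⟩)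
  exact ⟨⟨z.1, (mem_cocycles_iff w z).2 hz⟩, (mem_coboundaries_iff w _).2 h⟩

theorem isSubcomplex_cyclicCochains (w : (Poly d)ˣ) :
    IsSubcomplex (hochschildD d) (cyclicCochains w) := by
  intro n x hx
  let φ : PolyDiff d n := ⟨x, mem_polyDiff_of_mem_cyclicCochains hx⟩
  have h1 : hochschildD d n x = (hochP d n φ).1 := (hochP_coe φ).symm
  rw [h1, ← hochP_coe, hochP_hochP]
  exact ⟨(mem_cyclicCochains_iff w _).2 (cycP_hochP ((mem_cyclicCochains_iff w φ).1 hx)), rfl⟩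

/-- The map `γ ↦ φ_HKR(γ)` into polydifferential operators. -/
def hkrP (d n : ℕ) : Polyvec d →ₗ[ℂ] PolyDiff d n :=
  (n.factorial : ℂ)⁻¹ • (hkP d n ∘ₗ toAlt d n)

lemma hkrP_coe (γ : Polyvec d) : (hkrP d n γ).1 = hkr n γ := (hkr_eq γ).symm

lemma hkrP_mem_cycCocycles {w : (Poly d)ˣ} {γ : Polyvec d} (hγ : γ ∈ polyvecDiv w n) :
    hkrP d n γ ∈ cycCocycles d n :=
  Submodule.smul_mem _ _ (hkP_mem_cycCocycles ((mem_polyvecDiv_iff hγ.1).1 hγ))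

theorem exists_equiv_HCyc (w : (Poly d)ˣ) (hn : n ≤ d) :
    ∃ e : polyvecDiv w n ≃ₗ[ℂ] HCyc w n,
      ∀ γ, ∃ z : cocycles (hochschildD d) (cyclicCochains w) n,
        z.1 = hkr n γ.1 ∧ e γ = Submodule.Quotient.mk z := by
  have hfac : (n.factorial : ℂ) ≠ 0 := by exact_mod_cast Nat.factorial_ne_zero n
  suffices h : ∃ e : polyvecDiv w n ≃ₗ[ℂ] HCyc w n, ∀ γ : polyvecDiv w n,
      e γ = Submodule.Quotient.mk ⟨(hkrP d n γ.1).1,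
        (mem_cocycles_iff w _).2 (hkrP_mem_cycCocycles γ.2)⟩ by
    obtain ⟨e, he⟩ := h
    exact ⟨e, fun γ => ⟨_, hkrP_coe γ.1, he γ⟩⟩
  refine exists_equiv_quotient (cocycles (hochschildD d) (cyclicCochains w) n)
    (coboundaries (hochschildD d) (cyclicCochains w) n)
    (((PolyDiff d n).subtype ∘ₗ hkrP d n).restrict fun γ hγ =>
      (mem_cocycles_iff w _).2 (hkrP_mem_cycCocycles hγ)) (fun γ hγ => ?_) fun z hz => ?_
  · have h1 : hkrP d n γ.1 ∈ cycCoboundaries d n := (mem_coboundaries_iff w _).1 hγ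
    have h2 : hkP d n (toAlt d n γ.1) ∈ cycCoboundaries d n :=
      (Submodule.smul_mem_iff _ (inv_ne_zero hfac)).1 h1
    exact Subtype.ext (toAlt_injective γ.2.1 (zero_mem _)
      ((eq_zero_of_hkP_mem_cycCoboundaries h2).trans (map_zero _).symm))
  · let φ : PolyDiff d n := ⟨z, mem_polyDiff_of_mem_cyclicCochains hz.1⟩
    obtain ⟨τ, hτ, h⟩ := exists_sub_hkP_mem_cycCoboundaries n (by omega) φ
      ((mem_cocycles_iff w φ).1 hz)
    obtain ⟨γ, hγ, rfl⟩ := exists_toAlt_eq τ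
    -- The factor n! undoes the normalisation of the HKR map.
    refine ⟨⟨(n.factorial : ℂ) • γ, Submodule.smul_mem _ _ ((mem_polyvecDiv_iff hγ).2 hτ)⟩, ?_⟩
    have h1 : hkrP d n ((n.factorial : ℂ) • γ) = hkP d n (toAlt d n γ) := by
      rw [map_smul, hkrP, LinearMap.smul_apply, smul_smul, mul_inv_cancel₀ hfac, one_smul]
      rfl
    rw [← h1] at h
    exact (mem_coboundaries_iff w _).2 h

theorem nonempty_equiv_HCyc_complex (w : (Poly d)ˣ) (k : ℕ) :
    Nonempty (HCyc w (d + 2 * k) ≃ₗ[ℂ] ℂ) := by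
  induction k with
  | zero =>
    obtain ⟨e, -⟩ := exists_equiv_HCyc w le_rfl
    exact ⟨e.symm ≪≫ₗ (LinearEquiv.ofBijective _ (polyvecDivTop_bijective w)).symm⟩
  | succ k ih =>
    obtain ⟨e⟩ := ih
    obtain ⟨s⟩ := nonempty_equiv_HCyc_add_two w (Nat.le_add_right d (2 * k))
    exact ⟨s.symm ≪≫ₗ e⟩

theorem subsingleton_HCyc (w : (Poly d)ˣ) (k : ℕ) : Subsingleton (HCyc w (d + 2 * k + 1)) := by
  induction k with
  | zero =>
    refine subsingleton_quotient fun x hx => ?_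
    -- Position d + 1 is the last one reached by the low-degree theorem, and there are no (d +
    -- 1)-vector fields.
    obtain ⟨γ, -, h⟩ := exists_sub_hkP_mem_cycCoboundaries (d + 1) le_rfl _
      (toPolyDiff_mem w ⟨x, hx⟩)
    rw [alt_eq_zero (Nat.lt_succ_self d) γ, map_zero, sub_zero] at h
    exact (mem_coboundaries_iff w _).2 h
  | succ k ih =>
    obtain ⟨s⟩ := nonempty_equiv_HCyc_add_two w (by omega : d ≤ d + 2 * k + 1)
    exact s.symm.toEquiv.subsingleton

end HCyc

end

end CyclicHKR

theorem theorem2p1 (d : ℕ) (w : (MvPolynomial (Fin d) ℂ)ˣ) :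
    -- both objects are complexes
    CyclicHKR.IsSubcomplex (CyclicHKR.hochschildD d) (CyclicHKR.cyclicCochains w) ∧
    CyclicHKR.IsSubcomplex (M := fun _ => CyclicHKR.PolyvecU d) (fun _ => CyclicHKR.dDiv w)
      (CyclicHKR.polyvecUDeg d) ∧
    -- cohomology of `[D_poly]_cycl` in degree `i = n - 1`
    (∀ n ≤ d, ∃ e : CyclicHKR.polyvecDiv w n ≃ₗ[ℂ] CyclicHKR.HCyc w n,
      ∀ γ, ∃ z : CyclicHKR.cocycles (CyclicHKR.hochschildD d) (CyclicHKR.cyclicCochains w) n,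
        z.1 = CyclicHKR.hkr n γ.1 ∧ e γ = Submodule.Quotient.mk z) ∧
    (∀ k : ℕ, Nonempty (CyclicHKR.HCyc w (d + 2 * k) ≃ₗ[ℂ] ℂ)) ∧
    (∀ k : ℕ, Subsingleton (CyclicHKR.HCyc w (d + 2 * k + 1))) ∧
    -- cohomology of `T_poly ⊗ ℂ[u]` in degree `i = n - 1`
    (∀ n ≤ d, ∃ e : CyclicHKR.polyvecDiv w n ≃ₗ[ℂ] CyclicHKR.HDiv w n,
      ∀ γ, ∃ z : CyclicHKR.cocycles (M := fun _ => CyclicHKR.PolyvecU d)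
          (fun _ => CyclicHKR.dDiv w) (CyclicHKR.polyvecUDeg d) n,
        z.1 = γ.1 ⊗ₜ[ℂ] (1 : Polynomial ℂ) ∧ e γ = Submodule.Quotient.mk z) ∧
    (∀ k : ℕ, Nonempty (CyclicHKR.HDiv w (d + 2 * k) ≃ₗ[ℂ] ℂ)) ∧
    (∀ k : ℕ, Subsingleton (CyclicHKR.HDiv w (d + 2 * k + 1))) := by
  refine ⟨CyclicHKR.isSubcomplex_cyclicCochains w, CyclicHKR.isSubcomplex_polyvecU w,
    fun n hn => CyclicHKR.exists_equiv_HCyc w hn, CyclicHKR.nonempty_equiv_HCyc_complex w,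
    CyclicHKR.subsingleton_HCyc w, fun n hn => ?_, fun k => ?_, CyclicHKR.subsingleton_HDiv w⟩
  · obtain ⟨e, he⟩ := CyclicHKR.exists_equiv_HDiv (k := 0) w hn (Or.inl rfl)
    exact ⟨e, fun γ => ⟨_, congrArg (fun p => γ.1 ⊗ₜ[ℂ] p) (pow_zero _), he γ⟩⟩
  · obtain ⟨e, -⟩ := CyclicHKR.exists_equiv_HDiv (k := k) w le_rfl (Or.inr rfl)
    exact ⟨e.symm ≪≫ₗ (LinearEquiv.ofBijective _ (CyclicHKR.polyvecDivTop_bijective w)).symm⟩
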